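/- Let $h_k(x)=\pi^{-1/4}(2^k k!)^{-1/2}H_k(x)e^{-x^2/2}$, with $H_k(x)=(-1)^k e^{x^2}\frac{d^k}{dx^k}e^{-x^2}$, be the $L^2(\mathbb R)$-normalized Hermite functions. For $\alpha>0$ put $h_k^\alpha(x)=\alpha^{-1/2}h_k(x/\alpha)$ and, for $f\in L^2(\mathbb R)$ and an integer $n\ge 0$, $K_n^\alpha f=\sum_{k=0}^n\langle f,h_k^\alpha\rangle h_k^\alpha$. Let $\widehat f$ denote the Fourier transform on $L^2(\mathbb R)$ normalized by $\widehat f(\omega)=\frac1{\sqrt{2\pi}}\int_{\mathbb R}f(t)e^{-it\omega}\,dt$ for $f\in L^1(\mathbb R)\cap L^2(\mathbb R)$. Let $\alpha>0$, $T\ge 2$, $c\ge 2/\alpha$ and $\varepsilon_T,\varepsilon_{c/\alpha}\ge 0$. Let $f\in L^2(\mathbb R)$ (complex-valued) satisfy $$\int_{|t|>T}|f(t)|^2\,dt\le\varepsilon_T^2\|f\|_{L^2(\mathbb R)}^2\quad\text{and}\quad\int_{|\omega|>c/\alpha}|\widehat f(\omega)|^2\,d\omega\le\varepsilon_{c/\alpha}^2\|f\|_{L^2(\mathbb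 R)}^2 .$$ Then, for every integer $n\ge\max\bigl(2(T/\alpha)^2,\,2c^2\bigr)$, $$\|f-K_n^\alpha f\|_{L^2([-T,T])}\le\Bigl(\varepsilon_T+\varepsilon_{c/\alpha}+\frac{34\,(T/\alpha)^3}{\sqrt{2n+1}}\Bigr)\|f\|_{L^2(\mathbb R)} .$$ -/

import Mathlib

open MeasureTheory
open scoped ENNReal FourierTransform

noncomputable section

/-- The Hermite polynomial function `H_k(x) = (-1)^k e^{x^2} (d/dx)^k e^{-x^2}`. -/
def physHermite (k : ℕ) (x : ℝ) : ℝ :=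
  (-1) ^ k * Real.exp (x ^ 2) * iteratedDeriv k (fun t : ℝ => Real.exp (-t ^ 2)) x

/-- The `L²`-normalized Hermite function
`h_k(x) = π^{-1/4} (2^k k!)^{-1/2} H_k(x) e^{-x^2/2}`. -/
def hermiteFun (k : ℕ) (x : ℝ) : ℝ :=
  1 / (Real.pi ^ (1 / 4 : ℝ) * √(2 ^ k * (k.factorial : ℝ))) *
    physHermite k x * Real.exp (-x ^ 2 / 2)

/-- The scaled Hermite function `h_k^α(x) = α^{-1/2} h_k(x / α)`. -/
def scaledHermiteFun (α : ℝ) (k : ℕ) (x : ℝ) : ℝ :=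
  α ^ (-(1 / 2) : ℝ) * hermiteFun k (x / α)

/-- `K_n^α f = ∑_{k=0}^n ⟨f, h_k^α⟩ h_k^α`. -/
def scaledHermiteProj (α : ℝ) (n : ℕ) (f : ℝ → ℂ) (x : ℝ) : ℂ :=
  ∑ k ∈ Finset.range (n + 1),
    (∫ t : ℝ, f t * (scaledHermiteFun α k t : ℂ)) * (scaledHermiteFun α k x : ℂ)

/-- The unitary Fourier transform on `L²(ℝ)` in the variable `ω`, that is, the `L²`-extension of
`f̂(ω) = (2π)^{-1/2} ∫ f(t) e^{-itω} dt`. Here `𝓕` is Mathlib's Fourier–Plancherel transform on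
`L²`, which extends `f ↦ ∫ f(t) e^{-2πitξ} dt`; hence `f̂(ω) = (2π)^{-1/2} (𝓕 f)(ω / 2π)`. -/
def unitaryFourier (f : Lp ℂ 2 (volume : Measure ℝ)) (ω : ℝ) : ℂ :=
  ((√(2 * Real.pi))⁻¹ : ℝ) * (𝓕 f : Lp ℂ 2 (volume : Measure ℝ)) (ω / (2 * Real.pi))

/-- `f` is `ε`-almost time limited to `[-T, T]`. -/
def IsAlmostTimeLimited (f : Lp ℂ 2 (volume : Measure ℝ)) (ε T : ℝ) : Prop :=
  ∫ t in {t : ℝ | T < |t|}, ‖f t‖ ^ 2 ≤ ε ^ 2 * ‖f‖ ^ 2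

/-- `f` is `ε`-almost band limited to `[-Ω, Ω]`. -/
def IsAlmostBandLimited (f : Lp ℂ 2 (volume : Measure ℝ)) (ε Ω : ℝ) : Prop :=
  ∫ ω in {ω : ℝ | Ω < |ω|}, ‖unitaryFourier f ω‖ ^ 2 ≤ ε ^ 2 * ‖f‖ ^ 2

end

/-! Let P restrict to [-T, T], let Q project onto a frequency band and let K be the Hermite
projection; put t = T/α, N = √(2n+1). Widening the band only lowers the band defect, so its
half-width c (in the variable x/α) may be chosen with 2c² = n. The claim becomes ‖P(f - Kf)‖ ≤ ‖f -
Pf‖ + ‖f - Qf‖ + ℓ‖f‖ with ℓ = 34t³/N. Both defects must carry coefficient exactly 1, which crude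
triangle inequalities do not give. What saves the constants is that PK has norm at most 1/2 on the
kernel of P (`two_mul_norm_proj_proj_le`).

Two mechanisms produce ℓ. In `norm_proj_sub_le_of_contraction`, Qf is multiplied by a window,
leaving a bias P(1 - Θ)Qf and a loss P(1 - K)ΘQf. The window e^{-y²/2} cosh(y/√M)^M differs from 1
by at most y⁴/(4M), and its modulations are averages of Gaussians. The Hermite coefficients of a
Gaussian are explicit, so the energy missed by K is a tail of the exponential series; by duality the
loss is at most the integral of these tails over the band (`norm_sq_window_loss_le`). That integral
decays exponentially in n because ω² ≤ n/2 there.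

For very small t the loss is no longer of size t³/N, and `norm_proj_sub_le_of_dominated` takes over:
it suffices that ‖Qw‖² ≤ ‖Kw‖² + O(ℓ)‖w‖² for w = Pf. Up to small errors Qw depends only on the
zeroth and first moments of w, and Hermite functions near the origin capture these moments with room
to spare: heuristically K acts there like a band projection of half-width √(2n) = 2c, twice that of
Q.

The case ℓ ≥ 1 is trivial. Otherwise tN > 40 uses the window with M about n/16, and tN ≤ 40 uses M =
1 or the moments, according to the size of ct (small n) or t²(2n+1)³ (large n). -/

/-! ### Pairs and triples of orthogonal projections in a Hilbert space -/

section HilbertProjections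

variable {E : Type*} [NormedAddCommGroup E] [InnerProductSpace ℂ E]

/-- A continuous linear operator that is idempotent and symmetric. -/
structure IsOrthoProj (P : E →L[ℂ] E) : Prop where
  idem : ∀ x, P (P x) = P x
  symm : ∀ x y, inner ℂ (P x) y = inner ℂ x (P y)

namespace IsOrthoProj

variable {P Q K : E →L[ℂ] E}

theorem inner_proj_compl (hP : IsOrthoProj P) (x y : E) : inner ℂ (P x) (y - P y) = 0 := by
  rw [hP.symm, map_sub, hP.idem, sub_self, inner_zero_right]

theorem norm_add_sq (hP : IsOrthoProj P) {a b : E} (ha : P a = a) (hb : P b = 0) :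
    ‖a + b‖ ^ 2 = ‖a‖ ^ 2 + ‖b‖ ^ 2 := by
  have h : inner ℂ a b = 0 := by
    rw [← ha, hP.symm, hb, inner_zero_right]
  simpa [pow_two] using norm_add_sq_eq_norm_sq_add_norm_sq_of_inner_eq_zero a b h

theorem pyth (hP : IsOrthoProj P) (x : E) : ‖x‖ ^ 2 = ‖P x‖ ^ 2 + ‖x - P x‖ ^ 2 := by
  have h := hP.norm_add_sq (a := P x) (b := x - P x) (hP.idem x) (by simp [hP.idem])
  simpa using h

theorem norm_le (hP : IsOrthoProj P) (x : E) : ‖P x‖ ≤ ‖x‖ := by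
  have h := hP.pyth x
  exact le_of_sq_le_sq (by nlinarith [sq_nonneg ‖x - P x‖]) (norm_nonneg _)

theorem norm_compl_le (hP : IsOrthoProj P) (x : E) : ‖x - P x‖ ≤ ‖x‖ := by
  have h := hP.pyth x
  exact le_of_sq_le_sq (by nlinarith [sq_nonneg ‖P x‖]) (norm_nonneg _)

theorem inner_self (hP : IsOrthoProj P) (x : E) : inner ℂ x (P x) = (‖P x‖ : ℂ) ^ 2 := by
  have h : inner ℂ (P x) (P x) = (‖P x‖ : ℂ) ^ 2 := inner_self_eq_norm_sq_to_K _
  rw [← h, hP.symm, hP.idem]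

/-- A vector in the kernel of `P` loses at least half of its norm under `P K`. -/
theorem two_mul_norm_proj_proj_le (hP : IsOrthoProj P) (hK : IsOrthoProj K) {b : E}
    (hb : P b = 0) : 2 * ‖P (K b)‖ ≤ ‖b‖ := by
  have h1 : (‖K b‖ : ℝ) ^ 2 ≤ ‖b‖ * ‖K b - P (K b)‖ := by
    have h2 : inner ℂ b (K b - P (K b)) = (‖K b‖ : ℂ) ^ 2 := by
      rw [inner_sub_right, hK.inner_self, ← hP.symm, hb, inner_zero_left, sub_zero]
    have h3 := norm_inner_le_norm (𝕜 := ℂ) b (K b - P (K b))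
    rw [h2] at h3
    simpa using h3
  have h2 := hP.pyth (K b)
  have h4 : ‖K b‖ ^ 2 = ‖P (K b)‖ ^ 2 + ‖K b - P (K b)‖ ^ 2 := h2
  refine le_of_sq_le_sq ?_ (norm_nonneg _)
  -- With s = ‖Kb - PKb‖, Pythagoras gives ‖PKb‖² ≤ ‖b‖s - s² ≤ ‖b‖²/4.
  nlinarith [sq_nonneg (‖b‖ - 2 * ‖K b - P (K b)‖)]

end IsOrthoProj

theorem exists_add_norm_le {b : E} {p q : ℝ} (hp : 0 ≤ p) (hq : 0 ≤ q) (h : ‖b‖ ≤ p + q) :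
    ∃ t : ℝ, ‖((1 - t : ℝ) : ℂ) • b‖ ≤ p ∧ ‖(t : ℂ) • b‖ ≤ q := by
  rcases le_or_gt ‖b‖ q with hbq | hbq
  · exact ⟨1, by simpa using hp, by simpa using hbq⟩
  · have hb : 0 < ‖b‖ := hq.trans_lt hbq
    have h1 : q / ‖b‖ ≤ 1 := (div_le_one hb).2 hbq.le
    refine ⟨q / ‖b‖, ?_, ?_⟩
    · rw [norm_smul, Complex.norm_real, Real.norm_of_nonneg (by linarith), sub_mul,
        div_mul_cancel₀ _ hb.ne']
      linarith
    · rw [norm_smul, Complex.norm_real, Real.norm_of_nonneg (by positivity),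
        div_mul_cancel₀ _ hb.ne']

variable {P Q K : E →L[ℂ] E}

/-- Error of the projection `K` inside the range of `P`, for a vector which is nearly in the ranges
of `P` and `Q`: an auxiliary contraction `Θ` commuting with `P` localizes the range of `Q`. -/
theorem norm_proj_sub_le_of_contraction (hP : IsOrthoProj P)
    (hK : IsOrthoProj K) {Θ : E →L[ℂ] E} (hΘ : ∀ x, ‖Θ x‖ ≤ ‖x‖)
    (hPΘ : ∀ x, P (Θ x) = Θ (P x)) (f : E) :
    ‖P (f - K f)‖ ≤ ‖f - P f‖ + ‖f - Q f‖ + ‖P (Q f - Θ (Q f))‖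
      + ‖P (Θ (Q f) - K (Θ (Q f)))‖ := by
  set y := f - Θ (Q f) with hy
  set b := y - P y with hb
  have hPb : P b = 0 := by simp [hb, hP.idem]
  -- The factor 2 arises because f - Pf enters once directly and once through (1 - P)Qf, as P
  -- commutes with Θ.
  have hbn : ‖b‖ ≤ 2 * ‖f - P f‖ + ‖(f - Q f) - P (f - Q f)‖ := by
    have e1 : b = (f - P f) - Θ (Q f - P (Q f)) := by
      simp only [hb, hy, map_sub, hPΘ]; abel
    have e2 : Q f - P (Q f) = (f - P f) - ((f - Q f) - P (f - Q f)) := by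
      simp only [map_sub]; abel
    have h1 := norm_sub_le (f - P f) (Θ (Q f - P (Q f)))
    have h2 := hΘ (Q f - P (Q f))
    have h3 := norm_sub_le (f - P f) ((f - Q f) - P (f - Q f))
    rw [← e2] at h3
    rw [e1]
    linarith
  -- The part b1 of size 2‖f - Pf‖ will be halved by PK; the part b2 of size ‖(1 - P)(f - Qf)‖ will
  -- be recombined orthogonally with P(f - Qf).
  obtain ⟨t, ht1, ht2⟩ := exists_add_norm_le (by positivity) (norm_nonneg _) hbn
  set b1 := ((1 - t : ℝ) : ℂ) • b
  set b2 := (t : ℂ) • b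
  have hb12 : b1 + b2 = b := by
    simp only [b1, b2, ← add_smul]; simp
  have hPb1 : P b1 = 0 := by simp [b1, hPb]
  have hPb2 : P b2 = 0 := by simp [b2, hPb]
  set a := P (f - Q f)
  set e := P (Q f - Θ (Q f))
  have hya : y = (a + b2) + e + b1 := by
    have : P y = a + e := by simp only [a, e, hy, ← map_add]; congr 1; abel
    have h2 : y = P y + b := by simp [hb]
    rw [h2, this, ← hb12]; abel
  have hdec : P (f - K f) = P ((a + b2) - K (a + b2)) + P (e - K e) + P (b1 - K b1)
      + P (Θ (Q f) - K (Θ (Q f))) := by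
    have : f = y + Θ (Q f) := by simp [hy]
    conv_lhs => rw [this, hya]
    simp only [map_sub, map_add]
    abel
  have n1 : ‖P ((a + b2) - K (a + b2))‖ ≤ ‖f - Q f‖ := by
    refine (hP.norm_le _).trans ((hK.norm_compl_le _).trans ?_)
    refine le_of_sq_le_sq ?_ (norm_nonneg _)
    rw [hP.norm_add_sq (hP.idem _) hPb2, hP.pyth (f - Q f)]
    gcongr
  have n2 : ‖P (e - K e)‖ ≤ ‖e‖ := (hP.norm_le _).trans (hK.norm_compl_le _)
  have n3 : ‖P (b1 - K b1)‖ ≤ ‖f - P f‖ := by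
    have := hP.two_mul_norm_proj_proj_le hK hPb1
    rw [map_sub, hPb1, zero_sub, norm_neg]
    linarith
  rw [hdec]
  refine (norm_add_le _ _).trans ?_
  have h1 := norm_add_le (P ((a + b2) - K (a + b2)) + P (e - K e)) (P (b1 - K b1))
  have h2 := norm_add_le (P ((a + b2) - K (a + b2))) (P (e - K e))
  linarith

/-- Error of the projection `K` inside the range of `P` when `P` and `Q` are far apart and `K`
dominates `Q` on the range of `P`. -/
theorem norm_proj_sub_le_of_dominated (hP : IsOrthoProj P) (hQ : IsOrthoProj Q)
    (hK : IsOrthoProj K) {ℓ : ℝ} (hℓ : 0 ≤ ℓ) (f : E)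
    (h4 : 4 * ‖Q (P f)‖ ^ 2 ≤ ‖P f‖ ^ 2)
    (hdom : ‖Q (P f)‖ ^ 2 ≤ ‖K (P f)‖ ^ 2 + 17 / 10 * ℓ * ‖P f‖ ^ 2) :
    ‖P (f - K f)‖ ≤ ‖f - P f‖ + ‖f - Q f‖ + ℓ * ‖f‖ := by
  set w := P f with hw
  set r := f - w with hr
  have hPr : P r = 0 := by simp [hr, hw, hP.idem]
  have hfr : f = w + r := by simp [hr]
  set X := ‖w - Q w‖ with hX
  have hX0 : 0 ≤ X := norm_nonneg _
  have hwX := hQ.pyth w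
  -- 17/20 is a rational lower bound for √3/2; twice it is the 17/10 of `hdom`, which lets the
  -- square (X + ℓ‖w‖)² be completed.
  have hX34 : 17 / 20 * ‖w‖ ≤ X := by
    refine le_of_sq_le_sq ?_ hX0
    nlinarith [sq_nonneg ‖w‖]
  have hA : ‖w - K w‖ ≤ X + ℓ * ‖w‖ := by
    refine le_of_sq_le_sq ?_ (by positivity)
    have h1 := hK.pyth w
    have h2 : 17 / 20 * ‖w‖ * (ℓ * ‖w‖) ≤ X * (ℓ * ‖w‖) := by gcongr
    nlinarith [sq_nonneg (ℓ * ‖w‖)]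
  have hB : ‖P (f - K f)‖ ≤ ‖w - K w‖ + ‖r‖ / 2 := by
    have e : P (f - K f) = P (w - K w) + P (r - K r) := by
      conv_lhs => rw [hfr]
      simp only [map_sub, map_add]; abel
    have h1 := hP.norm_le (w - K w)
    have h2 : ‖P (r - K r)‖ ≤ ‖r‖ / 2 := by
      have := hP.two_mul_norm_proj_proj_le hK hPr
      rw [map_sub, hPr, zero_sub, norm_neg]; linarith
    rw [e]
    exact (norm_add_le _ _).trans (add_le_add h1 h2)
  have hwf : ‖w‖ ≤ ‖f‖ := hP.norm_le f
  -- Pairing w - Qw with f - Qf returns X² up to ⟨(1 - P)Qw, r⟩, and (1 - P)Qw has norm at most X/2.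
  -- This half and the half in `hB` add up to one full ‖r‖.
  have hC : X ≤ ‖f - Q f‖ + ‖r‖ / 2 := by
    rcases hX0.eq_or_lt with h0 | hpos
    · rw [← h0]; positivity
    have hw0 : 0 < ‖w‖ := by
      by_contra h
      have : ‖w‖ = 0 := le_antisymm (not_lt.1 h) (norm_nonneg _)
      have := hQ.norm_compl_le w
      linarith
    have e1 : inner ℂ (w - Q w) (f - Q f) = (X : ℂ) ^ 2 - inner ℂ (Q w - P (Q w)) r := by
      have a1 : inner ℂ (w - Q w) (Q f) = 0 := by
        rw [← inner_conj_symm, hQ.inner_proj_compl, map_zero]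
      have a2 : inner ℂ (w - Q w) (Q w) = 0 := by
        rw [← inner_conj_symm, hQ.inner_proj_compl, map_zero]
      have a3 : inner ℂ (w - Q w) (w - Q w) = (X : ℂ) ^ 2 := inner_self_eq_norm_sq_to_K _
      rw [inner_sub_right, a2, sub_zero] at a3
      have a4 : inner ℂ w r = 0 := hP.inner_proj_compl f f
      have a5 : inner ℂ (P (Q w)) r = 0 := by rw [hP.symm, hPr, inner_zero_right]
      rw [inner_sub_right, a1, sub_zero]
      conv_lhs => rw [hfr]
      rw [inner_add_right, a3, inner_sub_left w, a4, inner_sub_left, a5]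
      ring
    have h1 : X ^ 2 - ‖Q w - P (Q w)‖ * ‖r‖ ≤ X * ‖f - Q f‖ := by
      have b1 := norm_inner_le_norm (𝕜 := ℂ) (w - Q w) (f - Q f)
      have b2 := norm_inner_le_norm (𝕜 := ℂ) (Q w - P (Q w)) r
      have b3 := norm_sub_norm_le ((X : ℂ) ^ 2) (inner ℂ (Q w - P (Q w)) r)
      rw [← e1] at b3
      have b4 : ‖(X : ℂ) ^ 2‖ = X ^ 2 := by simp
      linarith
    -- From ‖Qw‖² ≤ ‖w‖‖PQw‖ one gets ‖(1 - P)Qw‖² ≤ ‖Qw‖²X²/‖w‖², and the hypothesis bounds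
    -- ‖Qw‖²/‖w‖² by 1/4.
    have h2 : 2 * ‖Q w - P (Q w)‖ ≤ X := by
      have c1 := hP.pyth (Q w)
      have c2 : ‖Q w‖ ^ 2 ≤ ‖w‖ * ‖P (Q w)‖ := by
        have d1 : inner ℂ w (P (Q w)) = (‖Q w‖ : ℂ) ^ 2 := by
          rw [← hP.symm, show P w = w from hP.idem f, hQ.inner_self]
        have := norm_inner_le_norm (𝕜 := ℂ) w (P (Q w))
        rw [d1] at this
        simpa using this
      refine le_of_sq_le_sq ?_ hX0
      have c3 : ‖Q w‖ ^ 2 * ‖Q w‖ ^ 2 ≤ ‖w‖ ^ 2 * ‖P (Q w)‖ ^ 2 := by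
        have := mul_self_le_mul_self (sq_nonneg _) c2
        nlinarith
      have c4 : ‖w‖ ^ 2 * ‖Q w - P (Q w)‖ ^ 2 ≤ ‖Q w‖ ^ 2 * X ^ 2 := by nlinarith
      have c5 : ‖w‖ ^ 2 * (4 * ‖Q w - P (Q w)‖ ^ 2) ≤ ‖w‖ ^ 2 * X ^ 2 := by
        nlinarith [sq_nonneg X]
      have := le_of_mul_le_mul_left c5 (by positivity)
      nlinarith
    have h3 : X * X ≤ X * (‖f - Q f‖ + ‖r‖ / 2) := by
      nlinarith [norm_nonneg r]
    exact le_of_mul_le_mul_left h3 hpos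
  have : ℓ * ‖w‖ ≤ ℓ * ‖f‖ := by gcongr
  linarith

end HilbertProjections

/-! ### Time and band projections on L² -/

section LTwo

/-- Complex-valued square-integrable functions on the line. -/
local notation "L²" => Lp ℂ 2 (volume : Measure ℝ)

/-- On an integrable element of `L²`, the Fourier–Plancherel transform is the Fourier integral. -/
theorem fourier_coeFn_ae_eq (g : L²) (hg : Integrable g) :
    (𝓕 g : L²) =ᵐ[volume] 𝓕 (g : ℝ → ℂ) := by
  have hcont : Continuous (𝓕 (g : ℝ → ℂ)) :=
    VectorFourier.fourierIntegral_continuous Real.continuous_fourierChar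
      (by fun_prop) hg
  -- Both sides have the same pairing with every test function: the distributional transform gives
  -- it for one, the Fubini flip for the other.
  refine ae_eq_of_integral_contDiff_smul_eq
    ((Lp.memLp (𝓕 g : L²)).locallyIntegrable (by norm_num)) hcont.locallyIntegrable ?_
  intro ψ hψ hψc
  have h1 : ContDiff ℝ (⊤ : ℕ∞) (fun x => (ψ x : ℂ)) := Complex.ofRealCLM.contDiff.comp hψ
  have h2 : HasCompactSupport (fun x => (ψ x : ℂ)) := hψc.comp_left (g := Complex.ofReal) rfl
  set φ := h2.toSchwartzMap h1
  have h3 : ∀ x, φ x = (ψ x : ℂ) := fun x => rfl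
  have key := congrArg (fun S => S φ) (Lp.fourier_toTemperedDistribution_eq g)
  simp only [TemperedDistribution.fourier_apply, Lp.toTemperedDistribution_apply] at key
  have h4 : ∫ x, (𝓕 φ : SchwartzMap ℝ ℂ) x • g x = ∫ x, φ x • 𝓕 (g : ℝ → ℂ) x := by
    simpa using! (VectorFourier.integral_fourierIntegral_smul_eq_flip (L := innerₗ ℝ)
      (f := φ) (g := g) Real.continuous_fourierChar (by fun_prop) φ.integrable hg)
  have h5 : ∫ x, φ x • (𝓕 g : L²) x = ∫ x, φ x • 𝓕 (g : ℝ → ℂ) x := key.symm.trans h4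
  simpa [h3] using h5

theorem norm_sq_eq_integral (f : L²) : ‖f‖ ^ 2 = ∫ x, ‖f x‖ ^ 2 := by
  have h : (inner ℂ f f : ℂ) = ∫ x, (inner ℂ (f x) (f x) : ℂ) := L2.inner_def f f
  have h2 : ∀ x, (inner ℂ (f x) (f x) : ℂ) = ((‖f x‖ ^ 2 : ℝ) : ℂ) := fun x => by
    rw [inner_self_eq_norm_sq_to_K]; norm_cast
  have h3 : (inner ℂ f f : ℂ) = ((‖f‖ ^ 2 : ℝ) : ℂ) := by
    rw [inner_self_eq_norm_sq_to_K]; norm_cast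
  simp only [h2, integral_complex_ofReal, h3] at h
  exact_mod_cast h

theorem integrable_norm_sq (f : L²) : Integrable (fun x => ‖f x‖ ^ 2) :=
  (memLp_two_iff_integrable_sq_norm (Lp.memLp f).1).1 (Lp.memLp f)

theorem memLp_bounded_mul (g : ℝ → ℝ) (hg : Measurable g) (hb : ∀ x, |g x| ≤ 1) (f : L²) :
    MemLp (fun x => (g x : ℂ) * f x) 2 volume := by
  refine (Lp.memLp f).mono ?_ (ae_of_all _ fun x => ?_)
  · exact ((Complex.measurable_ofReal.comp hg).aestronglyMeasurable).mul (Lp.memLp f).1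
  · rw [norm_mul, Complex.norm_real]
    exact mul_le_of_le_one_left (norm_nonneg _) (hb x)

/-- Multiplication by a measurable function with values in `[-1, 1]`, as an operator on `L²`. -/
noncomputable def mulLTwo (g : ℝ → ℝ) (hg : Measurable g) (hb : ∀ x, |g x| ≤ 1) : L² →L[ℂ] L² :=
  LinearMap.mkContinuous
    { toFun := fun f => (memLp_bounded_mul g hg hb f).toLp _
      map_add' := fun f₁ f₂ => by
        ext1
        filter_upwards [MemLp.coeFn_toLp (memLp_bounded_mul g hg hb (f₁ + f₂)),
          Lp.coeFn_add ((memLp_bounded_mul g hg hb f₁).toLp _)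
            ((memLp_bounded_mul g hg hb f₂).toLp _),
          MemLp.coeFn_toLp (memLp_bounded_mul g hg hb f₁),
          MemLp.coeFn_toLp (memLp_bounded_mul g hg hb f₂), Lp.coeFn_add f₁ f₂]
          with x h1 h2 h3 h4 h5
        rw [h1, h2, Pi.add_apply, h3, h4, h5, Pi.add_apply, mul_add]
      map_smul' := fun c f => by
        ext1
        filter_upwards [MemLp.coeFn_toLp (memLp_bounded_mul g hg hb (c • f)),
          Lp.coeFn_smul c ((memLp_bounded_mul g hg hb f).toLp _),
          MemLp.coeFn_toLp (memLp_bounded_mul g hg hb f), Lp.coeFn_smul c f]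
          with x h1 h2 h3 h4
        rw [h1, RingHom.id_apply, h2, Pi.smul_apply, h3, h4, Pi.smul_apply, smul_eq_mul,
          smul_eq_mul]
        ring }
    1 (fun f => by
      rw [one_mul]
      refine Lp.norm_le_norm_of_ae_le ?_
      filter_upwards [MemLp.coeFn_toLp (memLp_bounded_mul g hg hb f)] with x hx
      change ‖((memLp_bounded_mul g hg hb f).toLp _ : ℝ → ℂ) x‖ ≤ _
      rw [hx, norm_mul, Complex.norm_real]
      exact mul_le_of_le_one_left (norm_nonneg _) (hb x))

variable {g h : ℝ → ℝ} {hg : Measurable g} {hb : ∀ x, |g x| ≤ 1}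
  {hh : Measurable h} {hhb : ∀ x, |h x| ≤ 1}

theorem mulLTwo_ae (f : L²) : mulLTwo g hg hb f =ᵐ[volume] fun x => (g x : ℂ) * f x :=
  MemLp.coeFn_toLp (memLp_bounded_mul g hg hb f)

theorem norm_mulLTwo_le (f : L²) : ‖mulLTwo g hg hb f‖ ≤ ‖f‖ := by
  refine Lp.norm_le_norm_of_ae_le ?_
  filter_upwards [mulLTwo_ae (hg := hg) (hb := hb) f] with x hx
  rw [hx, norm_mul, Complex.norm_real]
  exact mul_le_of_le_one_left (norm_nonneg _) (hb x)

theorem mulLTwo_comm (f : L²) :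
    mulLTwo g hg hb (mulLTwo h hh hhb f) = mulLTwo h hh hhb (mulLTwo g hg hb f) := by
  ext1
  filter_upwards [mulLTwo_ae (hg := hg) (hb := hb) f, mulLTwo_ae (hg := hh) (hb := hhb) f,
    mulLTwo_ae (hg := hg) (hb := hb) (mulLTwo h hh hhb f),
    mulLTwo_ae (hg := hh) (hb := hhb) (mulLTwo g hg hb f)] with x h1 h2 h3 h4
  rw [h3, h4, h1, h2]
  ring

theorem mulLTwo_symm (f₁ f₂ : L²) :
    inner ℂ (mulLTwo g hg hb f₁) f₂ = inner ℂ f₁ (mulLTwo g hg hb f₂) := by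
  rw [L2.inner_def, L2.inner_def]
  refine integral_congr_ae ?_
  filter_upwards [mulLTwo_ae (hg := hg) (hb := hb) f₁, mulLTwo_ae (hg := hg) (hb := hb) f₂]
    with x h1 h2
  rw [h1, h2]
  simp only [RCLike.inner_apply, map_mul, Complex.conj_ofReal]
  ring

theorem mulLTwo_isOrthoProj (hidem : ∀ x, g x * g x = g x) : IsOrthoProj (mulLTwo g hg hb) where
  idem f := by
    ext1
    filter_upwards [mulLTwo_ae (hg := hg) (hb := hb) f,
      mulLTwo_ae (hg := hg) (hb := hb) (mulLTwo g hg hb f)] with x h1 h2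
    rw [h2, h1, ← mul_assoc]
    congr 1
    exact_mod_cast hidem x
  symm := mulLTwo_symm

/-- The indicator function of `[-T, T]`. -/
noncomputable def intervalInd (T : ℝ) (x : ℝ) : ℝ := {t : ℝ | |t| ≤ T}.indicator 1 x

theorem measurable_intervalInd (T : ℝ) : Measurable (intervalInd T) :=
  measurable_one.indicator (measurableSet_le continuous_abs.measurable measurable_const)

theorem abs_intervalInd_le (T x : ℝ) : |intervalInd T x| ≤ 1 := by
  by_cases h : |x| ≤ T <;> simp [intervalInd, h]

theorem intervalInd_of_le {T x : ℝ} (h : |x| ≤ T) : intervalInd T x = 1 := by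
  simp [intervalInd, h]

theorem intervalInd_of_lt {T x : ℝ} (h : T < |x|) : intervalInd T x = 0 := by
  simp [intervalInd, h]

/-- The projection of `L²` onto the functions supported in `[-T, T]`. -/
noncomputable def timeProj (T : ℝ) : L² →L[ℂ] L² :=
  mulLTwo (intervalInd T) (measurable_intervalInd T) (abs_intervalInd_le T)

/-- The projection of `L²` onto the functions with Fourier transform supported in `[-B, B]`. -/
noncomputable def bandProj (B : ℝ) : L² →L[ℂ] L² :=
  ((Lp.fourierTransformₗᵢ ℝ ℂ).symm.toContinuousLinearEquiv : L² →L[ℂ] L²) ∘L timeProj B ∘L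
    ((Lp.fourierTransformₗᵢ ℝ ℂ).toContinuousLinearEquiv : L² →L[ℂ] L²)

theorem timeProj_isOrthoProj (T : ℝ) : IsOrthoProj (timeProj T) :=
  mulLTwo_isOrthoProj fun x => by by_cases h : |x| ≤ T <;> simp [intervalInd, h]

theorem bandProj_eq (B : ℝ) (f : L²) : bandProj B f = 𝓕⁻ (timeProj B (𝓕 f)) := rfl

theorem fourier_bandProj (B : ℝ) (f : L²) : (𝓕 (bandProj B f) : L²) = timeProj B (𝓕 f) := by
  rw [bandProj_eq, FourierTransform.fourier_fourierInv_eq]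

theorem bandProj_isOrthoProj (B : ℝ) : IsOrthoProj (bandProj B) where
  idem f := by
    rw [bandProj_eq, fourier_bandProj, (timeProj_isOrthoProj B).idem, bandProj_eq]
  symm f₁ f₂ := by
    rw [← Lp.inner_fourier_eq (bandProj B f₁), ← Lp.inner_fourier_eq f₁, fourier_bandProj,
      fourier_bandProj, (timeProj_isOrthoProj B).symm]

theorem norm_bandProj (B : ℝ) (f : L²) : ‖bandProj B f‖ = ‖timeProj B (𝓕 f)‖ := by
  rw [← Lp.norm_fourier_eq (bandProj B f), fourier_bandProj]

theorem norm_sub_bandProj (B : ℝ) (f : L²) :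
    ‖f - bandProj B f‖ = ‖(𝓕 f : L²) - timeProj B (𝓕 f)‖ := by
  have h : (𝓕 (f - bandProj B f) : L²) = 𝓕 f - 𝓕 (bandProj B f) :=
    (Lp.fourierTransformₗᵢ ℝ ℂ).map_sub f (bandProj B f)
  rw [← Lp.norm_fourier_eq (f - bandProj B f), h, fourier_bandProj]

theorem timeProj_ae (T : ℝ) (f : L²) :
    timeProj T f =ᵐ[volume] fun x => (intervalInd T x : ℂ) * f x := mulLTwo_ae f

theorem norm_sq_timeProj (T : ℝ) (f : L²) :
    ‖timeProj T f‖ ^ 2 = ∫ x in {x : ℝ | |x| ≤ T}, ‖f x‖ ^ 2 := by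
  rw [norm_sq_eq_integral, ← integral_indicator
    (measurableSet_le continuous_abs.measurable measurable_const)]
  refine integral_congr_ae ?_
  filter_upwards [timeProj_ae T f] with x hx
  rw [hx]
  by_cases h : |x| ≤ T <;> simp [intervalInd, h]

theorem norm_sq_sub_timeProj (T : ℝ) (f : L²) :
    ‖f - timeProj T f‖ ^ 2 = ∫ x in {x : ℝ | T < |x|}, ‖f x‖ ^ 2 := by
  rw [norm_sq_eq_integral, ← integral_indicator
    (measurableSet_lt measurable_const continuous_abs.measurable)]
  refine integral_congr_ae ?_
  filter_upwards [timeProj_ae T f, Lp.coeFn_sub f (timeProj T f)] with x hx h2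
  rw [h2, Pi.sub_apply, hx]
  rcases le_or_gt |x| T with h | h
  · simp [intervalInd, h, not_lt.2 h]
  · simp [intervalInd, h, not_le.2 h]

theorem integrable_timeProj (T : ℝ) (f : L²) : Integrable (timeProj T f) := by
  have hfin : volume {x : ℝ | |x| ≤ T} < ∞ := by
    have : {x : ℝ | |x| ≤ T} = Set.Icc (-T) T := by ext x; simp [abs_le]
    rw [this]; exact measure_Icc_lt_top
  have hs : MeasurableSet {x : ℝ | |x| ≤ T} :=
    measurableSet_le continuous_abs.measurable measurable_const
  have h1 : IntegrableOn f {x : ℝ | |x| ≤ T} := by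
    have : IsFiniteMeasure (volume.restrict {x : ℝ | |x| ≤ T}) := ⟨by simpa using hfin⟩
    exact ((Lp.memLp f).restrict _).integrable (by norm_num)
  refine (h1.integrable_indicator hs).congr ?_
  filter_upwards [timeProj_ae T f] with x hx
  rw [hx]
  by_cases h : |x| ≤ T <;> simp [intervalInd, h]

theorem norm_sub_timeProj_mono {S T : ℝ} (h : S ≤ T) (f : L²) :
    ‖f - timeProj T f‖ ≤ ‖f - timeProj S f‖ := by
  refine le_of_sq_le_sq ?_ (norm_nonneg _)
  rw [norm_sq_sub_timeProj, norm_sq_sub_timeProj]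
  refine setIntegral_mono_set (integrable_norm_sq f).integrableOn (ae_of_all _ fun x => ?_)
    (Filter.Eventually.of_forall fun x hx => lt_of_le_of_lt h hx)
  positivity

theorem norm_sub_bandProj_mono {A B : ℝ} (h : A ≤ B) (f : L²) :
    ‖f - bandProj B f‖ ≤ ‖f - bandProj A f‖ := by
  rw [norm_sub_bandProj, norm_sub_bandProj]
  exact norm_sub_timeProj_mono h _

theorem IsAlmostTimeLimited.norm_sub_le {f : L²} {ε T : ℝ} (hε : 0 ≤ ε)
    (h : IsAlmostTimeLimited f ε T) : ‖f - timeProj T f‖ ≤ ε * ‖f‖ := by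
  refine le_of_sq_le_sq ?_ (by positivity)
  rw [norm_sq_sub_timeProj, mul_pow]
  exact h

/-- The substitution ω = 2πξ: the factor (2π)⁻¹ in the squared unitary transform is exactly its
Jacobian, and a band edge Ω becomes Ω/(2π). -/
theorem IsAlmostBandLimited.norm_sub_le {f : L²} {ε Ω : ℝ} (hε : 0 ≤ ε)
    (h : IsAlmostBandLimited f ε Ω) :
    ‖f - bandProj (Ω / (2 * Real.pi)) f‖ ≤ ε * ‖f‖ := by
  refine le_of_sq_le_sq ?_ (by positivity)
  rw [norm_sub_bandProj, norm_sq_sub_timeProj, mul_pow]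
  refine le_trans (le_of_eq ?_) h
  have hπ : (0 : ℝ) < 2 * Real.pi := by positivity
  set F : ℝ → ℝ := {ξ : ℝ | Ω / (2 * Real.pi) < |ξ|}.indicator (fun ξ => ‖(𝓕 f : L²) ξ‖ ^ 2)
  have e1 : ∫ ω in {ω : ℝ | Ω < |ω|}, ‖unitaryFourier f ω‖ ^ 2
      = ∫ ω, (2 * Real.pi)⁻¹ * F (ω / (2 * Real.pi)) := by
    rw [← integral_indicator (measurableSet_lt measurable_const continuous_abs.measurable)]
    refine integral_congr_ae (ae_of_all _ fun ω => ?_)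
    have h1 : Ω / (2 * Real.pi) < |ω / (2 * Real.pi)| ↔ Ω < |ω| := by
      rw [abs_div, abs_of_pos hπ, div_lt_div_iff_of_pos_right hπ]
    by_cases hω : Ω < |ω|
    · simp only [F, Set.indicator, Set.mem_ofPred_eq, hω, h1, if_true, unitaryFourier, norm_mul,
        Complex.norm_real, mul_pow, norm_inv, inv_pow, Real.norm_eq_abs, sq_abs]
      rw [Real.sq_sqrt hπ.le]
    · simp [F, Set.indicator, hω, h1]
  rw [e1, integral_const_mul, Measure.integral_comp_div F, abs_of_pos hπ, smul_eq_mul,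
    ← mul_assoc, inv_mul_cancel₀ hπ.ne', one_mul,
    integral_indicator (measurableSet_lt measurable_const continuous_abs.measurable)]

end LTwo

/-! ### Hermite functions: ladder relations, generating function, orthonormality -/

section HermiteFunctions

theorem contDiff_gaussian : ContDiff ℝ (⊤ : ℕ∞) (fun t : ℝ => Real.exp (-t ^ 2)) := by fun_prop

theorem hasDerivAt_iteratedDeriv_gaussian (k : ℕ) (x : ℝ) :
    HasDerivAt (iteratedDeriv k fun t : ℝ => Real.exp (-t ^ 2))
      (iteratedDeriv (k + 1) (fun t : ℝ => Real.exp (-t ^ 2)) x) x := by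
  rw [iteratedDeriv_succ]
  exact ((contDiff_gaussian.differentiable_iteratedDeriv k
    (by exact_mod_cast WithTop.coe_lt_top _)) x).hasDerivAt

theorem iteratedDeriv_gaussian_one (x : ℝ) :
    iteratedDeriv 1 (fun t : ℝ => Real.exp (-t ^ 2)) x
      = -2 * x * iteratedDeriv 0 (fun t : ℝ => Real.exp (-t ^ 2)) x := by
  have h : HasDerivAt (fun t : ℝ => Real.exp (-t ^ 2)) (Real.exp (-x ^ 2) * (-(2 * x))) x := by
    simpa using ((hasDerivAt_pow 2 x).neg).exp
  rw [iteratedDeriv_one, h.deriv, iteratedDeriv_zero]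
  ring

/-- Comes from differentiating g' = -2xg again and again; uniqueness of the derivative closes each
induction step. -/
theorem iteratedDeriv_gaussian_add_two (k : ℕ) (x : ℝ) :
    iteratedDeriv (k + 2) (fun t : ℝ => Real.exp (-t ^ 2)) x
      = -2 * x * iteratedDeriv (k + 1) (fun t : ℝ => Real.exp (-t ^ 2)) x
        - 2 * (k + 1) * iteratedDeriv k (fun t : ℝ => Real.exp (-t ^ 2)) x := by
  induction k generalizing x with
  | zero =>
    have h1 := hasDerivAt_iteratedDeriv_gaussian 1 x
    have h2 : HasDerivAt (iteratedDeriv 1 fun t : ℝ => Real.exp (-t ^ 2)) _ x :=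
      (((hasDerivAt_id x).const_mul (-2)).mul
        (hasDerivAt_iteratedDeriv_gaussian 0 x)).congr_of_eventuallyEq
        (Filter.Eventually.of_forall iteratedDeriv_gaussian_one)
    rw [h1.unique h2]
    simp
    ring
  | succ k ih =>
    have h1 := hasDerivAt_iteratedDeriv_gaussian (k + 2) x
    have h2 : HasDerivAt (iteratedDeriv (k + 2) fun t : ℝ => Real.exp (-t ^ 2)) _ x :=
      ((((hasDerivAt_id x).const_mul (-2)).mul
        (hasDerivAt_iteratedDeriv_gaussian (k + 1) x)).sub
        ((hasDerivAt_iteratedDeriv_gaussian k x).const_mul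
          (2 * ((k : ℝ) + 1)))).congr_of_eventuallyEq (Filter.Eventually.of_forall ih)
    rw [show k + 1 + 2 = k + 2 + 1 from rfl, h1.unique h2]
    push_cast
    simp
    ring

/-- The normalizing constant of the `k`-th Hermite function. -/
noncomputable def hermiteNorm (k : ℕ) : ℝ :=
  1 / (Real.pi ^ (1 / 4 : ℝ) * √(2 ^ k * (k.factorial : ℝ)))

theorem hermiteNorm_succ (k : ℕ) : √(2 * (k + 1)) * hermiteNorm (k + 1) = hermiteNorm k := by
  unfold hermiteNorm
  have h : (2 : ℝ) ^ (k + 1) * ((k + 1).factorial : ℝ)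
      = (2 * (k + 1)) * (2 ^ k * (k.factorial : ℝ)) := by
    rw [Nat.factorial_succ]; push_cast; ring
  rw [h, Real.sqrt_mul (by positivity : (0 : ℝ) ≤ 2 * ((k : ℝ) + 1)) (2 ^ k * (k.factorial : ℝ))]
  field_simp

theorem hermiteFun_eq (k : ℕ) (x : ℝ) :
    hermiteFun k x = hermiteNorm k * (-1) ^ k * Real.exp (x ^ 2 / 2) *
      iteratedDeriv k (fun t : ℝ => Real.exp (-t ^ 2)) x := by
  have h : Real.exp (x ^ 2) * Real.exp (-x ^ 2 / 2) = Real.exp (x ^ 2 / 2) := by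
    rw [← Real.exp_add]; congr 1; ring
  unfold hermiteFun physHermite hermiteNorm
  rw [← h]
  ring

theorem hermiteFun_zero (x : ℝ) : hermiteFun 0 x = hermiteNorm 0 * Real.exp (-x ^ 2 / 2) := by
  rw [hermiteFun_eq, iteratedDeriv_zero, pow_zero, mul_one, mul_assoc, ← Real.exp_add]
  congr 2; ring

/-- The raising relation. -/
theorem hasDerivAt_hermiteFun (k : ℕ) (x : ℝ) :
    HasDerivAt (hermiteFun k)
      (x * hermiteFun k x - √(2 * (k + 1)) * hermiteFun (k + 1) x) x := by
  have h0 : HasDerivAt (fun y : ℝ => y ^ 2 / 2) x x := by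
    simpa using (hasDerivAt_pow 2 x).div_const 2
  have h1 := ((h0.exp.const_mul (hermiteNorm k * (-1) ^ k)).mul
    (hasDerivAt_iteratedDeriv_gaussian k x)).congr_of_eventuallyEq
    (Filter.Eventually.of_forall (hermiteFun_eq k))
  refine h1.congr_deriv ?_
  rw [hermiteFun_eq, hermiteFun_eq, ← hermiteNorm_succ k]
  ring

theorem hermiteFun_recurrence (k : ℕ) (x : ℝ) :
    2 * x * hermiteFun (k + 1) x
      = √(2 * (k + 2)) * hermiteFun (k + 2) x + √(2 * (k + 1)) * hermiteFun k x := by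
  have h1 := hermiteNorm_succ (k + 1)
  have h2 : hermiteNorm (k + 1) * (2 * (k + 1)) = √(2 * (k + 1)) * hermiteNorm k := by
    have hs := Real.mul_self_sqrt (show (0 : ℝ) ≤ 2 * ((k : ℝ) + 1) by positivity)
    rw [← hermiteNorm_succ k]
    linear_combination -hermiteNorm (k + 1) * hs
  rw [hermiteFun_eq, hermiteFun_eq (k + 2), hermiteFun_eq k, iteratedDeriv_gaussian_add_two]
  push_cast at h1
  rw [show (k : ℝ) + 1 + 1 = k + 2 by ring] at h1
  set A := Real.exp (x ^ 2 / 2)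
  set G1 := iteratedDeriv (k + 1) (fun t : ℝ => Real.exp (-t ^ 2)) x
  set G0 := iteratedDeriv k (fun t : ℝ => Real.exp (-t ^ 2)) x
  have e : √(2 * (k + 2)) * (hermiteNorm (k + 2) * (-1) ^ (k + 2) * A
      * (-2 * x * G1 - 2 * (k + 1) * G0))
      = (√(2 * (k + 2)) * hermiteNorm (k + 2)) * (-1) ^ (k + 2) * A
      * (-2 * x * G1 - 2 * (k + 1) * G0) := by ring
  have e2 : √(2 * (k + 1)) * (hermiteNorm k * (-1) ^ k * A * G0)
      = (√(2 * (k + 1)) * hermiteNorm k) * (-1) ^ k * A * G0 := by ring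
  rw [e, show k + 2 = k + 1 + 1 from rfl, h1, e2, ← h2]
  ring

/-- The lowering relation. -/
theorem hasDerivAt_hermiteFun_succ (k : ℕ) (x : ℝ) :
    HasDerivAt (hermiteFun (k + 1))
      (-x * hermiteFun (k + 1) x + √(2 * (k + 1)) * hermiteFun k x) x := by
  have h := hasDerivAt_hermiteFun (k + 1) x
  refine h.congr_deriv ?_
  have h2 := hermiteFun_recurrence k x
  push_cast
  rw [show (k : ℝ) + 1 + 1 = k + 2 by ring]
  linarith

theorem hasDerivAt_hermiteFun_zero (x : ℝ) :
    HasDerivAt (hermiteFun 0) (-x * hermiteFun 0 x) x := by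
  have h0 : HasDerivAt (fun y : ℝ => -y ^ 2 / 2) (-x) x := by
    exact (((hasDerivAt_pow 2 x).neg).div_const 2).congr_deriv (by simp; ring)
  have h1 := (h0.exp.const_mul (hermiteNorm 0)).congr_of_eventuallyEq
    (Filter.Eventually.of_forall hermiteFun_zero)
  refine h1.congr_deriv ?_
  rw [hermiteFun_zero]; ring

theorem exists_polynomial_hermiteFun (k : ℕ) :
    ∃ p : Polynomial ℝ, ∀ x, hermiteFun k x = p.eval x * Real.exp (-x ^ 2 / 2) := by
  induction k with
  | zero => exact ⟨Polynomial.C (hermiteNorm 0), fun x => by simp [hermiteFun_zero]⟩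
  | succ k ih =>
    obtain ⟨p, hp⟩ := ih
    refine ⟨Polynomial.C (√(2 * (k + 1)))⁻¹ * (2 * Polynomial.X * p - Polynomial.derivative p),
      fun x => ?_⟩
    have h0 : HasDerivAt (fun y : ℝ => -y ^ 2 / 2) (-x) x := by
      exact (((hasDerivAt_pow 2 x).neg).div_const 2).congr_deriv (by simp; ring)
    have h1 := ((p.hasDerivAt x).mul h0.exp).congr_of_eventuallyEq (Filter.Eventually.of_forall hp)
    have h2 := (hasDerivAt_hermiteFun k x).unique h1
    have h3 : √(2 * ((k : ℝ) + 1)) ≠ 0 := by positivity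
    rw [hp] at h2
    simp only [Polynomial.eval_mul, Polynomial.eval_sub, Polynomial.eval_C, Polynomial.eval_X,
      Polynomial.eval_ofNat]
    apply mul_left_cancel₀ h3
    linear_combination (-1) * h2 - (2 * x * p.eval x - (Polynomial.derivative p).eval x)
      * Real.exp (-x ^ 2 / 2) * mul_inv_cancel₀ h3

theorem continuous_hermiteFun (k : ℕ) : Continuous (hermiteFun k) :=
  continuous_iff_continuousAt.2 fun x => (hasDerivAt_hermiteFun k x).continuousAt

/-- A monomial of degree m is at most m!(e^x + e^{-x}), and these exponentials only shift z by ±1 in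
the Gaussian. -/
theorem integrable_polynomial_mul_cexp (p : Polynomial ℝ) (z : ℂ) :
    Integrable (fun x : ℝ => ((p.eval x : ℝ) : ℂ) * Complex.exp (-(x : ℂ) ^ 2 + z * x)) := by
  induction p using Polynomial.induction_on' with
  | add p q hp hq =>
    refine (hp.add hq).congr (ae_of_all _ fun x => ?_)
    simp only [Pi.add_apply, Polynomial.eval_add, Complex.ofReal_add]
    ring
  | monomial m a =>
    have hq : ∀ w : ℂ, Integrable (fun x : ℝ => Complex.exp (-(x : ℂ) ^ 2 + w * x)) := fun w => by
      simpa using integrable_cexp_quadratic (b := 1) (by simp) w 0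
    have hs := ((hq (z + 1)).norm.add (hq (z - 1)).norm).const_mul (|a| * m.factorial)
    refine hs.mono' (Continuous.aestronglyMeasurable (by fun_prop)) (ae_of_all _ fun x => ?_)
    have h1 : |x| ^ m ≤ m.factorial * (Real.exp x + Real.exp (-x)) := by
      have := Real.pow_div_factorial_le_exp |x| (abs_nonneg x) m
      rw [div_le_iff₀ (by positivity)] at this
      have h2 : Real.exp |x| ≤ Real.exp x + Real.exp (-x) := by
        rcases abs_cases x with ⟨h, -⟩ | ⟨h, -⟩ <;> rw [h]
        · linarith [Real.exp_pos (-x)]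
        · linarith [Real.exp_pos x]
      calc |x| ^ m ≤ Real.exp |x| * m.factorial := this
        _ ≤ (Real.exp x + Real.exp (-x)) * m.factorial := by gcongr
        _ = _ := by ring
    have e1 : ‖Complex.exp (-(x : ℂ) ^ 2 + (z + 1) * x)‖
        = ‖Complex.exp (-(x : ℂ) ^ 2 + z * x)‖ * Real.exp x := by
      rw [Complex.norm_exp, Complex.norm_exp, ← Real.exp_add]; congr 1; simp; ring
    have e2 : ‖Complex.exp (-(x : ℂ) ^ 2 + (z - 1) * x)‖
        = ‖Complex.exp (-(x : ℂ) ^ 2 + z * x)‖ * Real.exp (-x) := by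
      rw [Complex.norm_exp, Complex.norm_exp, ← Real.exp_add]; congr 1; simp; ring
    rw [norm_mul, Complex.norm_real, Polynomial.eval_monomial, Real.norm_eq_abs, abs_mul, abs_pow]
    simp only [Pi.add_apply, e1, e2]
    calc |a| * |x| ^ m * ‖Complex.exp (-(x : ℂ) ^ 2 + z * x)‖
        ≤ |a| * (m.factorial * (Real.exp x + Real.exp (-x)))
          * ‖Complex.exp (-(x : ℂ) ^ 2 + z * x)‖ := by gcongr
      _ = _ := by ring

theorem integrable_hermiteFun_mul_cexp (k : ℕ) (z : ℂ) :
    Integrable (fun x : ℝ => (hermiteFun k x : ℂ) * Complex.exp (-(x : ℂ) ^ 2 / 2 + z * x)) := by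
  obtain ⟨p, hp⟩ := exists_polynomial_hermiteFun k
  refine (integrable_polynomial_mul_cexp p z).congr (ae_of_all _ fun x => ?_)
  simp only [hp]
  push_cast
  rw [mul_assoc, ← Complex.exp_add]
  congr 2; ring

theorem integrable_hermiteFun_mul_hermiteFun (j k : ℕ) :
    Integrable (fun x : ℝ => hermiteFun j x * hermiteFun k x) := by
  obtain ⟨p, hp⟩ := exists_polynomial_hermiteFun j
  obtain ⟨q, hq⟩ := exists_polynomial_hermiteFun k
  refine ((integrable_polynomial_mul_cexp (p * q) 0).re).congr (ae_of_all _ fun x => ?_)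
  have e : ((Polynomial.eval x (p * q) : ℝ) : ℂ) * Complex.exp (-(x : ℂ) ^ 2 + 0 * x)
      = ((Polynomial.eval x (p * q) * Real.exp (-x ^ 2) : ℝ) : ℂ) := by
    push_cast; simp
  have e2 : Real.exp (-x ^ 2) = Real.exp (-x ^ 2 / 2) * Real.exp (-x ^ 2 / 2) := by
    rw [← Real.exp_add]; congr 1; ring
  beta_reduce
  rw [e, RCLike.re_to_complex, Complex.ofReal_re, Polynomial.eval_mul, e2, hp, hq]
  ring

/-- The inner product of a Hermite function with a coherent state, recursively. -/
theorem integral_hermiteFun_succ_mul_cexp (k : ℕ) (z : ℂ) :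
    (√(2 * (k + 1)) : ℂ) *
      ∫ x : ℝ, (hermiteFun (k + 1) x : ℂ) * Complex.exp (-(x : ℂ) ^ 2 / 2 + z * x)
      = z * ∫ x : ℝ, (hermiteFun k x : ℂ) * Complex.exp (-(x : ℂ) ^ 2 / 2 + z * x) := by
  have hd : ∀ x : ℝ, HasDerivAt
      (fun y : ℝ => (hermiteFun k y : ℂ) * Complex.exp (-(y : ℂ) ^ 2 / 2 + z * y))
      (z * ((hermiteFun k x : ℂ) * Complex.exp (-(x : ℂ) ^ 2 / 2 + z * x))
        - (√(2 * (k + 1)) : ℂ) *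
          ((hermiteFun (k + 1) x : ℂ) * Complex.exp (-(x : ℂ) ^ 2 / 2 + z * x))) x := by
    intro x
    have h1 := (hasDerivAt_hermiteFun k x).ofReal_comp
    have h2 : HasDerivAt (fun y : ℂ => Complex.exp (-y ^ 2 / 2 + z * y))
        (Complex.exp (-(x : ℂ) ^ 2 / 2 + z * x) * (-(x : ℂ) + z)) (x : ℂ) := by
      have h3 : HasDerivAt (fun y : ℂ => -y ^ 2 / 2 + z * y) (-(x : ℂ) + z) (x : ℂ) := by
        have := (((hasDerivAt_pow 2 (x : ℂ)).neg).div_const 2).add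
          ((hasDerivAt_id (x : ℂ)).const_mul z)
        refine this.congr_deriv ?_
        simp; ring
      exact h3.cexp
    have h4 := h1.mul h2.comp_ofReal
    refine h4.congr_deriv ?_
    push_cast
    ring
  have hi := (integrable_hermiteFun_mul_cexp k z).const_mul z
  have hi2 := (integrable_hermiteFun_mul_cexp (k + 1) z).const_mul (√(2 * (k + 1)) : ℂ)
  -- By the raising relation the derivative of h_k times the Gaussian is the difference of the two
  -- integrands, and its total integral vanishes.
  have h := integral_eq_zero_of_hasDerivAt_of_integrable hd (hi.sub hi2)
    (integrable_hermiteFun_mul_cexp k z)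
  rw [integral_sub hi hi2, integral_const_mul, integral_const_mul] at h
  exact (sub_eq_zero.1 h).symm

theorem pi_rpow_quarter_sq : (Real.pi ^ (1 / 4 : ℝ)) ^ 2 = √Real.pi := by
  rw [Real.sqrt_eq_rpow, ← Real.rpow_natCast, ← Real.rpow_mul Real.pi_pos.le]; norm_num

theorem hermiteNorm_zero_mul_sqrt_pi :
    hermiteNorm 0 * √Real.pi = Real.pi ^ (1 / 4 : ℝ) := by
  have h := (Real.rpow_pos_of_pos Real.pi_pos (1 / 4 : ℝ)).ne'
  rw [← pi_rpow_quarter_sq, hermiteNorm]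
  simp only [pow_zero, Nat.factorial_zero, Nat.cast_one, mul_one, Real.sqrt_one]
  field_simp

theorem hermiteNorm_zero_sq : hermiteNorm 0 ^ 2 * √Real.pi = 1 := by
  unfold hermiteNorm
  rw [← pi_rpow_quarter_sq]
  have h := (Real.rpow_pos_of_pos Real.pi_pos (1 / 4 : ℝ)).ne'
  simp
  field_simp

/-- The Hermite generating function: up to a common factor the squared moduli are the terms of the
exponential series at |z|²/2, so truncating at degree n will leave an exponential tail. -/
theorem integral_hermiteFun_mul_cexp (k : ℕ) (z : ℂ) :
    ∫ x : ℝ, (hermiteFun k x : ℂ) * Complex.exp (-(x : ℂ) ^ 2 / 2 + z * x)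
      = (Real.pi ^ (1 / 4 : ℝ) : ℝ) * Complex.exp (z ^ 2 / 4) * z ^ k
        / (√(2 ^ k * (k.factorial : ℝ)) : ℝ) := by
  induction k with
  | zero =>
    have e : ∀ x : ℝ, (hermiteFun 0 x : ℂ) * Complex.exp (-(x : ℂ) ^ 2 / 2 + z * x)
        = (hermiteNorm 0 : ℂ) * Complex.exp (-1 * (x : ℂ) ^ 2 + z * x + 0) := fun x => by
      rw [hermiteFun_zero]; push_cast
      rw [mul_assoc, ← Complex.exp_add]; congr 2; ring
    simp only [e]
    rw [integral_const_mul, integral_cexp_quadratic (by simp), ← hermiteNorm_zero_mul_sqrt_pi]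
    have h1 : ((Real.pi : ℂ) / - -1) ^ (1 / 2 : ℂ) = (√Real.pi : ℂ) := by
      rw [Real.sqrt_eq_rpow, Complex.ofReal_cpow Real.pi_pos.le]; simp
    rw [h1]
    simp
    have : -(z ^ 2 / (4 * -1)) = z ^ 2 / 4 := by ring
    ring_nf
  | succ k ih =>
    have h := integral_hermiteFun_succ_mul_cexp k z
    rw [ih] at h
    have e : √((2 : ℝ) ^ (k + 1) * ((k + 1).factorial : ℝ))
        = √(2 * (k + 1)) * √(2 ^ k * (k.factorial : ℝ)) := by
      rw [← Real.sqrt_mul (by positivity), Nat.factorial_succ]; congr 1; push_cast; ring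
    have h0 : (√(2 * (k + 1)) : ℂ) ≠ 0 := by
      have : √(2 * ((k : ℝ) + 1)) ≠ 0 := by positivity
      exact_mod_cast this
    have h1 : ((√(2 ^ k * (k.factorial : ℝ)) : ℝ) : ℂ) ≠ 0 := by
      have : √((2 : ℝ) ^ k * (k.factorial : ℝ)) ≠ 0 := by positivity
      exact_mod_cast this
    rw [e]
    apply mul_left_cancel₀ h0
    rw [h]
    push_cast
    field_simp
    ring

/-- Integrate the derivative of h_k h_{j+1}, raising one factor and lowering the other so that the
terms with x cancel. Both indices drop by one, reducing orthonormality to pairings with h_0. -/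
theorem integral_hermiteFun_succ_mul_succ (j k : ℕ) :
    √(2 * (k + 1)) * ∫ x, hermiteFun (k + 1) x * hermiteFun (j + 1) x
      = √(2 * (j + 1)) * ∫ x, hermiteFun k x * hermiteFun j x := by
  have hd : ∀ x : ℝ, HasDerivAt (fun y => hermiteFun k y * hermiteFun (j + 1) y)
      (√(2 * (j + 1)) * (hermiteFun k x * hermiteFun j x)
        - √(2 * (k + 1)) * (hermiteFun (k + 1) x * hermiteFun (j + 1) x)) x := by
    intro x
    refine ((hasDerivAt_hermiteFun k x).mul (hasDerivAt_hermiteFun_succ j x)).congr_deriv ?_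
    ring
  have hi := (integrable_hermiteFun_mul_hermiteFun k j).const_mul √(2 * ((j : ℝ) + 1))
  have hi2 := (integrable_hermiteFun_mul_hermiteFun (k + 1) (j + 1)).const_mul √(2 * ((k : ℝ) + 1))
  have h := integral_eq_zero_of_hasDerivAt_of_integrable hd (hi.sub hi2)
    (integrable_hermiteFun_mul_hermiteFun k (j + 1))
  rw [integral_sub hi hi2, integral_const_mul, integral_const_mul] at h
  linarith

theorem integral_hermiteFun_succ_mul_zero (k : ℕ) :
    ∫ x, hermiteFun (k + 1) x * hermiteFun 0 x = 0 := by
  have hd : ∀ x : ℝ, HasDerivAt (fun y => hermiteFun k y * hermiteFun 0 y)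
      (-(√(2 * (k + 1)) * (hermiteFun (k + 1) x * hermiteFun 0 x))) x := by
    intro x
    refine ((hasDerivAt_hermiteFun k x).mul (hasDerivAt_hermiteFun_zero x)).congr_deriv ?_
    ring
  have hi2 := (integrable_hermiteFun_mul_hermiteFun (k + 1) 0).const_mul √(2 * ((k : ℝ) + 1))
  have h := integral_eq_zero_of_hasDerivAt_of_integrable hd hi2.neg
    (integrable_hermiteFun_mul_hermiteFun k 0)
  rw [integral_neg, integral_const_mul, neg_eq_zero] at h
  have : √(2 * ((k : ℝ) + 1)) ≠ 0 := by positivity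
  exact (mul_eq_zero.1 h).resolve_left this

theorem integral_hermiteFun_mul_hermiteFun (j k : ℕ) :
    ∫ x, hermiteFun j x * hermiteFun k x = if j = k then 1 else 0 := by
  induction j generalizing k with
  | zero =>
    cases k with
    | zero =>
      have e : ∀ x, hermiteFun 0 x * hermiteFun 0 x = hermiteNorm 0 ^ 2 * Real.exp (-1 * x ^ 2) :=
        fun x => by
          have : Real.exp (-1 * x ^ 2) = Real.exp (-x ^ 2 / 2) * Real.exp (-x ^ 2 / 2) := by
            rw [← Real.exp_add]; congr 1; ring
          rw [hermiteFun_zero, this]; ring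
      simp only [e]
      rw [integral_const_mul, integral_gaussian, div_one, hermiteNorm_zero_sq]; simp
    | succ k =>
      simp only [mul_comm (hermiteFun 0 _), integral_hermiteFun_succ_mul_zero]; simp
  | succ j ih =>
    cases k with
    | zero => rw [integral_hermiteFun_succ_mul_zero]; simp
    | succ k =>
      have h := integral_hermiteFun_succ_mul_succ k j
      rw [ih] at h
      have h0 : √(2 * ((j : ℝ) + 1)) ≠ 0 := by positivity
      by_cases hjk : j = k
      · subst hjk
        simp only [if_true, mul_one] at h ⊢
        exact mul_left_cancel₀ h0 (by simpa using h)
      · simp only [hjk, if_false, mul_zero, Nat.add_right_cancel_iff] at h ⊢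
        exact (mul_eq_zero.1 h).resolve_left h0

end HermiteFunctions

/-! ### Projection onto finitely many orthonormal vectors -/

section OrthonormalSum

variable {E : Type*} [NormedAddCommGroup E] [InnerProductSpace ℂ E]

/-- The orthogonal projection onto the span of the first `n` vectors of an orthonormal family. -/
noncomputable def orthoSum (v : ℕ → E) (n : ℕ) : E →L[ℂ] E :=
  ∑ k ∈ Finset.range n, (innerSL ℂ (v k)).smulRight (v k)

theorem orthoSum_apply (v : ℕ → E) (n : ℕ) (x : E) :
    orthoSum v n x = ∑ k ∈ Finset.range n, (inner ℂ (v k) x : ℂ) • v k := by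
  simp [orthoSum]

theorem inner_orthoSum {v : ℕ → E} (hv : Orthonormal ℂ v) (n : ℕ) (x : E) {k : ℕ} (hk : k < n) :
    inner ℂ (v k) (orthoSum v n x) = inner ℂ (v k) x := by
  rw [orthoSum_apply]
  exact hv.inner_right_sum _ (Finset.mem_range.2 hk)

theorem orthoSum_isOrthoProj {v : ℕ → E} (hv : Orthonormal ℂ v) (n : ℕ) :
    IsOrthoProj (orthoSum v n) where
  idem x := by
    rw [orthoSum_apply v n (orthoSum v n x), orthoSum_apply v n x]
    refine Finset.sum_congr rfl fun k hk => ?_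
    rw [← orthoSum_apply, inner_orthoSum hv n x (Finset.mem_range.1 hk)]
  symm x y := by
    rw [orthoSum_apply, orthoSum_apply, sum_inner, inner_sum]
    refine Finset.sum_congr rfl fun k _ => ?_
    rw [inner_smul_left, inner_smul_right, inner_conj_symm, mul_comm]

theorem norm_sq_orthoSum {v : ℕ → E} (hv : Orthonormal ℂ v) (n : ℕ) (x : E) :
    ‖orthoSum v n x‖ ^ 2 = ∑ k ∈ Finset.range n, ‖(inner ℂ (v k) x : ℂ)‖ ^ 2 := by
  have h := (orthoSum_isOrthoProj hv n).inner_self x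
  rw [orthoSum_apply, inner_sum] at h
  have h2 : ∀ k, inner ℂ x ((inner ℂ (v k) x : ℂ) • v k)
      = ((‖(inner ℂ (v k) x : ℂ)‖ ^ 2 : ℝ) : ℂ) := fun k => by
    rw [inner_smul_right, ← inner_conj_symm x (v k), Complex.mul_conj, Complex.normSq_eq_norm_sq]
  simp only [h2, ← orthoSum_apply] at h
  exact_mod_cast h.symm

end OrthonormalSum

/-! ### Tails of the exponential series -/

section ExpTail

/-- The remainder of the exponential series after the term of degree `n`. -/
noncomputable def expTail (n : ℕ) (y : ℝ) : ℝ :=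
  Real.exp y - ∑ k ∈ Finset.range (n + 1), y ^ k / (k.factorial : ℝ)

theorem hasSum_expTail (n : ℕ) (y : ℝ) :
    HasSum (fun k => y ^ (k + (n + 1)) / ((k + (n + 1)).factorial : ℝ)) (expTail n y) := by
  have h : HasSum (fun k : ℕ => y ^ k / (k.factorial : ℝ)) (Real.exp y) := by
    have := NormedSpace.expSeries_div_hasSum_exp (𝔸 := ℝ) y
    rwa [← Real.exp_eq_exp_ℝ] at this
  exact (hasSum_nat_add_iff' (n + 1)).2 h

theorem expTail_nonneg (n : ℕ) {y : ℝ} (hy : 0 ≤ y) : 0 ≤ expTail n y :=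
  (hasSum_expTail n y).nonneg fun k => by positivity

theorem expTail_mono (n : ℕ) {x y : ℝ} (hx : 0 ≤ x) (h : x ≤ y) : expTail n x ≤ expTail n y :=
  hasSum_le (fun k => by gcongr) (hasSum_expTail n x) (hasSum_expTail n y)

/-- Past the leading term, each term of the tail is at most y/(n+2) times its predecessor, so the
tail is controlled by a geometric series. -/
theorem expTail_mul_le (n : ℕ) {y : ℝ} (hy : 0 ≤ y) :
    expTail n y * (1 - y / (n + 2)) ≤ y ^ (n + 1) / ((n + 1).factorial : ℝ) := by
  have h1 : expTail n y = y ^ (n + 1) / ((n + 1).factorial : ℝ) + expTail (n + 1) y := by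
    unfold expTail
    rw [Finset.sum_range_succ _ (n + 1)]
    ring
  have h2 : expTail (n + 1) y ≤ y / (n + 2) * expTail n y := by
    refine hasSum_le (fun k => ?_) (hasSum_expTail (n + 1) y)
      ((hasSum_expTail n y).mul_left (y / (n + 2)))
    have e : (k + (n + 1 + 1)).factorial = (k + n + 2) * (k + (n + 1)).factorial := by
      rw [show k + (n + 1 + 1) = k + (n + 1) + 1 by ring, Nat.factorial_succ]; ring
    rw [e, show k + (n + 1 + 1) = k + (n + 1) + 1 by ring, pow_succ']
    push_cast
    rw [mul_div_mul_comm]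
    gcongr
    linarith [(Nat.cast_nonneg k : (0 : ℝ) ≤ k)]
  linarith

theorem expTail_le (n : ℕ) {y r : ℝ} (hy : 0 ≤ y) (hr : r < 1) (h : y ≤ r * (n + 2)) :
    expTail n y ≤ (1 - r)⁻¹ * (y ^ (n + 1) / ((n + 1).factorial : ℝ)) := by
  have h1 := expTail_mul_le n hy
  have h2 : y / (n + 2) ≤ r := (div_le_iff₀ (by positivity)).2 h
  have h3 := expTail_nonneg n hy
  rw [inv_mul_eq_div, le_div_iff₀ (by linarith)]
  nlinarith

theorem continuous_expTail (n : ℕ) : Continuous (expTail n) := by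
  unfold expTail
  fun_prop

end ExpTail

/-! ### The Hermite projection as an operator on L² -/

section HermiteLTwo

local notation "L²" => Lp ℂ 2 (volume : Measure ℝ)

theorem rpow_neg_half_sq {α : ℝ} (hα : 0 < α) :
    α ^ (-(1 / 2) : ℝ) * α ^ (-(1 / 2) : ℝ) = α⁻¹ := by
  rw [← Real.rpow_add hα, ← Real.rpow_neg_one]; norm_num

theorem continuous_scaledHermiteFun (α : ℝ) (k : ℕ) : Continuous (scaledHermiteFun α k) :=
  continuous_const.mul ((continuous_hermiteFun k).comp (continuous_id.div_const α))

theorem scaledHermiteFun_mul {α : ℝ} (hα : 0 < α) (j k : ℕ) (x : ℝ) :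
    scaledHermiteFun α j x * scaledHermiteFun α k x
      = α⁻¹ * (hermiteFun j (x / α) * hermiteFun k (x / α)) := by
  unfold scaledHermiteFun
  rw [← rpow_neg_half_sq hα]
  ring

theorem memLp_scaledHermiteFun {α : ℝ} (hα : 0 < α) (k : ℕ) :
    MemLp (fun x => (scaledHermiteFun α k x : ℂ)) 2 volume := by
  refine (memLp_two_iff_integrable_sq_norm (Complex.continuous_ofReal.comp
    (continuous_scaledHermiteFun α k)).aestronglyMeasurable).2 ?_
  refine (((integrable_hermiteFun_mul_hermiteFun k k).comp_div hα.ne').const_mul α⁻¹).congr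
    (ae_of_all _ fun x => ?_)
  simp only [Function.comp_apply, Complex.norm_real, Real.norm_eq_abs, sq_abs]
  rw [pow_two, scaledHermiteFun_mul hα]

/-- The scaled Hermite function as an element of `L²`. -/
noncomputable def hermiteL {α : ℝ} (hα : 0 < α) (k : ℕ) : L² :=
  (memLp_scaledHermiteFun hα k).toLp _

variable {α : ℝ} (hα : 0 < α)

theorem hermiteL_ae (k : ℕ) :
    hermiteL hα k =ᵐ[volume] fun x => (scaledHermiteFun α k x : ℂ) :=
  MemLp.coeFn_toLp (memLp_scaledHermiteFun hα k)

theorem inner_hermiteL (k : ℕ) (f : L²) :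
    inner ℂ (hermiteL hα k) f = ∫ t : ℝ, f t * (scaledHermiteFun α k t : ℂ) := by
  rw [L2.inner_def]
  refine integral_congr_ae ?_
  filter_upwards [hermiteL_ae hα k] with x hx
  rw [hx, RCLike.inner_apply, Complex.conj_ofReal]

theorem orthonormal_hermiteL : Orthonormal ℂ (hermiteL hα) := by
  rw [orthonormal_iff_ite]
  intro j k
  rw [inner_hermiteL]
  have h : ∫ t : ℝ, hermiteL hα k t * (scaledHermiteFun α j t : ℂ)
      = ∫ t : ℝ, ((α⁻¹ * (hermiteFun j (t / α) * hermiteFun k (t / α)) : ℝ) : ℂ) := by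
    refine integral_congr_ae ?_
    filter_upwards [hermiteL_ae hα k] with x hx
    rw [hx, ← scaledHermiteFun_mul hα]
    push_cast; ring
  rw [h, integral_complex_ofReal, integral_const_mul,
    Measure.integral_comp_div (fun t => hermiteFun j t * hermiteFun k t) α,
    integral_hermiteFun_mul_hermiteFun, abs_of_pos hα, smul_eq_mul, ← mul_assoc,
    inv_mul_cancel₀ hα.ne', one_mul]
  split_ifs <;> simp

/-- The projection onto the span of the Hermite functions of degree at most `n`. -/
noncomputable def hermiteProj (n : ℕ) : L² →L[ℂ] L² := orthoSum (hermiteL hα) (n + 1)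

theorem hermiteProj_isOrthoProj (n : ℕ) : IsOrthoProj (hermiteProj hα n) :=
  orthoSum_isOrthoProj (orthonormal_hermiteL hα) _

theorem hermiteProj_ae (n : ℕ) (f : L²) :
    hermiteProj hα n f =ᵐ[volume] scaledHermiteProj α n f := by
  rw [hermiteProj, orthoSum_apply]
  have h2 : ∀ m : ℕ, (∑ k ∈ Finset.range m, (inner ℂ (hermiteL hα k) f : ℂ) • hermiteL hα k : L²)
      =ᵐ[volume] fun x => ∑ k ∈ Finset.range m,
        (∫ t : ℝ, f t * (scaledHermiteFun α k t : ℂ)) * (scaledHermiteFun α k x : ℂ) := by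
    intro m
    induction m with
    | zero =>
      filter_upwards [Lp.coeFn_zero ℂ 2 (volume : Measure ℝ)] with x hx
      simp
    | succ m ih =>
      rw [Finset.sum_range_succ]
      filter_upwards [ih, Lp.coeFn_add (∑ k ∈ Finset.range m,
        (inner ℂ (hermiteL hα k) f : ℂ) • hermiteL hα k)
          ((inner ℂ (hermiteL hα m) f : ℂ) • hermiteL hα m),
        Lp.coeFn_smul (inner ℂ (hermiteL hα m) f : ℂ) (hermiteL hα m), hermiteL_ae hα m]
        with x h1 h2 h3 h4
      rw [h2, Pi.add_apply, h1, h3, Pi.smul_apply, h4, Finset.sum_range_succ, inner_hermiteL,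
        smul_eq_mul]
  exact h2 (n + 1)

end HermiteLTwo

/-! ### Hermite approximation of modulated Gaussians -/

section CoherentStates

local notation "L²" => Lp ℂ 2 (volume : Measure ℝ)

/-- The Gaussian `x ↦ exp (-(x/α)²/2 + z x/α)`. -/
noncomputable def coherent (α : ℝ) (z : ℂ) (x : ℝ) : ℂ :=
  Complex.exp (-((x / α : ℝ) : ℂ) ^ 2 / 2 + z * ((x / α : ℝ) : ℂ))

theorem continuous_coherent (α : ℝ) (z : ℂ) : Continuous (coherent α z) := by
  unfold coherent
  fun_prop

theorem norm_coherent_sq (α : ℝ) (z : ℂ) (x : ℝ) :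
    ‖coherent α z x‖ ^ 2 = Real.exp (-(x / α) ^ 2 + 2 * z.re * (x / α)) := by
  unfold coherent
  rw [Complex.norm_exp, ← Real.exp_nat_mul]
  congr 1
  have h : (-((x / α : ℝ) : ℂ) ^ 2 / 2 + z * ((x / α : ℝ) : ℂ)).re
      = -(x / α) ^ 2 / 2 + z.re * (x / α) := by
    have : (-((x / α : ℝ) : ℂ) ^ 2 / 2) = ((-(x / α) ^ 2 / 2 : ℝ) : ℂ) := by push_cast; ring
    rw [Complex.add_re, this, Complex.ofReal_re, Complex.re_mul_ofReal]
  rw [h]; push_cast; ring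

theorem integral_exp_quadratic (a : ℝ) :
    Integrable (fun x : ℝ => Real.exp (-x ^ 2 + 2 * a * x)) ∧
    ∫ x : ℝ, Real.exp (-x ^ 2 + 2 * a * x) = √Real.pi * Real.exp (a ^ 2) := by
  have e : ∀ x : ℝ, ((Real.exp (-x ^ 2 + 2 * a * x) : ℝ) : ℂ)
      = Complex.exp (-1 * (x : ℂ) ^ 2 + (2 * a : ℂ) * x + 0) := fun x => by
    push_cast; congr 1; ring
  constructor
  · have h := integrable_cexp_quadratic (b := 1) (by simp) (2 * a : ℂ) 0
    have h2 := h.re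
    refine h2.congr (ae_of_all _ fun x => ?_)
    beta_reduce
    rw [← e, RCLike.re_to_complex, Complex.ofReal_re]
  · have h : ∫ x : ℝ, ((Real.exp (-x ^ 2 + 2 * a * x) : ℝ) : ℂ)
        = ((√Real.pi * Real.exp (a ^ 2) : ℝ) : ℂ) := by
      simp only [e]
      have h1 : ((Real.pi : ℂ) / - -1) ^ (1 / 2 : ℂ) = (√Real.pi : ℂ) := by
        rw [Real.sqrt_eq_rpow, Complex.ofReal_cpow Real.pi_pos.le]; simp
      rw [integral_cexp_quadratic (by simp), h1]
      push_cast
      congr 2; ring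
    rw [integral_complex_ofReal] at h
    exact_mod_cast h

variable {α : ℝ} (hα : 0 < α)

theorem memLp_coherent (hα : 0 < α) (z : ℂ) : MemLp (coherent α z) 2 volume := by
  refine (memLp_two_iff_integrable_sq_norm (continuous_coherent α z).aestronglyMeasurable).2 ?_
  simp only [norm_coherent_sq]
  exact (integral_exp_quadratic z.re).1.comp_div hα.ne'

/-- The Gaussian `coherent α z` as an element of `L²`. -/
noncomputable def coherentL (z : ℂ) : L² := (memLp_coherent hα z).toLp _

theorem coherentL_ae (z : ℂ) : coherentL hα z =ᵐ[volume] coherent α z :=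
  MemLp.coeFn_toLp (memLp_coherent hα z)

theorem norm_sq_coherentL (z : ℂ) :
    ‖coherentL hα z‖ ^ 2 = α * (√Real.pi * Real.exp (z.re ^ 2)) := by
  rw [norm_sq_eq_integral]
  have h : ∫ x, ‖coherentL hα z x‖ ^ 2
      = ∫ x : ℝ, Real.exp (-(x / α) ^ 2 + 2 * z.re * (x / α)) := by
    refine integral_congr_ae ?_
    filter_upwards [coherentL_ae hα z] with x hx
    rw [hx, norm_coherent_sq]
  rw [h, Measure.integral_comp_div (fun x => Real.exp (-x ^ 2 + 2 * z.re * x)) α,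
    (integral_exp_quadratic z.re).2, abs_of_pos hα, smul_eq_mul]

theorem norm_sq_inner_hermiteL_coherentL (k : ℕ) (z : ℂ) :
    ‖(inner ℂ (hermiteL hα k) (coherentL hα z) : ℂ)‖ ^ 2
      = α * (√Real.pi * Real.exp ((z.re ^ 2 - z.im ^ 2) / 2) *
        (((z.re ^ 2 + z.im ^ 2) / 2) ^ k / (k.factorial : ℝ))) := by
  have h : (inner ℂ (hermiteL hα k) (coherentL hα z) : ℂ)
      = (α ^ (-(1 / 2) : ℝ) : ℝ) * ((α : ℂ) * ((Real.pi ^ (1 / 4 : ℝ) : ℝ) *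
        Complex.exp (z ^ 2 / 4) * z ^ k / (√(2 ^ k * (k.factorial : ℝ)) : ℝ))) := by
    rw [inner_hermiteL, ← integral_hermiteFun_mul_cexp]
    have h1 : ∫ t : ℝ, coherentL hα z t * (scaledHermiteFun α k t : ℂ)
        = ∫ t : ℝ, ((α ^ (-(1 / 2) : ℝ) : ℝ) : ℂ) * ((fun x : ℝ => (hermiteFun k x : ℂ) *
          Complex.exp (-(x : ℂ) ^ 2 / 2 + z * x)) (t / α)) := by
      refine integral_congr_ae ?_
      filter_upwards [coherentL_ae hα z] with x hx
      rw [hx, scaledHermiteFun, coherent]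
      push_cast; ring
    rw [h1, integral_const_mul, Measure.integral_comp_div (fun x : ℝ => (hermiteFun k x : ℂ) *
      Complex.exp (-(x : ℂ) ^ 2 / 2 + z * x)) α, abs_of_pos hα, Complex.real_smul]
  rw [h]
  simp only [norm_mul, norm_div, norm_pow, Complex.norm_real, mul_pow, div_pow, Real.norm_eq_abs,
    sq_abs]
  have e1 : (α ^ (-(1 / 2) : ℝ)) ^ 2 = α⁻¹ := by rw [pow_two, rpow_neg_half_sq hα]
  have e2 : ‖Complex.exp (z ^ 2 / 4)‖ ^ 2 = Real.exp ((z.re ^ 2 - z.im ^ 2) / 2) := by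
    rw [Complex.norm_exp, ← Real.exp_nat_mul]
    congr 1
    have : (z ^ 2 / 4).re = (z.re ^ 2 - z.im ^ 2) / 4 := by
      rw [show z ^ 2 / 4 = z ^ 2 * ((1 / 4 : ℝ) : ℂ) by push_cast; ring, Complex.re_mul_ofReal,
        pow_two, Complex.mul_re]
      ring
    rw [this]; push_cast; ring
  have e3 : (‖z‖ ^ k) ^ 2 = (z.re ^ 2 + z.im ^ 2) ^ k := by
    rw [← pow_mul, mul_comm, pow_mul, ← Complex.normSq_eq_norm_sq, Complex.normSq_apply]
    ring
  rw [e1, e2, e3, pi_rpow_quarter_sq, Real.sq_sqrt (by positivity)]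
  field_simp

/-- Pythagoras: the full energy is the common factor times e^{|z|²/2}, and the captured energy is
the same factor times the partial sum of that exponential. -/
theorem norm_sq_sub_hermiteProj_coherentL (n : ℕ) (z : ℂ) :
    ‖coherentL hα z - hermiteProj hα n (coherentL hα z)‖ ^ 2
      = α * (√Real.pi * Real.exp ((z.re ^ 2 - z.im ^ 2) / 2) *
        expTail n ((z.re ^ 2 + z.im ^ 2) / 2)) := by
  have h := (hermiteProj_isOrthoProj hα n).pyth (coherentL hα z)
  have h2 := norm_sq_orthoSum (orthonormal_hermiteL hα) (n + 1) (coherentL hα z)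
  simp only [norm_sq_inner_hermiteL_coherentL, ← Finset.mul_sum] at h2
  rw [norm_sq_coherentL, hermiteProj, h2] at h
  have e : Real.exp (z.re ^ 2) = Real.exp ((z.re ^ 2 - z.im ^ 2) / 2) *
      Real.exp ((z.re ^ 2 + z.im ^ 2) / 2) := by rw [← Real.exp_add]; congr 1; ring
  rw [e] at h
  rw [hermiteProj, expTail]
  linear_combination -h

/-- The missed energy increases with (Re z)², so one bound serves all the Gaussians in a window. -/
theorem norm_sq_sub_hermiteProj_coherentL_le (n : ℕ) (z : ℂ) {m : ℝ} (hm : z.re ^ 2 ≤ m) :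
    ‖coherentL hα z - hermiteProj hα n (coherentL hα z)‖ ^ 2
      ≤ α * (√Real.pi * Real.exp ((m - z.im ^ 2) / 2) * expTail n ((m + z.im ^ 2) / 2)) := by
  rw [norm_sq_sub_hermiteProj_coherentL]
  have h := expTail_mono n (x := (z.re ^ 2 + z.im ^ 2) / 2) (y := (m + z.im ^ 2) / 2)
    (by positivity) (by linarith)
  have h0 := expTail_nonneg n (y := (z.re ^ 2 + z.im ^ 2) / 2) (by positivity)
  gcongr

end CoherentStates

/-! ### The cosh window and the loss of the Hermite projection -/

section Window

/-- The window `y ↦ exp (-y²/2) cosh (y/√M)^M`. -/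
noncomputable def coshWindow (M : ℕ) (y : ℝ) : ℝ :=
  Real.exp (-y ^ 2 / 2) * Real.cosh (y / √M) ^ M

theorem coshWindow_nonneg (M : ℕ) (y : ℝ) : 0 ≤ coshWindow M y := by
  have := Real.cosh_pos (y / √M)
  unfold coshWindow; positivity

theorem continuous_coshWindow (M : ℕ) : Continuous (coshWindow M) := by
  unfold coshWindow
  have := Real.continuous_cosh
  fun_prop

theorem coshWindow_eq {M : ℕ} (hM : 1 ≤ M) (y : ℝ) :
    coshWindow M y = (Real.exp (-(y / √M) ^ 2 / 2) * Real.cosh (y / √M)) ^ M := by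
  have hM' : (M : ℝ) ≠ 0 := by positivity
  rw [mul_pow, ← Real.exp_nat_mul, coshWindow, div_pow, Real.sq_sqrt (by positivity)]
  congr 2
  field_simp

theorem coshWindow_le_one {M : ℕ} (hM : 1 ≤ M) (y : ℝ) : coshWindow M y ≤ 1 := by
  rw [coshWindow_eq hM]
  set t := y / √M
  have hc := Real.cosh_pos t
  refine pow_le_one₀ (by positivity) ?_
  have h := Real.cosh_le_exp_half_sq t
  calc Real.exp (-t ^ 2 / 2) * Real.cosh t ≤ Real.exp (-t ^ 2 / 2) * Real.exp (t ^ 2 / 2) := by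
        gcongr
    _ = 1 := by rw [← Real.exp_add, neg_div, neg_add_cancel, Real.exp_zero]

theorem one_add_half_sq_le_cosh (t : ℝ) : 1 + t ^ 2 / 2 ≤ Real.cosh t := by
  have h1 : Real.cosh t = 1 + 2 * Real.sinh (t / 2) ^ 2 := by
    have h2 := Real.cosh_two_mul (t / 2)
    rw [mul_div_cancel₀ t two_ne_zero, Real.cosh_sq] at h2
    linarith
  have h3 : (t / 2) ^ 2 ≤ Real.sinh (t / 2) ^ 2 := by
    rw [sq_le_sq]
    rcases le_total 0 (t / 2) with h | h
    · rw [abs_of_nonneg h, abs_of_nonneg (Real.sinh_nonneg_iff.2 h)]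
      exact Real.self_le_sinh_iff.2 h
    · rw [abs_of_nonpos h, abs_of_nonpos (Real.sinh_nonpos_iff.2 h)]
      exact neg_le_neg (Real.sinh_le_self_iff.2 h)
  rw [h1]
  linarith

/-- With t = y/√M, each of the M factors is at least (1 - t²/2)(1 + t²/2) = 1 - t⁴/4, and
Bernoulli's inequality handles the power. For t⁴/4 > 1 the bound exceeds 1 and is trivial. -/
theorem one_sub_coshWindow_le {M : ℕ} (hM : 1 ≤ M) (y : ℝ) :
    1 - coshWindow M y ≤ y ^ 4 / (4 * M) := by
  have hM' : (1 : ℝ) ≤ M := by exact_mod_cast hM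
  set t := y / √M with ht
  have hy : y ^ 4 / (4 * M) = M * (t ^ 4 / 4) := by
    have : (√(M : ℝ)) ^ 4 = (M : ℝ) ^ 2 := by
      rw [show 4 = 2 * 2 by rfl, pow_mul, Real.sq_sqrt (by positivity)]
    rw [ht, div_pow, this]; field_simp
  rw [hy]
  rcases le_or_gt (t ^ 4 / 4) 1 with h | h
  · rw [coshWindow_eq hM, ← ht]
    have h1 : 1 - t ^ 4 / 4 ≤ Real.exp (-t ^ 2 / 2) * Real.cosh t := by
      have a := Real.add_one_le_exp (-t ^ 2 / 2)
      have b := one_add_half_sq_le_cosh t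
      have c := Real.exp_pos (-t ^ 2 / 2)
      calc 1 - t ^ 4 / 4 = (-t ^ 2 / 2 + 1) * (1 + t ^ 2 / 2) := by ring
        _ ≤ Real.exp (-t ^ 2 / 2) * (1 + t ^ 2 / 2) := by gcongr
        _ ≤ _ := by gcongr
    have h2 : (1 - t ^ 4 / 4) ^ M ≤ (Real.exp (-t ^ 2 / 2) * Real.cosh t) ^ M :=
      pow_le_pow_left₀ (by linarith) h1 M
    have h3 := one_add_mul_le_pow (a := -(t ^ 4 / 4)) (by linarith) M
    rw [← sub_eq_add_neg 1 (t ^ 4 / 4)] at h3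
    linarith
  · have := coshWindow_nonneg M y
    nlinarith

theorem sum_choose_div_two_pow (M : ℕ) :
    ∑ j ∈ Finset.range (M + 1), (M.choose j : ℝ) / 2 ^ M = 1 := by
  rw [← Finset.sum_div]
  have h := Nat.sum_range_choose M
  have h2 : ∑ j ∈ Finset.range (M + 1), (M.choose j : ℝ) = 2 ^ M := by exact_mod_cast h
  rw [h2]
  exact div_self (by positivity)

/-- The centres of the Gaussians that make up the modulated window. -/
noncomputable def windowCentre (M j : ℕ) (ω : ℝ) : ℂ := ⟨(2 * j - M) / √M, ω⟩

theorem windowCentre_re_sq_le {M j : ℕ} (hM : 1 ≤ M) (hj : j ≤ M) (ω : ℝ) :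
    (windowCentre M j ω).re ^ 2 ≤ M := by
  have hM' : (0 : ℝ) < M := by exact_mod_cast hM
  have hj' : (j : ℝ) ≤ M := by exact_mod_cast hj
  have hj0 : (0 : ℝ) ≤ j := by positivity
  change ((2 * j - M) / √M) ^ 2 ≤ (M : ℝ)
  rw [div_pow, Real.sq_sqrt hM'.le, div_le_iff₀ hM']
  nlinarith

/-- Binomial expansion of cosh^M. The weights are binomial probabilities, so a norm bound uniform
over the Gaussians passes to the window without loss. -/
theorem coshWindow_mul_cexp_eq_sum (α : ℝ) (M : ℕ) (ω x : ℝ) :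
    (coshWindow M (x / α) : ℂ) * Complex.exp (Complex.I * ω * ((x / α : ℝ) : ℂ))
      = ∑ j ∈ Finset.range (M + 1),
        (((M.choose j : ℝ) / 2 ^ M : ℝ) : ℂ) * coherent α (windowCentre M j ω) x := by
  set y := x / α with hy
  set s := y / √M with hs
  have h1 : Real.cosh s ^ M = ∑ j ∈ Finset.range (M + 1),
      (M.choose j : ℝ) / 2 ^ M * Real.exp ((2 * j - M) * s) := by
    rw [Real.cosh_eq, div_pow, add_pow, Finset.sum_div]
    refine Finset.sum_congr rfl fun j hj => ?_
    have hj' : j ≤ M := Nat.lt_succ_iff.1 (Finset.mem_range.1 hj)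
    rw [← Real.exp_nat_mul, ← Real.exp_nat_mul, ← Real.exp_add, Nat.cast_sub hj']
    rw [show (j : ℝ) * s + ((M : ℝ) - j) * -s = (2 * j - M) * s by ring]
    ring
  unfold coshWindow
  rw [← hs, h1, Finset.mul_sum]
  push_cast
  rw [Finset.sum_mul]
  refine Finset.sum_congr rfl fun j _ => ?_
  have hz : windowCentre M j ω = (((2 * j - M) / √M : ℝ) : ℂ) + Complex.I * ω := by
    apply Complex.ext <;> simp [windowCentre]
  have h2 : ((2 * j - M : ℝ) : ℂ) * (s : ℂ) = (((2 * j - M) / √M : ℝ) : ℂ) * (y : ℂ) := by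
    rw [hs]; push_cast; ring
  push_cast at h2
  rw [coherent, ← hy, hz, h2, add_mul, ← add_assoc, Complex.exp_add, Complex.exp_add]
  push_cast
  ring

local notation "L²" => Lp ℂ 2 (volume : Measure ℝ)

variable {α : ℝ} (hα : 0 < α)

/-- The modulated window `x ↦ coshWindow M (x/α) exp (iωx/α)` as an element of `L²`. -/
noncomputable def windowL (M : ℕ) (ω : ℝ) : L² :=
  ∑ j ∈ Finset.range (M + 1),
    (((M.choose j : ℝ) / 2 ^ M : ℝ) : ℂ) • coherentL hα (windowCentre M j ω)

theorem windowL_ae (M : ℕ) (ω : ℝ) : windowL hα M ω =ᵐ[volume] fun x =>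
    (coshWindow M (x / α) : ℂ) * Complex.exp (Complex.I * ω * ((x / α : ℝ) : ℂ)) := by
  simp only [coshWindow_mul_cexp_eq_sum]
  have h2 : ∀ m : ℕ, (∑ j ∈ Finset.range m,
      (((M.choose j : ℝ) / 2 ^ M : ℝ) : ℂ) • coherentL hα (windowCentre M j ω) : L²)
      =ᵐ[volume] fun x => ∑ j ∈ Finset.range m,
        (((M.choose j : ℝ) / 2 ^ M : ℝ) : ℂ) * coherent α (windowCentre M j ω) x := by
    intro m
    induction m with
    | zero =>
      filter_upwards [Lp.coeFn_zero ℂ 2 (volume : Measure ℝ)] with x hx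
      simp
    | succ m ih =>
      rw [Finset.sum_range_succ]
      filter_upwards [ih, Lp.coeFn_add (∑ j ∈ Finset.range m,
        (((M.choose j : ℝ) / 2 ^ M : ℝ) : ℂ) • coherentL hα (windowCentre M j ω))
          ((((M.choose m : ℝ) / 2 ^ M : ℝ) : ℂ) • coherentL hα (windowCentre M m ω)),
        Lp.coeFn_smul (((M.choose m : ℝ) / 2 ^ M : ℝ) : ℂ) (coherentL hα (windowCentre M m ω)),
        coherentL_ae hα (windowCentre M m ω)]
        with x h1 h2 h3 h4
      rw [h2, Pi.add_apply, h1, h3, Pi.smul_apply, h4, Finset.sum_range_succ, smul_eq_mul]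
  exact h2 (M + 1)

theorem norm_sq_sub_hermiteProj_windowL_le {M : ℕ} (hM : 1 ≤ M) (n : ℕ) (ω : ℝ) :
    ‖windowL hα M ω - hermiteProj hα n (windowL hα M ω)‖ ^ 2
      ≤ α * (√Real.pi * Real.exp ((M - ω ^ 2) / 2) * expTail n ((M + ω ^ 2) / 2)) := by
  set G := α * (√Real.pi * Real.exp ((M - ω ^ 2) / 2) * expTail n ((M + ω ^ 2) / 2))
  have hG : 0 ≤ G := by
    have := expTail_nonneg n (y := (M + ω ^ 2) / 2) (by positivity)
    positivity
  rw [← Real.le_sqrt (norm_nonneg _) hG]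
  have e : windowL hα M ω - hermiteProj hα n (windowL hα M ω)
      = ∑ j ∈ Finset.range (M + 1), (((M.choose j : ℝ) / 2 ^ M : ℝ) : ℂ) •
        (coherentL hα (windowCentre M j ω)
          - hermiteProj hα n (coherentL hα (windowCentre M j ω))) := by
    simp only [windowL, map_sum, map_smul, smul_sub, Finset.sum_sub_distrib]
  rw [e]
  refine (norm_sum_le _ _).trans ?_
  calc _ ≤ ∑ j ∈ Finset.range (M + 1), (M.choose j : ℝ) / 2 ^ M * √G := by
        refine Finset.sum_le_sum fun j hj => ?_
        rw [norm_smul, Complex.norm_real, Real.norm_of_nonneg (by positivity)]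
        refine mul_le_mul_of_nonneg_left (Real.le_sqrt_of_sq_le ?_) (by positivity)
        exact norm_sq_sub_hermiteProj_coherentL_le hα n _
          (windowCentre_re_sq_le hM (Nat.lt_succ_iff.1 (Finset.mem_range.1 hj)) ω)
    _ = √G := by rw [← Finset.sum_mul, sum_choose_div_two_pow, one_mul]

/-- Multiplication by the dilated window. -/
noncomputable def windowMul (α : ℝ) {M : ℕ} (hM : 1 ≤ M) : L² →L[ℂ] L² :=
  mulLTwo (fun x => coshWindow M (x / α))
    ((continuous_coshWindow M).measurable.comp (measurable_id.div_const α))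
    (fun x => abs_le.2 ⟨by linarith [coshWindow_nonneg M (x / α)], coshWindow_le_one hM _⟩)

theorem windowMul_ae {M : ℕ} (hM : 1 ≤ M) (f : L²) :
    windowMul α hM f =ᵐ[volume] fun x => (coshWindow M (x / α) : ℂ) * f x := mulLTwo_ae f

theorem integrable_windowMul (hα : 0 < α) {M : ℕ} (hM : 1 ≤ M) (f : L²) :
    Integrable (windowMul α hM f) := by
  refine (L2.integrable_inner (𝕜 := ℂ) (windowL hα M 0) f).congr ?_
  filter_upwards [windowMul_ae hM f, windowL_ae hα M 0] with x h1 h2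
  rw [h1, h2]
  simp [mul_comm]

/-- Writes a value of the transform as an inner product with an L² vector, so that 1 - K can later
be moved onto that vector. -/
theorem fourier_windowMul_ae {M : ℕ} (hM : 1 ≤ M) (f : L²) :
    (𝓕 (windowMul α hM f) : L²) =ᵐ[volume]
      fun ξ => inner ℂ (windowL hα M (2 * Real.pi * ξ * α)) f := by
  filter_upwards [fourier_coeFn_ae_eq _ (integrable_windowMul hα hM f)] with ξ hξ
  rw [hξ, Real.fourier_real_eq_integral_exp_smul, L2.inner_def]
  refine integral_congr_ae ?_
  filter_upwards [windowMul_ae hM f, windowL_ae hα M (2 * Real.pi * ξ * α)] with x h1 h2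
  rw [h1, h2, RCLike.inner_apply, map_mul, Complex.conj_ofReal, ← Complex.exp_conj, smul_eq_mul]
  have e : (starRingEnd ℂ) (Complex.I * ((2 * Real.pi * ξ * α : ℝ) : ℂ) * ((x / α : ℝ) : ℂ))
      = ((-2 * Real.pi * x * ξ : ℝ) : ℂ) * Complex.I := by
    rw [map_mul, map_mul, Complex.conj_I, Complex.conj_ofReal, Complex.conj_ofReal]
    have : (α : ℂ) ≠ 0 := by exact_mod_cast hα.ne'
    push_cast
    field_simp
  rw [e]
  ring

/-- The part of a windowed band-limited function that the Hermite projection misses. -/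
theorem norm_sq_window_loss_le {M : ℕ} (hM : 1 ≤ M) (n : ℕ) {c : ℝ} (hc : 0 ≤ c) (T : ℝ) {I : ℝ}
    (hI : ∫ ω in -c..c, Real.exp ((M - ω ^ 2) / 2) * expTail n ((M + ω ^ 2) / 2) ≤ I) (f : L²) :
    ‖timeProj T (windowMul α hM (bandProj (c / (2 * Real.pi * α)) f)
      - hermiteProj hα n (windowMul α hM (bandProj (c / (2 * Real.pi * α)) f)))‖ ^ 2
      ≤ √Real.pi / (2 * Real.pi) * I * ‖f‖ ^ 2 := by
  set B := c / (2 * Real.pi * α) with hB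
  have hB0 : 0 ≤ B := by positivity
  set P := timeProj T
  set Q := bandProj B
  set K := hermiteProj hα n
  set Θ := windowMul α hM
  have hP := timeProj_isOrthoProj T
  have hQ := bandProj_isOrthoProj B
  have hK := hermiteProj_isOrthoProj hα n
  set v := P (Θ (Q f) - K (Θ (Q f))) with hv
  set g := P v - K (P v) with hg
  have hI0 : 0 ≤ I := by
    refine le_trans (intervalIntegral.integral_nonneg (by linarith) fun ω _ => ?_) hI
    exact mul_nonneg (Real.exp_pos _).le (expTail_nonneg n (by positivity))
  -- Duality: moving P, 1 - K, Θ and Q across the inner product, it is enough to bound the band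
  -- energy of Θg, where g = (1 - K)Pv.
  have h1 : inner ℂ v v = inner ℂ (Q (Θ g)) f := by
    rw [hQ.symm, show inner ℂ (Θ g) (Q f) = inner ℂ g (Θ (Q f)) from mulLTwo_symm _ _, hg,
      inner_sub_left, hK.symm, ← inner_sub_right, hP.symm v]
  have h2 : ‖v‖ ^ 2 ≤ ‖Q (Θ g)‖ * ‖f‖ := by
    have := norm_inner_le_norm (𝕜 := ℂ) (Q (Θ g)) f
    rw [← h1, inner_self_eq_norm_sq_to_K] at this
    simpa using this
  have h3 : ‖Q (Θ g)‖ ^ 2 ≤ √Real.pi / (2 * Real.pi) * I * ‖v‖ ^ 2 := by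
    rw [norm_bandProj, norm_sq_timeProj]
    set G : ℝ → ℝ := fun ω => Real.exp ((M - ω ^ 2) / 2) * expTail n ((M + ω ^ 2) / 2) with hG
    have hGc : Continuous G := by
      have := continuous_expTail n
      fun_prop
    have hset : {x : ℝ | |x| ≤ B} = Set.Icc (-B) B := by ext x; simp [abs_le]
    have hb : ∀ ξ : ℝ, ‖(inner ℂ (windowL hα M (2 * Real.pi * ξ * α)) g : ℂ)‖ ^ 2
        ≤ α * √Real.pi * G (2 * Real.pi * α * ξ) * ‖v‖ ^ 2 := fun ξ => by
      -- Since g lies in the range of 1 - K, it only sees the part of the modulated window that K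
      -- misses.
      have e : (inner ℂ (windowL hα M (2 * Real.pi * ξ * α)) g : ℂ)
          = inner ℂ (windowL hα M (2 * Real.pi * ξ * α)
            - K (windowL hα M (2 * Real.pi * ξ * α))) (P v) := by
        rw [hg, inner_sub_left, inner_sub_right, hK.symm]
      have h5 := norm_sq_sub_hermiteProj_windowL_le hα hM n (2 * Real.pi * ξ * α)
      rw [e]
      calc _ ≤ (‖windowL hα M (2 * Real.pi * ξ * α)
            - K (windowL hα M (2 * Real.pi * ξ * α))‖ * ‖P v‖) ^ 2 := by
            gcongr; exact norm_inner_le_norm _ _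
        _ = ‖windowL hα M (2 * Real.pi * ξ * α)
            - K (windowL hα M (2 * Real.pi * ξ * α))‖ ^ 2 * ‖P v‖ ^ 2 := by rw [mul_pow]
        _ ≤ (α * (√Real.pi * Real.exp ((M - (2 * Real.pi * ξ * α) ^ 2) / 2)
            * expTail n ((M + (2 * Real.pi * ξ * α) ^ 2) / 2))) * ‖v‖ ^ 2 := by
            gcongr
            · exact le_trans (sq_nonneg _) h5
            · exact hP.norm_le v
        _ = _ := by
            rw [hG, show 2 * Real.pi * α * ξ = 2 * Real.pi * ξ * α by ring]; ring
    calc ∫ x in {x : ℝ | |x| ≤ B}, ‖(𝓕 (Θ g) : L²) x‖ ^ 2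
        ≤ ∫ ξ in {x : ℝ | |x| ≤ B}, α * √Real.pi * G (2 * Real.pi * α * ξ) * ‖v‖ ^ 2 := by
          refine setIntegral_mono_ae (integrable_norm_sq _).integrableOn ?_ ?_
          · rw [hset]
            exact (Continuous.continuousOn (by fun_prop)).integrableOn_Icc
          · filter_upwards [fourier_windowMul_ae hα hM g] with ξ hξ
            rw [hξ]
            exact hb ξ
      _ = α * √Real.pi * ((2 * Real.pi * α)⁻¹ * ∫ ω in -c..c, G ω) * ‖v‖ ^ 2 := by
          rw [hset, integral_Icc_eq_integral_Ioc,
            ← intervalIntegral.integral_of_le (by linarith),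
            intervalIntegral.integral_mul_const, intervalIntegral.integral_const_mul,
            intervalIntegral.integral_comp_mul_left G (by positivity), smul_eq_mul]
          have : 2 * Real.pi * α * B = c := by rw [hB]; field_simp
          rw [mul_neg, this]
      _ = √Real.pi / (2 * Real.pi) * (∫ ω in -c..c, G ω) * ‖v‖ ^ 2 := by field_simp
      _ ≤ _ := by gcongr
  rcases eq_or_ne ‖v‖ 0 with h0 | h0
  · rw [h0, zero_pow two_ne_zero]; positivity
  · have hpos : 0 < ‖v‖ ^ 2 := by positivity
    have h6 : (‖v‖ ^ 2) ^ 2 ≤ (√Real.pi / (2 * Real.pi) * I * ‖f‖ ^ 2) * ‖v‖ ^ 2 := by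
      calc (‖v‖ ^ 2) ^ 2 ≤ (‖Q (Θ g)‖ * ‖f‖) ^ 2 := by gcongr
        _ = ‖Q (Θ g)‖ ^ 2 * ‖f‖ ^ 2 := by ring
        _ ≤ (√Real.pi / (2 * Real.pi) * I * ‖v‖ ^ 2) * ‖f‖ ^ 2 := by gcongr
        _ = _ := by ring
    rw [pow_two (‖v‖ ^ 2)] at h6
    exact le_of_mul_le_mul_right h6 hpos

theorem norm_sub_windowMul_le (hα : 0 < α) {M : ℕ} (hM : 1 ≤ M) (T : ℝ) (f : L²) :
    ‖timeProj T (f - windowMul α hM f)‖ ≤ (T / α) ^ 4 / (4 * M) * ‖f‖ := by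
  refine Lp.norm_le_mul_norm_of_ae_le_mul ?_
  filter_upwards [timeProj_ae T (f - windowMul α hM f), Lp.coeFn_sub f (windowMul α hM f),
    windowMul_ae hM f] with x h1 h2 h3
  rw [h1, h2, Pi.sub_apply, h3, norm_mul, Complex.norm_real]
  rcases le_or_gt |x| T with h | h
  · have e : f x - (coshWindow M (x / α) : ℂ) * f x
        = ((1 - coshWindow M (x / α) : ℝ) : ℂ) * f x := by push_cast; ring
    rw [intervalInd_of_le h, norm_one, one_mul, e, norm_mul, Complex.norm_real,
      Real.norm_of_nonneg (by linarith [coshWindow_le_one hM (x / α)])]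
    gcongr
    refine (one_sub_coshWindow_le hM _).trans ?_
    have h4 : (x / α) ^ 4 ≤ (T / α) ^ 4 := by
      rw [div_pow, div_pow, ← Even.pow_abs (by decide : Even 4) x]
      gcongr
    gcongr
  · rw [intervalInd_of_lt h, norm_zero, zero_mul]
    positivity

theorem norm_sub_hermiteProj_le_of_window {M : ℕ} (hM : 1 ≤ M) (n : ℕ) {c : ℝ} (hc : 0 ≤ c)
    (T : ℝ) {I : ℝ}
    (hI : ∫ ω in -c..c, Real.exp ((M - ω ^ 2) / 2) * expTail n ((M + ω ^ 2) / 2) ≤ I) (f : L²) :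
    ‖timeProj T (f - hermiteProj hα n f)‖ ≤ ‖f - timeProj T f‖
      + ‖f - bandProj (c / (2 * Real.pi * α)) f‖
      + ((T / α) ^ 4 / (4 * M) + √(√Real.pi / (2 * Real.pi) * I)) * ‖f‖ := by
  have h := norm_proj_sub_le_of_contraction (Q := bandProj (c / (2 * Real.pi * α)))
    (timeProj_isOrthoProj T) (hermiteProj_isOrthoProj hα n) (Θ := windowMul α hM)
    (fun x => norm_mulLTwo_le x) (fun x => mulLTwo_comm x) f
  have h1 := norm_sub_windowMul_le hα hM T (bandProj (c / (2 * Real.pi * α)) f)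
  have h2 := Real.sqrt_le_sqrt (norm_sq_window_loss_le hα hM n hc T hI f)
  have hI0 : 0 ≤ I := by
    refine le_trans (intervalIntegral.integral_nonneg (by linarith) fun ω _ => ?_) hI
    exact mul_nonneg (Real.exp_pos _).le (expTail_nonneg n (by positivity))
  rw [Real.sqrt_sq (norm_nonneg _), Real.sqrt_mul (by positivity), Real.sqrt_sq (norm_nonneg _)]
    at h2
  have h3 : (T / α) ^ 4 / (4 * M) * ‖bandProj (c / (2 * Real.pi * α)) f‖
      ≤ (T / α) ^ 4 / (4 * M) * ‖f‖ := by
    gcongr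
    exact (bandProj_isOrthoProj _).norm_le f
  linarith

end Window

/-! ### Bounds for the loss integral -/

section LossIntegral

/-- A Chernoff bound: every exponent in the tail is at least n+1, so inserting the factor e^{k-n}
with k ≥ 0 replaced by the actual surplus exponent only enlarges the terms. -/
theorem expTail_le_exp (n : ℕ) {y : ℝ} (hy : 0 ≤ y) :
    expTail n y ≤ Real.exp (Real.exp 1 * y - (n + 1)) := by
  have h1 : expTail n y ≤ Real.exp (-(n + 1)) * expTail n (Real.exp 1 * y) := by
    refine hasSum_le (fun k => ?_) (hasSum_expTail n y)
      ((hasSum_expTail n (Real.exp 1 * y)).mul_left _)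
    have h2 : (1 : ℝ) ≤ Real.exp (-(n + 1)) * Real.exp 1 ^ (k + (n + 1)) := by
      rw [← Real.exp_nat_mul, ← Real.exp_add]
      refine Real.one_le_exp ?_
      push_cast
      linarith [(Nat.cast_nonneg k : (0 : ℝ) ≤ k)]
    have h3 : 0 ≤ y ^ (k + (n + 1)) / ((k + (n + 1)).factorial : ℝ) := by positivity
    calc _ ≤ (Real.exp (-(n + 1)) * Real.exp 1 ^ (k + (n + 1))) *
          (y ^ (k + (n + 1)) / ((k + (n + 1)).factorial : ℝ)) := le_mul_of_one_le_left h3 h2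
      _ = _ := by rw [mul_pow]; ring
  have h4 : expTail n (Real.exp 1 * y) ≤ Real.exp (Real.exp 1 * y) :=
    sub_le_self _ (Finset.sum_nonneg fun k _ => by positivity)
  calc expTail n y ≤ Real.exp (-(n + 1)) * Real.exp (Real.exp 1 * y) :=
        h1.trans (by gcongr)
    _ = _ := by rw [← Real.exp_add]; congr 1; ring

theorem intervalIntegrable_loss (m : ℝ) (n : ℕ) (a b : ℝ) :
    IntervalIntegrable (fun ω : ℝ => Real.exp ((m - ω ^ 2) / 2) * expTail n ((m + ω ^ 2) / 2))
      volume a b := by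
  have := continuous_expTail n
  exact Continuous.intervalIntegrable (by fun_prop) _ _

theorem loss_integral_le_exp {M n : ℕ} (h : 8 * M ≤ n) {c : ℝ} (hc : 0 ≤ c)
    (hcn : 2 * c ^ 2 = n) :
    ∫ ω in -c..c, Real.exp ((M - ω ^ 2) / 2) * expTail n ((M + ω ^ 2) / 2)
      ≤ 2 * c * Real.exp (-n / 3) := by
  have hM : 8 * (M : ℝ) ≤ n := by exact_mod_cast h
  have he := Real.exp_one_lt_d9
  have he1 := Real.exp_one_gt_d9
  calc _ ≤ ∫ ω in -c..c, Real.exp (-(n : ℝ) / 3) := by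
        refine intervalIntegral.integral_mono_on (by linarith) (intervalIntegrable_loss _ _ _ _)
          (by simp) fun ω hω => ?_
        have hω2 : ω ^ 2 ≤ c ^ 2 := sq_le_sq' hω.1 hω.2
        calc _ ≤ Real.exp ((M - ω ^ 2) / 2) *
              Real.exp (Real.exp 1 * ((M + ω ^ 2) / 2) - (n + 1)) := by
              gcongr; exact expTail_le_exp n (by positivity)
          _ ≤ _ := by
              rw [← Real.exp_add, Real.exp_le_exp]
              -- The worst case is ω² = n/2 and M = n/8, where the exponent over n is below (1+e)/16
              -- + (e-1)/4 - 1 < -1/3.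
              nlinarith [(Nat.cast_nonneg M : (0 : ℝ) ≤ M), sq_nonneg ω]
    _ = _ := by rw [intervalIntegral.integral_const, smul_eq_mul]; ring

/-- The maximal value of the integrand in the loss integral for the simplest window. -/
noncomputable def lossPeak (n : ℕ) : ℝ :=
  Real.exp (1 - (n + 2) / 4) * ((n + 2) / 4) ^ (n + 1) / ((n + 1).factorial : ℝ)

/-- The ratio is e^{-1/4}/4 · (1 + 1/(n+2))^{n+2} ≤ e^{3/4}/4 < 0.53. -/
theorem lossPeak_succ_le (n : ℕ) : lossPeak (n + 1) ≤ 53 / 100 * lossPeak n := by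
  have h1 : Real.exp (3 / 4) ≤ 212 / 100 := by
    refine le_of_pow_le_pow_left₀ (n := 4) (by norm_num) (by norm_num) ?_
    rw [← Real.exp_nat_mul]
    have h2 : Real.exp ((4 : ℕ) * (3 / 4)) = Real.exp 1 ^ 3 := by
      rw [← Real.exp_nat_mul]; norm_num
    rw [h2]
    calc Real.exp 1 ^ 3 ≤ 2.7182818286 ^ 3 := by
          have := Real.exp_one_lt_d9
          gcongr
      _ ≤ _ := by norm_num
  have h3 : (1 + 1 / ((n : ℝ) + 2)) ^ (n + 2) ≤ Real.exp 1 := by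
    calc (1 + 1 / ((n : ℝ) + 2)) ^ (n + 2) ≤ (Real.exp (1 / ((n : ℝ) + 2))) ^ (n + 2) := by
          gcongr
          linarith [Real.add_one_le_exp (1 / ((n : ℝ) + 2))]
      _ = Real.exp 1 := by
          rw [← Real.exp_nat_mul]; congr 1; push_cast; field_simp
  have e1 : lossPeak (n + 1) = lossPeak n * (Real.exp (-(1 / 4)) / 4 *
      (1 + 1 / ((n : ℝ) + 2)) ^ (n + 2)) := by
    unfold lossPeak
    have a1 : (((n + 1 : ℕ) : ℝ) + 2) / 4 = ((n : ℝ) + 2) / 4 * (1 + 1 / ((n : ℝ) + 2)) := by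
      push_cast; field_simp; ring
    have a2 : Real.exp (1 - (((n + 1 : ℕ) : ℝ) + 2) / 4)
        = Real.exp (1 - ((n : ℝ) + 2) / 4) * Real.exp (-(1 / 4)) := by
      rw [← Real.exp_add]; congr 1; push_cast; ring
    have a3 : ((n + 1 + 1).factorial : ℝ) = (n + 2) * ((n + 1).factorial : ℝ) := by
      rw [Nat.factorial_succ]; push_cast; ring
    rw [a2, a1, mul_pow, a3, pow_succ ((n + 2 : ℝ) / 4)]
    field_simp
  have h0 : 0 ≤ lossPeak n := by unfold lossPeak; positivity
  have h4 : Real.exp (-(1 / 4)) / 4 * (1 + 1 / ((n : ℝ) + 2)) ^ (n + 2) ≤ 53 / 100 := by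
    calc _ ≤ Real.exp (-(1 / 4)) / 4 * Real.exp 1 := by gcongr
      _ = Real.exp (3 / 4) / 4 := by
          rw [div_mul_eq_mul_div, ← Real.exp_add]; norm_num
      _ ≤ _ := by linarith
  rw [e1, mul_comm (53 / 100 : ℝ)]
  gcongr

theorem lossPeak_le {n : ℕ} (hn : 2 ≤ n) : lossPeak n ≤ 1 / 6 * (53 / 100) ^ (n - 2) := by
  induction n, hn using Nat.le_induction with
  | base => norm_num [lossPeak, Nat.factorial]
  | succ n hn ih =>
    refine (lossPeak_succ_le n).trans ?_
    rw [show n + 1 - 2 = (n - 2) + 1 by omega, pow_succ]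
    linarith

/-- Below the band edge value m = (n+2)/4 the tail is at most 4/3 of its leading term, and y^{n+1}
decays from y = m at rate (n+1)/m ≥ 3, which uses n ≥ 2. The factor e^{1-y} takes back rate 1, and
the remaining 2(m - y) equals c² - ω². -/
theorem loss_integrand_le {n : ℕ} (hn : 2 ≤ n) {c ω : ℝ} (hcn : 2 * c ^ 2 = n)
    (hω : ω ^ 2 ≤ c ^ 2) :
    Real.exp ((1 - ω ^ 2) / 2) * expTail n ((1 + ω ^ 2) / 2)
      ≤ 4 / 3 * lossPeak n * Real.exp (-(c ^ 2 - ω ^ 2)) := by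
  have hn' : (2 : ℝ) ≤ n := by exact_mod_cast hn
  set m : ℝ := (n + 2) / 4 with hm
  set y := (1 + ω ^ 2) / 2 with hy
  have hy0 : 0 ≤ y := by positivity
  have hm0 : 0 < m := by positivity
  have hym : m - y = (c ^ 2 - ω ^ 2) / 2 := by rw [hm, hy, ← hcn]; ring
  have h1 : expTail n y ≤ 4 / 3 * (y ^ (n + 1) / ((n + 1).factorial : ℝ)) := by
    have := expTail_le n hy0 (r := 1 / 4) (by norm_num) (by linarith)
    norm_num at this ⊢
    exact this
  have h2 : y ^ (n + 1) ≤ m ^ (n + 1) * Real.exp (-(3 * (m - y))) := by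
    have a : y / m ≤ Real.exp (y / m - 1) := by linarith [Real.add_one_le_exp (y / m - 1)]
    have b : y ≤ m * Real.exp (y / m - 1) := by
      rw [mul_comm]; exact (div_le_iff₀ hm0).1 a
    calc y ^ (n + 1) ≤ (m * Real.exp (y / m - 1)) ^ (n + 1) := by gcongr
      _ = m ^ (n + 1) * Real.exp (-(((n : ℝ) + 1) / m * (m - y))) := by
          rw [mul_pow, ← Real.exp_nat_mul]
          congr 2
          push_cast
          field_simp
          ring
      _ ≤ _ := by
          gcongr
          · linarith
          · rw [le_div_iff₀ hm0, hm]; linarith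
  have e : (1 - ω ^ 2) / 2 = 1 - y := by rw [hy]; ring
  rw [e]
  calc _ ≤ Real.exp (1 - y) * (4 / 3 * (m ^ (n + 1) * Real.exp (-(3 * (m - y)))
        / ((n + 1).factorial : ℝ))) := by
        refine mul_le_mul_of_nonneg_left (h1.trans ?_) (Real.exp_pos _).le
        gcongr
    _ = 4 / 3 * (m ^ (n + 1) / ((n + 1).factorial : ℝ)) *
        (Real.exp (1 - y) * Real.exp (-(3 * (m - y)))) := by ring
    _ = 4 / 3 * (m ^ (n + 1) / ((n + 1).factorial : ℝ)) *
        (Real.exp (1 - m) * Real.exp (-(c ^ 2 - ω ^ 2))) := by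
        rw [← Real.exp_add, ← Real.exp_add]
        congr 2
        linarith
    _ = _ := by unfold lossPeak; ring

/-- Since c² - ω² ≥ c(c - |ω|) in the band, these two edge exponentials dominate the decay of the
loss integrand. -/
theorem integral_exp_edge_le {c : ℝ} (hc : 0 < c) :
    ∫ ω in -c..c, (Real.exp (-(c * (c - ω))) + Real.exp (-(c * (c + ω)))) ≤ 2 / c := by
  have hd : ∀ ω ∈ Set.uIcc (-c) c, HasDerivAt
      (fun ω => (Real.exp (-(c * (c - ω))) - Real.exp (-(c * (c + ω)))) / c)
      (Real.exp (-(c * (c - ω))) + Real.exp (-(c * (c + ω)))) ω := by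
    intro ω _
    have h1 : HasDerivAt (fun ω => -(c * (c - ω))) c ω := by
      exact (((hasDerivAt_id ω).const_sub c).const_mul c).neg.congr_deriv (by ring)
    have h2 : HasDerivAt (fun ω => -(c * (c + ω))) (-c) ω := by
      exact (((hasDerivAt_id ω).const_add c).const_mul c).neg.congr_deriv (by ring)
    refine ((h1.exp.sub h2.exp).div_const c).congr_deriv ?_
    field_simp
    ring
  rw [intervalIntegral.integral_eq_sub_of_hasDerivAt hd
    (Continuous.intervalIntegrable (by fun_prop) _ _)]
  have h1 : -(c * (c - c)) = 0 := by ring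
  have h2 : -(c * (c + -c)) = 0 := by ring
  rw [h1, h2, Real.exp_zero, ← sub_div]
  gcongr
  linarith [Real.exp_pos (-(c * (c + c))), Real.exp_pos (-(c * (c - -c)))]

theorem loss_integral_le {n : ℕ} (hn : 2 ≤ n) {c : ℝ} (hc : 0 < c) (hcn : 2 * c ^ 2 = n) :
    ∫ ω in -c..c, Real.exp (((1 : ℕ) - ω ^ 2) / 2) * expTail n (((1 : ℕ) + ω ^ 2) / 2)
      ≤ 4 / 9 * (53 / 100) ^ (n - 2) / c := by
  have h0 : 0 ≤ lossPeak n := by unfold lossPeak; positivity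
  calc _ ≤ ∫ ω in -c..c, 4 / 3 * lossPeak n *
        (Real.exp (-(c * (c - ω))) + Real.exp (-(c * (c + ω)))) := by
        refine intervalIntegral.integral_mono_on (by linarith) (intervalIntegrable_loss _ _ _ _)
          (Continuous.intervalIntegrable (by fun_prop) _ _) fun ω hω => ?_
        rw [Nat.cast_one]
        refine (loss_integrand_le hn hcn (sq_le_sq' hω.1 hω.2)).trans ?_
        gcongr
        rcases le_total 0 ω with h | h
        · refine le_add_of_le_of_nonneg (Real.exp_le_exp.2 ?_) (Real.exp_pos _).le
          nlinarith [hω.2]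
        · refine le_add_of_nonneg_of_le (Real.exp_pos _).le (Real.exp_le_exp.2 ?_)
          nlinarith [hω.1]
    _ ≤ 4 / 3 * (1 / 6 * (53 / 100) ^ (n - 2)) * (2 / c) := by
        rw [intervalIntegral.integral_const_mul]
        have := integral_exp_edge_le hc
        have := lossPeak_le hn
        have h1 : 0 ≤ ∫ ω in -c..c, (Real.exp (-(c * (c - ω))) + Real.exp (-(c * (c + ω)))) :=
          intervalIntegral.integral_nonneg (by linarith) fun ω _ => by positivity
        gcongr
    _ = _ := by ring

end LossIntegral

/-! ### Numerical comparison of the loss with the allowance, for M = 1 -/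

section LossNumerics

theorem sqrt_pi_div_two_pi_le : √Real.pi / (2 * Real.pi) ≤ 2822 / 10000 := by
  have h1 : (3.1415 : ℝ) < Real.pi := Real.pi_gt_d4
  have h2 : (2 * Real.pi) = 2 * (√Real.pi * √Real.pi) := by
    rw [Real.mul_self_sqrt Real.pi_pos.le]
  have h3 : (1.7724 : ℝ) ≤ √Real.pi := Real.le_sqrt_of_sq_le (by norm_num; linarith)
  rw [h2, div_le_iff₀ (by positivity)]
  nlinarith

theorem pow_mul_geometric_le {n : ℕ} (hn : 12 ≤ n) :
    (53 / 100 : ℝ) ^ (n - 2) * (2 * n + 1) ^ 10 ≤ 24 * 10 ^ 10 := by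
  rcases lt_or_ge n 15 with h | h
  · interval_cases n <;> norm_num
  · induction n, h using Nat.le_induction with
    | base => norm_num
    | succ n hn15 ih =>
      have hn' : (15 : ℝ) ≤ n := by exact_mod_cast hn15
      have h1 : (2 * ((n + 1 : ℕ) : ℝ) + 1) ^ 10 ≤ (33 / 31 * (2 * n + 1)) ^ 10 := by
        gcongr
        push_cast
        linarith
      -- From n = 15 on, consecutive values do not increase, as (2n+3)/(2n+1) ≤ 33/31; smaller n
      -- were evaluated directly.
      have h2 : (53 / 100 : ℝ) * (33 / 31) ^ 10 ≤ 1 := by norm_num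
      have h3 := ih (by omega)
      have h4 : (0 : ℝ) ≤ (53 / 100 : ℝ) ^ (n - 2) * (2 * n + 1) ^ 10 := by positivity
      rw [show n + 1 - 2 = (n - 2) + 1 by omega, pow_succ]
      calc _ ≤ (53 / 100 : ℝ) ^ (n - 2) * (53 / 100) * (33 / 31 * (2 * n + 1)) ^ 10 := by gcongr
        _ = (53 / 100 : ℝ) * (33 / 31) ^ 10 * ((53 / 100 : ℝ) ^ (n - 2) * (2 * n + 1) ^ 10) := by
            rw [mul_pow]; ring
        _ ≤ 1 * ((53 / 100 : ℝ) ^ (n - 2) * (2 * n + 1) ^ 10) := by gcongr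
        _ ≤ _ := by linarith

theorem loss_numeric_small {n : ℕ} (hn : 2 ≤ n) (hn' : n ≤ 11) {c t : ℝ} (hc : 0 < c)
    (hcn : 2 * c ^ 2 = n) (h : 3925 / 10000 ≤ c * t) :
    2822 / 10000 * (4 / 9 * (53 / 100) ^ (n - 2) / c) * (2 * n + 1) ≤ (24 * t ^ 3) ^ 2 := by
  -- From (c - 1.6)² ≥ 0: the odd power c⁵ is replaced by a rational expression in n, leaving
  -- finitely many numerical checks.
  have h1 : c ≤ (n / 2 + 2.56) / 3.2 := by
    rw [le_div_iff₀ (by norm_num)]; nlinarith [sq_nonneg (c - 1.6)]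
  have h2 : (3925 / 10000 : ℝ) ^ 6 ≤ (c * t) ^ 6 := by gcongr
  have h3 : 2822 / 10000 * (4 / 9 * (53 / 100 : ℝ) ^ (n - 2)) * (2 * n + 1) * ((n / 2) ^ 2
      * ((n / 2 + 2.56) / 3.2)) ≤ 576 * (3925 / 10000) ^ 6 := by
    interval_cases n <;> norm_num
  have h4 : c ^ 5 ≤ (n / 2) ^ 2 * ((n / 2 + 2.56) / 3.2) := by
    have : c ^ 5 = ((n : ℝ) / 2) ^ 2 * c := by rw [← hcn]; ring
    rw [this]; gcongr
  have h5 : 2822 / 10000 * (4 / 9 * (53 / 100 : ℝ) ^ (n - 2)) * (2 * n + 1) * c ^ 5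
      ≤ 576 * (c * t) ^ 6 := by
    refine le_trans ?_ (h3.trans (by gcongr))
    gcongr
  refine le_of_mul_le_mul_right ?_ (pow_pos hc 6)
  calc _ = 2822 / 10000 * (4 / 9 * (53 / 100 : ℝ) ^ (n - 2)) * (2 * n + 1) * c ^ 5 := by
        field_simp
    _ ≤ 576 * (c * t) ^ 6 := h5
    _ = _ := by ring

theorem loss_numeric_large {n : ℕ} (hn : 12 ≤ n) {c t : ℝ} (hc : 0 < c)
    (hcn : 2 * c ^ 2 = n) (h : 17 ^ 2 ≤ t ^ 2 * (2 * n + 1) ^ 3) :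
    2822 / 10000 * (4 / 9 * (53 / 100) ^ (n - 2) / c) * (2 * n + 1) ≤ (24 * t ^ 3) ^ 2 := by
  have hn' : (12 : ℝ) ≤ n := by exact_mod_cast hn
  have h1 : 12 / 5 ≤ c := by nlinarith
  -- Cubing turns the hypothesis into a lower bound for t⁶ with weight (2n+1)⁹; together with the
  -- remaining 2n+1 this gives the tenth power of `pow_mul_geometric_le`.
  have h2 : ((17 : ℝ) ^ 2) ^ 3 ≤ (t ^ 2 * (2 * n + 1) ^ 3) ^ 3 := by gcongr
  have h3 := pow_mul_geometric_le hn
  refine le_of_mul_le_mul_right ?_ (show (0 : ℝ) < (2 * n + 1) ^ 9 by positivity)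
  calc _ = 2822 / 10000 * 4 / 9 * ((53 / 100) ^ (n - 2) * (2 * (n : ℝ) + 1) ^ 10) / c := by
        field_simp
    _ ≤ 2822 / 10000 * 4 / 9 * (24 * 10 ^ 10) / (12 / 5) := by gcongr
    _ ≤ 576 * (17 ^ 2) ^ 3 := by norm_num
    _ ≤ 576 * (t ^ 2 * (2 * n + 1) ^ 3) ^ 3 := by gcongr
    _ = _ := by ring

end LossNumerics

/-! ### The estimate through windows -/

section LargeCases

local notation "L²" => Lp ℂ 2 (volume : Measure ℝ)

variable {α : ℝ} (hα : 0 < α)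

theorem norm_sub_hermiteProj_le_of_loss_numeric {n : ℕ} (hn : 2 ≤ n) {T c N : ℝ} (hT : 0 < T)
    (hc : 0 < c) (hcn : 2 * c ^ 2 = n) (hN : 0 < N) (hNn : N ^ 2 = 2 * n + 1)
    (h40 : T / α * N ≤ 40)
    (h : 2822 / 10000 * (4 / 9 * (53 / 100) ^ (n - 2) / c) * (2 * n + 1)
      ≤ (24 * (T / α) ^ 3) ^ 2) (f : L²) :
    ‖timeProj T (f - hermiteProj hα n f)‖ ≤ ‖f - timeProj T f‖
      + ‖f - bandProj (c / (2 * Real.pi * α)) f‖ + 34 * (T / α) ^ 3 / N * ‖f‖ := by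
  have ht : 0 < T / α := by positivity
  set t := T / α with htd
  refine (norm_sub_hermiteProj_le_of_window hα le_rfl n hc.le T
    (loss_integral_le hn hc hcn) f).trans ?_
  -- The allowance 34 is split as 10 + 24: here tN ≤ 40 gives t⁴/4 ≤ 10t³/N, and the loss receives
  -- 24.
  have h1 : t ^ 4 / (4 * (1 : ℕ)) ≤ 10 * t ^ 3 / N := by
    rw [le_div_iff₀ hN, Nat.cast_one]
    have : 0 < t ^ 3 := by positivity
    nlinarith
  have h2 : √(√Real.pi / (2 * Real.pi) * (4 / 9 * (53 / 100) ^ (n - 2) / c))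
      ≤ 24 * t ^ 3 / N := by
    refine Real.sqrt_le_iff.2 ⟨by positivity, ?_⟩
    rw [div_pow (24 * t ^ 3), le_div_iff₀ (by positivity), hNn]
    refine le_trans ?_ h
    have := sqrt_pi_div_two_pi_le
    gcongr
  have h3 : 34 * t ^ 3 / N = 10 * t ^ 3 / N + 24 * t ^ 3 / N := by ring
  rw [h3]
  gcongr

theorem norm_sub_hermiteProj_le_of_large {n : ℕ} {T c N : ℝ} (hT : 0 < T)
    (hc : 0 < c) (hcn : 2 * c ^ 2 = n) (hN : 0 < N) (hNn : N ^ 2 = 2 * n + 1)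
    (h40 : 40 < T / α * N) (h34 : 34 * (T / α) ^ 3 < N) (f : L²) :
    ‖timeProj T (f - hermiteProj hα n f)‖ ≤ ‖f - timeProj T f‖
      + ‖f - bandProj (c / (2 * Real.pi * α)) f‖ + 34 * (T / α) ^ 3 / N * ‖f‖ := by
  have ht : 0 < T / α := by positivity
  set t := T / α with htd
  have h64 : 64000 ≤ t ^ 3 * N ^ 3 := by
    rw [← mul_pow]
    calc (64000 : ℝ) = 40 ^ 3 := by norm_num
      _ ≤ _ := by gcongr
  -- Combining 34t³ < N with tN > 40 gives N⁴ > 34 · 40³.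
  have hN2 : 1225 ≤ N ^ 2 := by
    have h1 : 34 * 64000 ≤ N ^ 2 * N ^ 2 := by
      calc (34 * 64000 : ℝ) ≤ 34 * (t ^ 3 * N ^ 3) := by linarith
        _ = 34 * t ^ 3 * N ^ 3 := by ring
        _ ≤ N * N ^ 3 := by gcongr
        _ = _ := by ring
    nlinarith
  have hn612 : (612 : ℝ) ≤ n := by linarith
  have hn16 : 612 ≤ n := by exact_mod_cast hn612
  have htN : 9 * t ≤ N := by
    by_contra! hcon
    have h1 : N ^ 3 < (9 * t) ^ 3 := by gcongr
    nlinarith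
  -- Large enough for the bias, which needs tN ≤ 4M, and small enough for 8M ≤ n, which makes the
  -- loss exponentially small. The allowance is now split as 1 + 33.
  set M := n / 16 + 1 with hMd
  have hM8 : 8 * M ≤ n := by omega
  have hM16 : (n : ℝ) ≤ 16 * M := by
    have : n ≤ 16 * M := by omega
    exact_mod_cast this
  have hM0 : (0 : ℝ) < M := by linarith
  refine (norm_sub_hermiteProj_le_of_window hα (show 1 ≤ M by omega) n hc.le T
    (loss_integral_le_exp hM8 hc.le hcn) f).trans ?_
  have h1 : t ^ 4 / (4 * M) ≤ t ^ 3 / N := by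
    rw [div_le_div_iff₀ (by positivity) hN]
    have : t * N ≤ 4 * M := by nlinarith
    calc t ^ 4 * N = t ^ 3 * (t * N) := by ring
      _ ≤ _ := by gcongr
  have h2 : √(√Real.pi / (2 * Real.pi) * (2 * c * Real.exp (-n / 3))) ≤ 33 * t ^ 3 / N := by
    refine Real.sqrt_le_iff.2 ⟨by positivity, ?_⟩
    -- From e^x ≥ x⁵/5! at x = n/3; 29160 = 5! · 3⁵.
    have hexp : Real.exp (-n / 3) ≤ 29160 / n ^ 5 := by
      have h5 := Real.pow_div_factorial_le_exp ((n : ℝ) / 3) (by positivity) 5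
      rw [neg_div, Real.exp_neg, inv_le_comm₀ (Real.exp_pos _) (by positivity), inv_div]
      refine le_trans (le_of_eq ?_) h5
      norm_num [Nat.factorial]
      ring
    have hcle : c ≤ n := by nlinarith
    have hs := sqrt_pi_div_two_pi_le
    have hn0 : (0 : ℝ) < n := by linarith
    calc √Real.pi / (2 * Real.pi) * (2 * c * Real.exp (-n / 3))
        ≤ 2822 / 10000 * (2 * n * (29160 / n ^ 5)) := by gcongr
      _ = (2822 / 10000 * 2 * 29160) / n ^ 4 := by field_simp
      _ ≤ (33 * 64000) ^ 2 / (3 * n) ^ 4 := by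
          rw [div_le_div_iff₀ (by positivity) (by positivity)]
          have : (0 : ℝ) < n ^ 4 := by positivity
          nlinarith
      _ ≤ (33 * 64000) ^ 2 / (N ^ 2) ^ 4 := by
          gcongr
          linarith
      _ ≤ (33 * (t ^ 3 * N ^ 3)) ^ 2 / (N ^ 2) ^ 4 := by gcongr
      _ = _ := by field_simp
  have h3 : 34 * t ^ 3 / N = t ^ 3 / N + 33 * t ^ 3 / N := by ring
  rw [h3]
  gcongr

end LargeCases

/-! ### Hermite functions near the origin -/

section HermiteNearZero

/-- The derivative of the `k`-th Hermite function. -/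
noncomputable def hermiteDeriv (k : ℕ) (x : ℝ) : ℝ :=
  x * hermiteFun k x - √(2 * (k + 1)) * hermiteFun (k + 1) x

theorem hasDerivAt_hermiteDeriv (k : ℕ) (x : ℝ) :
    HasDerivAt (hermiteDeriv k) (-((2 * k + 1 - x ^ 2) * hermiteFun k x)) x := by
  have h := ((hasDerivAt_id x).mul (hasDerivAt_hermiteFun k x)).sub
    ((hasDerivAt_hermiteFun_succ k x).const_mul √(2 * ((k : ℝ) + 1)))
  refine h.congr_deriv ?_
  have hs := Real.mul_self_sqrt (show (0 : ℝ) ≤ 2 * ((k : ℝ) + 1) by positivity)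
  simp only [id]
  linear_combination -hermiteFun k x * hs

theorem hermiteFun_neg (k : ℕ) (x : ℝ) : hermiteFun k (-x) = (-1) ^ k * hermiteFun k x := by
  have h := iteratedDeriv_comp_neg k (fun t : ℝ => Real.exp (-t ^ 2)) x
  simp only [neg_sq, smul_eq_mul] at h
  rw [hermiteFun_eq, hermiteFun_eq, neg_sq, h]
  have h1 : ((-1 : ℝ) ^ k) * (-1) ^ k = 1 := by rw [← mul_pow]; norm_num
  linear_combination hermiteNorm k * Real.exp (x ^ 2 / 2) * (-1) ^ k *
    iteratedDeriv k (fun t : ℝ => Real.exp (-t ^ 2)) (-x) * (-h1)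

theorem hermiteFun_zero_of_odd {k : ℕ} (hk : Odd k) : hermiteFun k 0 = 0 := by
  have h := hermiteFun_neg k 0
  rw [hk.neg_one_pow, neg_zero] at h
  linarith

theorem hermiteDeriv_zero_of_even {k : ℕ} (hk : Even k) : hermiteDeriv k 0 = 0 := by
  rw [hermiteDeriv, hermiteFun_zero_of_odd hk.add_one]; simp

/-- The energy of a Hermite function decreases on the positive half-line. -/
theorem hermite_energy_le (k : ℕ) {x : ℝ} (hx : 0 ≤ x) :
    hermiteDeriv k x ^ 2 + (2 * k + 1 - x ^ 2) * hermiteFun k x ^ 2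
      ≤ hermiteDeriv k 0 ^ 2 + (2 * k + 1) * hermiteFun k 0 ^ 2 := by
  have hd : ∀ y : ℝ, HasDerivAt
      (fun y => hermiteDeriv k y ^ 2 + (2 * k + 1 - y ^ 2) * hermiteFun k y ^ 2)
      (-(2 * y * hermiteFun k y ^ 2)) y := fun y => by
    have h1 := (hasDerivAt_hermiteDeriv k y).pow 2
    have h2 := (hasDerivAt_hermiteFun k y).pow 2
    have h3 : HasDerivAt (fun y : ℝ => (2 * (k : ℝ) + 1 - y ^ 2)) (-(2 * y)) y := by
      exact ((hasDerivAt_pow 2 y).const_sub _).congr_deriv (by simp)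
    refine (h1.add (h3.mul h2)).congr_deriv ?_
    simp only [hermiteDeriv, Pi.pow_apply]
    push_cast
    ring
  have hanti : AntitoneOn
      (fun y => hermiteDeriv k y ^ 2 + (2 * k + 1 - y ^ 2) * hermiteFun k y ^ 2)
      (Set.Ici 0) := by
    refine antitoneOn_of_deriv_nonpos (convex_Ici 0)
      (fun y _ => (hd y).continuousAt.continuousWithinAt)
      (fun y _ => (hd y).differentiableAt.differentiableWithinAt) fun y hy => ?_
    rw [(hd y).deriv]
    rw [interior_Ici] at hy
    have : 0 ≤ y := le_of_lt hy
    have : 0 ≤ 2 * y * hermiteFun k y ^ 2 := by positivity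
    linarith
  simpa using hanti (Set.mem_Ici.2 le_rfl) (Set.mem_Ici.2 hx) hx

theorem abs_sub_le_of_abs_deriv_le {g g' : ℝ → ℝ} (hd : ∀ x, HasDerivAt g (g' x) x)
    (hc : Continuous g') {C y : ℝ} (j : ℕ) (hy : 0 ≤ y)
    (hb : ∀ x, 0 ≤ x → x ≤ y → |g' x| ≤ C * x ^ j) :
    |g y - g 0| ≤ C / (j + 1) * y ^ (j + 1) := by
  rw [← intervalIntegral.integral_eq_sub_of_hasDerivAt (fun x _ => hd x)
    (hc.intervalIntegrable _ _)]
  have h := intervalIntegral.norm_integral_le_of_norm_le (f := g') (μ := volume) hy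
    (ae_of_all _ fun x hx => hb x hx.1.le hx.2)
    (Continuous.intervalIntegrable (by fun_prop : Continuous fun x : ℝ => C * x ^ j) 0 y)
  rw [intervalIntegral.integral_const_mul, integral_pow] at h
  refine h.trans (le_of_eq ?_)
  rw [zero_pow (Nat.succ_ne_zero j)]
  ring

theorem continuous_hermiteDeriv (k : ℕ) : Continuous (hermiteDeriv k) :=
  continuous_iff_continuousAt.2 fun x => (hasDerivAt_hermiteDeriv k x).continuousAt

/-- For even k the initial energy is (2k+1)h(0)², which bounds h'' by (2k+1)|h(0)|; integrate twice.
The restriction to |y| ≤ 1 keeps 2k+1-x² nonnegative. -/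
theorem hermiteFun_taylor_even {k : ℕ} (hk : Even k) {y : ℝ} (hy : |y| ≤ 1) :
    |hermiteFun k y - hermiteFun k 0 - hermiteDeriv k 0 * y|
      ≤ (2 * k + 1) * |hermiteFun k 0| / 2 * |y| ^ 2 := by
  have hd0 := hermiteDeriv_zero_of_even hk
  set C := (2 * (k : ℝ) + 1) * |hermiteFun k 0| with hC
  have hC0 : 0 ≤ C := by positivity
  have key : ∀ y : ℝ, 0 ≤ y → y ≤ 1 → |hermiteFun k y - hermiteFun k 0| ≤ C / 2 * y ^ 2 := by
    intro y hy0 hy1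
    have h2 : ∀ x, 0 ≤ x → x ≤ y → |(-((2 * k + 1 - x ^ 2) * hermiteFun k x))| ≤ C * x ^ 0 := by
      intro x hx0 hxy
      have hE := hermite_energy_le k hx0
      rw [hd0] at hE
      have hl : 0 ≤ 2 * (k : ℝ) + 1 - x ^ 2 := by
        have : (0 : ℝ) ≤ k := by positivity
        nlinarith
      rw [pow_zero, mul_one, abs_neg]
      refine abs_le_of_sq_le_sq ?_ hC0
      rw [hC, mul_pow, mul_pow, sq_abs]
      calc (2 * (k : ℝ) + 1 - x ^ 2) ^ 2 * hermiteFun k x ^ 2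
          = (2 * (k : ℝ) + 1 - x ^ 2) * ((2 * (k : ℝ) + 1 - x ^ 2) * hermiteFun k x ^ 2) := by ring
        _ ≤ (2 * (k : ℝ) + 1) * ((2 * (k : ℝ) + 1) * hermiteFun k 0 ^ 2) := by
            refine mul_le_mul (by nlinarith [sq_nonneg x])
              (by nlinarith [sq_nonneg (hermiteDeriv k x)]) (by positivity) (by positivity)
        _ = _ := by ring
    have h1 : ∀ x, 0 ≤ x → x ≤ y → |hermiteDeriv k x| ≤ C * x ^ 1 := by
      intro x hx0 hxy
      have := abs_sub_le_of_abs_deriv_le (hasDerivAt_hermiteDeriv k)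
        (by have := continuous_hermiteFun k; fun_prop) 0 hx0
        (fun z hz0 hzx => h2 z hz0 (hzx.trans hxy))
      rw [hd0] at this
      simpa using this
    have h0 := abs_sub_le_of_abs_deriv_le (hasDerivAt_hermiteFun k) (continuous_hermiteDeriv k) 1
      hy0 h1
    norm_num at h0
    exact h0
  rw [hd0, zero_mul, sub_zero]
  rcases le_total 0 y with h | h
  · rw [abs_of_nonneg h] at hy ⊢
    exact key y h hy
  · rw [abs_of_nonpos h] at hy ⊢
    have := key (-y) (by linarith) hy
    rwa [hermiteFun_neg, hk.neg_one_pow, one_mul] at this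

/-- For odd k the initial energy is h'(0)², so |h'| ≤ |h'(0)| and |h| ≤ |h'(0)|x. Inserting this
into the Hermite equation and integrating twice more gives the cubic remainder. -/
theorem hermiteFun_taylor_odd {k : ℕ} (hk : Odd k) {y : ℝ} (hy : |y| ≤ 1) :
    |hermiteFun k y - hermiteFun k 0 - hermiteDeriv k 0 * y|
      ≤ (2 * k + 1) * |hermiteDeriv k 0| / 6 * |y| ^ 3 := by
  have hd0 := hermiteFun_zero_of_odd hk
  set D := hermiteDeriv k 0 with hD
  have key : ∀ y : ℝ, 0 ≤ y → y ≤ 1 →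
      |hermiteFun k y - D * y| ≤ (2 * k + 1) * |D| / 6 * y ^ 3 := by
    intro y hy0 hy1
    have hE : ∀ x, 0 ≤ x → x ≤ y → |hermiteDeriv k x| ≤ |D| * x ^ 0 := by
      intro x hx0 hxy
      have hE := hermite_energy_le k hx0
      rw [hd0] at hE
      have hl : 0 ≤ 2 * (k : ℝ) + 1 - x ^ 2 := by
        have : (0 : ℝ) ≤ k := by positivity
        nlinarith
      rw [pow_zero, mul_one]
      refine sq_le_sq.1 ?_
      have : 0 ≤ (2 * (k : ℝ) + 1 - x ^ 2) * hermiteFun k x ^ 2 := by positivity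
      linarith
    have h3 : ∀ x, 0 ≤ x → x ≤ y → |hermiteFun k x| ≤ |D| * x := by
      intro x hx0 hxy
      have := abs_sub_le_of_abs_deriv_le (hasDerivAt_hermiteFun k) (continuous_hermiteDeriv k) 0
        hx0 (fun z hz0 hzx => hE z hz0 (hzx.trans hxy))
      rw [hd0] at this
      simpa using this
    have h2 : ∀ x, 0 ≤ x → x ≤ y →
        |(-((2 * k + 1 - x ^ 2) * hermiteFun k x))| ≤ (2 * k + 1) * |D| * x ^ 1 := by
      intro x hx0 hxy
      have hl : 0 ≤ 2 * (k : ℝ) + 1 - x ^ 2 := by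
        have : (0 : ℝ) ≤ k := by positivity
        nlinarith
      rw [abs_neg, abs_mul, abs_of_nonneg hl, pow_one, mul_assoc]
      have := h3 x hx0 hxy
      gcongr
      nlinarith [sq_nonneg x]
    have h1 : ∀ x, 0 ≤ x → x ≤ y → |hermiteDeriv k x - D| ≤ (2 * k + 1) * |D| / 2 * x ^ 2 := by
      intro x hx0 hxy
      have := abs_sub_le_of_abs_deriv_le (hasDerivAt_hermiteDeriv k)
        (by have := continuous_hermiteFun k; fun_prop) 1 hx0
        (fun z hz0 hzx => h2 z hz0 (hzx.trans hxy))
      norm_num at this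
      exact this
    have hdg : ∀ x, HasDerivAt (fun x => hermiteFun k x - D * x) (hermiteDeriv k x - D) x :=
      fun x => ((hasDerivAt_hermiteFun k x).sub ((hasDerivAt_id x).const_mul D)).congr_deriv
        (by rw [mul_one]; rfl)
    have h0 := abs_sub_le_of_abs_deriv_le hdg
      (by have := continuous_hermiteDeriv k; fun_prop) 2 hy0 h1
    rw [hd0] at h0
    norm_num at h0
    calc _ ≤ _ := h0
      _ = _ := by ring
  rw [hd0, sub_zero]
  rcases le_total 0 y with h | h
  · rw [abs_of_nonneg h] at hy ⊢
    exact key y h hy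
  · rw [abs_of_nonpos h] at hy ⊢
    have := key (-y) (by linarith) hy
    rw [hermiteFun_neg, hk.neg_one_pow, ← abs_neg] at this
    convert this using 2
    ring

theorem hermiteFun_add_two_zero_sq (k : ℕ) :
    (k + 2) * hermiteFun (k + 2) 0 ^ 2 = (k + 1) * hermiteFun k 0 ^ 2 := by
  have h := hermiteFun_recurrence k 0
  have h1 := Real.sq_sqrt (show (0 : ℝ) ≤ 2 * ((k : ℝ) + 1) by positivity)
  have h2 := Real.sq_sqrt (show (0 : ℝ) ≤ 2 * ((k : ℝ) + 2) by positivity)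
  have h3 : (√(2 * ((k : ℝ) + 2)) * hermiteFun (k + 2) 0) ^ 2
      = (√(2 * ((k : ℝ) + 1)) * hermiteFun k 0) ^ 2 := by
    rw [← neg_sq (√(2 * ((k : ℝ) + 1)) * _)]; congr 1; linarith
  rw [mul_pow, mul_pow, h1, h2] at h3
  linarith

theorem hermiteDeriv_zero_sq (k : ℕ) :
    hermiteDeriv k 0 ^ 2 = 2 * (k + 1) * hermiteFun (k + 1) 0 ^ 2 := by
  have h1 := Real.sq_sqrt (show (0 : ℝ) ≤ 2 * ((k : ℝ) + 1) by positivity)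
  rw [hermiteDeriv, zero_mul, zero_sub, neg_sq, mul_pow, h1]

theorem hermiteDeriv_succ_zero_sq (k : ℕ) :
    hermiteDeriv (k + 1) 0 ^ 2 = 2 * (k + 1) * hermiteFun k 0 ^ 2 := by
  rw [hermiteDeriv_zero_sq, show k + 1 + 1 = k + 2 from rfl, mul_assoc, mul_assoc,
    ← hermiteFun_add_two_zero_sq]
  push_cast; ring

theorem sum_hermiteDeriv_zero_sq (n : ℕ) : ∑ k ∈ Finset.range (n + 1), hermiteDeriv k 0 ^ 2
    = ∑ k ∈ Finset.range n, 2 * ((k : ℝ) + 1) * hermiteFun k 0 ^ 2 := by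
  rw [Finset.sum_range_succ', hermiteDeriv_zero_of_even ⟨0, rfl⟩]
  simp only [hermiteDeriv_succ_zero_sq]
  ring

/-- Telescoping: odd degrees vanish at 0, and (2J+2)h_{2J+2}(0)² = (2J+1)h_{2J}(0)². -/
theorem sum_hermiteFun_zero_sq (J : ℕ) :
    ∑ k ∈ Finset.range (2 * J + 1), hermiteFun k 0 ^ 2
      = (2 * J + 1) * hermiteFun (2 * J) 0 ^ 2 := by
  induction J with
  | zero => simp
  | succ J ih =>
    have h := hermiteFun_add_two_zero_sq (2 * J)
    rw [show 2 * (J + 1) + 1 = 2 * J + 1 + 1 + 1 by ring, Finset.sum_range_succ,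
      Finset.sum_range_succ, ih, hermiteFun_zero_of_odd ⟨J, rfl⟩,
      show 2 * (J + 1) = 2 * J + 2 by ring, show 2 * J + 1 + 1 = 2 * J + 2 by ring]
    push_cast at h ⊢
    linear_combination -h

theorem sum_mul_hermiteFun_zero_sq (J : ℕ) :
    ∑ k ∈ Finset.range (2 * J + 1), 2 * ((k : ℝ) + 1) * hermiteFun k 0 ^ 2
      = 2 * (2 * J + 3) / 3 * ((2 * J + 1) * hermiteFun (2 * J) 0 ^ 2) := by
  induction J with
  | zero => norm_num
  | succ J ih =>
    have h := hermiteFun_add_two_zero_sq (2 * J)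
    rw [show 2 * (J + 1) + 1 = 2 * J + 1 + 1 + 1 by ring, Finset.sum_range_succ,
      Finset.sum_range_succ, ih, hermiteFun_zero_of_odd ⟨J, rfl⟩,
      show 2 * (J + 1) = 2 * J + 2 by ring, show 2 * J + 1 + 1 = 2 * J + 2 by ring]
    push_cast at h ⊢
    linear_combination (-(2 * (2 * J + 3) / 3) : ℝ) * h

theorem pi_mul_hermiteFun_zero_pow_four : Real.pi * (hermiteFun 0 0 ^ 2) ^ 2 = 1 := by
  have h := hermiteNorm_zero_sq
  have h1 := Real.sq_sqrt Real.pi_pos.le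
  have h2 : hermiteFun 0 0 = hermiteNorm 0 := by rw [hermiteFun_zero]; simp
  rw [h2]
  calc Real.pi * (hermiteNorm 0 ^ 2) ^ 2 = (hermiteNorm 0 ^ 2 * √Real.pi) ^ 2 := by
        rw [mul_pow, h1]; ring
    _ = 1 := by rw [h]; norm_num

/-- Wallis-type monotonicity: the left side is nonincreasing in J because (2J+1)(2J+3) ≤ (2J+2)². -/
theorem hermiteFun_two_mul_zero_le (J : ℕ) :
    Real.pi * (hermiteFun (2 * J) 0 ^ 2) ^ 2 * (2 * J + 1) ≤ 1 := by
  induction J with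
  | zero => simpa using pi_mul_hermiteFun_zero_pow_four.le
  | succ J ih =>
    have h := hermiteFun_add_two_zero_sq (2 * J)
    rw [show 2 * (J + 1) = 2 * J + 2 by ring]
    push_cast at h ⊢
    set q := hermiteFun (2 * J) 0 ^ 2
    set r := hermiteFun (2 * J + 2) 0 ^ 2
    refine le_of_mul_le_mul_right (a := (2 * (J : ℝ) + 2) ^ 2) ?_ (by positivity)
    calc _ = Real.pi * ((2 * J + 2) * r) ^ 2 * (2 * J + 3) := by ring
      _ = (Real.pi * q ^ 2 * (2 * J + 1)) * ((2 * J + 1) * (2 * J + 3)) := by rw [h]; ring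
      _ ≤ 1 * (2 * (J : ℝ) + 2) ^ 2 := by gcongr; nlinarith

/-- The companion Wallis quantity is nondecreasing. Its value at degree 2 is 5/4; starting at degree
0 would give only 1, too little for the later comparison with c. -/
theorem le_hermiteFun_two_mul_zero (J : ℕ) :
    5 / 4 ≤ Real.pi * (hermiteFun (2 * (J + 1)) 0 ^ 2) ^ 2 * (4 * J + 5) := by
  induction J with
  | zero =>
    have h := hermiteFun_add_two_zero_sq 0
    have h0 := pi_mul_hermiteFun_zero_pow_four
    norm_num at h ⊢
    rw [← h] at h0
    linarith
  | succ J ih =>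
    have h := hermiteFun_add_two_zero_sq (2 * (J + 1))
    rw [show 2 * (J + 1 + 1) = 2 * (J + 1) + 2 by ring]
    push_cast at h ⊢
    set q := hermiteFun (2 * (J + 1)) 0 ^ 2
    set r := hermiteFun (2 * (J + 1) + 2) 0 ^ 2
    refine le_of_mul_le_mul_right (a := (2 * ((J : ℝ) + 1) + 2) ^ 2 * (4 * J + 5)) ?_
      (by positivity)
    calc 5 / 4 * ((2 * ((J : ℝ) + 1) + 2) ^ 2 * (4 * J + 5))
        ≤ (Real.pi * q ^ 2 * (4 * J + 5)) * ((2 * (J + 1) + 1) ^ 2 * (4 * (J + 1) + 5)) := by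
          refine mul_le_mul ih ?_ (by positivity) (by linarith)
          nlinarith [(Nat.cast_nonneg J : (0 : ℝ) ≤ J)]
      _ = Real.pi * ((2 * (J + 1) + 1) * q) ^ 2 * (4 * J + 5) * (4 * (J + 1) + 5) := by ring
      _ = _ := by rw [← h]; ring

/-- Two-sided bounds for the diagonal of the Hermite kernel at the origin. -/
theorem hermite_diagonal_bounds (J : ℕ) :
    5 / 8 * (2 * J + 1) ≤ Real.pi * ((2 * J + 1) * hermiteFun (2 * J) 0 ^ 2) ^ 2 ∧
    Real.pi * ((2 * J + 1) * hermiteFun (2 * J) 0 ^ 2) ^ 2 ≤ 2 * J + 1 := by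
  constructor
  · rcases J with _ | J
    · have := pi_mul_hermiteFun_zero_pow_four
      norm_num at this ⊢
      linarith
    · have h := le_hermiteFun_two_mul_zero J
      set q := hermiteFun (2 * (J + 1)) 0 ^ 2
      push_cast
      refine le_of_mul_le_mul_right (a := (4 * (J : ℝ) + 5)) ?_ (by positivity)
      calc _ ≤ 5 / 4 * (2 * ((J : ℝ) + 1) + 1) ^ 2 := by nlinarith [(Nat.cast_nonneg J : (0 : ℝ) ≤ J)]
        _ ≤ (Real.pi * q ^ 2 * (4 * J + 5)) * (2 * ((J : ℝ) + 1) + 1) ^ 2 := by gcongr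
        _ = _ := by ring
  · have h := hermiteFun_two_mul_zero_le J
    calc _ = (Real.pi * (hermiteFun (2 * J) 0 ^ 2) ^ 2 * (2 * J + 1)) * (2 * J + 1) := by ring
      _ ≤ 1 * (2 * J + 1) := by gcongr
      _ = _ := one_mul _

theorem sum_range_hermiteFun_zero_sq_bounds (n : ℕ) :
    5 / 8 * (n : ℝ) ≤ Real.pi * (∑ k ∈ Finset.range (n + 1), hermiteFun k 0 ^ 2) ^ 2 ∧
    Real.pi * (∑ k ∈ Finset.range (n + 1), hermiteFun k 0 ^ 2) ^ 2 ≤ n + 1 := by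
  rcases Nat.even_or_odd' n with ⟨J, rfl | rfl⟩
  · rw [sum_hermiteFun_zero_sq]
    have h := hermite_diagonal_bounds J
    push_cast
    exact ⟨by linarith, h.2⟩
  · rw [Finset.sum_range_succ, hermiteFun_zero_of_odd ⟨J, rfl⟩, sum_hermiteFun_zero_sq]
    have h := hermite_diagonal_bounds J
    push_cast
    rw [zero_pow two_ne_zero, add_zero]
    exact ⟨by linarith, by linarith⟩

theorem sum_range_hermiteDeriv_zero_sq_ge (n : ℕ) :
    5 / 9 * (n : ℝ) ^ 3 ≤ 8 * (Real.pi *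
      (∑ k ∈ Finset.range (n + 1), hermiteDeriv k 0 ^ 2) ^ 2) := by
  rw [sum_hermiteDeriv_zero_sq]
  have key : ∀ J : ℕ, 5 / 9 * (2 * (J : ℝ) + 2) ^ 3 ≤ 8 * (Real.pi *
      (2 * (2 * J + 3) / 3 * ((2 * J + 1) * hermiteFun (2 * J) 0 ^ 2)) ^ 2) := fun J => by
    have h := (hermite_diagonal_bounds J).1
    calc _ ≤ 8 * (4 * (2 * (J : ℝ) + 3) ^ 2 / 9 * (5 / 8 * (2 * J + 1))) := by
          nlinarith [(Nat.cast_nonneg J : (0 : ℝ) ≤ J)]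
      _ ≤ 8 * (4 * (2 * (J : ℝ) + 3) ^ 2 / 9 *
          (Real.pi * ((2 * J + 1) * hermiteFun (2 * J) 0 ^ 2) ^ 2)) := by gcongr
      _ = _ := by ring
  rcases Nat.even_or_odd' n with ⟨J, rfl | rfl⟩
  · rcases J with _ | J
    · simp
    · rw [show 2 * (J + 1) = 2 * J + 1 + 1 by ring, Finset.sum_range_succ,
        hermiteFun_zero_of_odd ⟨J, rfl⟩, sum_mul_hermiteFun_zero_sq]
      have := key J
      push_cast
      rw [zero_pow two_ne_zero, mul_zero, add_zero]
      refine le_trans (le_of_eq ?_) this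
      ring
  · rw [sum_mul_hermiteFun_zero_sq]
    refine le_trans ?_ (key J)
    push_cast
    gcongr
    norm_num

end HermiteNearZero

/-! ### Band and Hermite energies through the first two moments -/

section Moments

local notation "L²" => Lp ℂ 2 (volume : Measure ℝ)

theorem setOf_abs_le_eq_Icc (T : ℝ) : {x : ℝ | |x| ≤ T} = Set.Icc (-T) T := by
  ext x; simp [abs_le]

theorem memLp_intervalInd_mul (T : ℝ) {φ : ℝ → ℂ} (hφ : Continuous φ) :
    MemLp (fun x => (intervalInd T x : ℂ) * φ x) 2 volume := by
  refine (memLp_two_iff_integrable_sq_norm ((Complex.measurable_ofReal.comp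
    (measurable_intervalInd T)).mul hφ.measurable).aestronglyMeasurable).2 ?_
  have h : (fun x => ‖(intervalInd T x : ℂ) * φ x‖ ^ 2)
      = {x : ℝ | |x| ≤ T}.indicator (fun x => ‖φ x‖ ^ 2) := by
    funext x
    by_cases hx : |x| ≤ T <;> simp [intervalInd, hx]
  change Integrable (fun x => ‖(intervalInd T x : ℂ) * φ x‖ ^ 2) volume
  rw [h, integrable_indicator_iff (measurableSet_le continuous_abs.measurable measurable_const),
    setOf_abs_le_eq_Icc]
  exact (Continuous.continuousOn (by fun_prop)).integrableOn_Icc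

/-- A continuous function cut off to `[-T, T]`, as an element of `L²`. -/
noncomputable def cutL (T : ℝ) {φ : ℝ → ℂ} (hφ : Continuous φ) : L² :=
  (memLp_intervalInd_mul T hφ).toLp _

theorem cutL_ae (T : ℝ) {φ : ℝ → ℂ} (hφ : Continuous φ) :
    cutL T hφ =ᵐ[volume] fun x => (intervalInd T x : ℂ) * φ x :=
  MemLp.coeFn_toLp (memLp_intervalInd_mul T hφ)

variable {T : ℝ} {w : L²}

theorem inner_cutL_ae (hw : timeProj T w = w) {φ : ℝ → ℂ} (hφ : Continuous φ) :
    (fun x => (inner ℂ (cutL T (Complex.continuous_conj.comp hφ) x) (w x) : ℂ))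
      =ᵐ[volume] fun x => w x * φ x := by
  have h1 := timeProj_ae T w
  rw [hw] at h1
  filter_upwards [h1, cutL_ae T (Complex.continuous_conj.comp hφ)] with x h1 h2
  rw [h2, RCLike.inner_apply, Function.comp_apply, map_mul, Complex.conj_conj, Complex.conj_ofReal]
  conv_rhs => rw [h1]
  ring

theorem integrable_timeProj_mul (hw : timeProj T w = w) {φ : ℝ → ℂ} (hφ : Continuous φ) :
    Integrable (fun x => w x * φ x) :=
  (L2.integrable_inner (𝕜 := ℂ) _ w).congr (inner_cutL_ae hw hφ)

/-- Cauchy–Schwarz on [-T, T]. A factor vanishing to order j at 0 yields t^{2j+1}, the source of the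
powers t⁵ and t⁷ in the error terms. -/
theorem norm_sq_integral_mul_le (hw : timeProj T w = w) {α : ℝ} (hα : 0 < α) (hT : 0 ≤ T)
    {φ : ℝ → ℂ} (hφ : Continuous φ) {C : ℝ} (j : ℕ)
    (hb : ∀ x, |x| ≤ T → ‖φ x‖ ≤ C * |x / α| ^ j) :
    ‖∫ x, w x * φ x‖ ^ 2
      ≤ C ^ 2 * (α * (2 * (T / α) ^ (2 * j + 1) / (2 * j + 1))) * ‖w‖ ^ 2 := by
  set g := cutL T (Complex.continuous_conj.comp hφ) with hg
  have h1 : ∫ x, w x * φ x = inner ℂ g w := by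
    rw [L2.inner_def]; exact (integral_congr_ae (inner_cutL_ae hw hφ)).symm
  have h2 : ‖g‖ ^ 2 ≤ C ^ 2 * (α * (2 * (T / α) ^ (2 * j + 1) / (2 * j + 1))) := by
    rw [norm_sq_eq_integral]
    have e1 : ∫ x, ‖g x‖ ^ 2 = ∫ x in Set.Icc (-T) T, ‖φ x‖ ^ 2 := by
      rw [← setOf_abs_le_eq_Icc, ← integral_indicator
        (measurableSet_le continuous_abs.measurable measurable_const)]
      refine integral_congr_ae ?_
      filter_upwards [cutL_ae T (Complex.continuous_conj.comp hφ)] with x hx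
      rw [hg, hx]
      by_cases h : |x| ≤ T <;> simp [intervalInd, h]
    have e2 : ∫ x in -T..T, C ^ 2 * (x / α) ^ (2 * j)
        = C ^ 2 * (α * (2 * (T / α) ^ (2 * j + 1) / (2 * j + 1))) := by
      rw [intervalIntegral.integral_const_mul,
        intervalIntegral.integral_comp_div (fun x => x ^ (2 * j)) hα.ne', integral_pow, smul_eq_mul,
        neg_div, Odd.neg_pow ⟨j, rfl⟩]
      push_cast
      ring
    rw [e1, ← e2, intervalIntegral.integral_of_le (by linarith), ← integral_Icc_eq_integral_Ioc]
    refine setIntegral_mono_on ?_ ?_ measurableSet_Icc fun x hx => ?_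
    · exact (Continuous.continuousOn (by fun_prop)).integrableOn_Icc
    · exact (Continuous.continuousOn (by fun_prop)).integrableOn_Icc
    · have := hb x (abs_le.2 hx)
      calc ‖φ x‖ ^ 2 ≤ (C * |x / α| ^ j) ^ 2 := by gcongr
        _ = _ := by rw [mul_pow, ← pow_mul, mul_comm j 2, pow_mul, sq_abs, ← pow_mul]
  rw [h1]
  calc ‖(inner ℂ g w : ℂ)‖ ^ 2 ≤ (‖g‖ * ‖w‖) ^ 2 := by gcongr; exact norm_inner_le_norm _ _
    _ = ‖g‖ ^ 2 * ‖w‖ ^ 2 := by ring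
    _ ≤ _ := by gcongr

theorem norm_exp_I_mul_sub_le (s : ℝ) :
    ‖Complex.exp (-(Complex.I * s)) - 1 - -(Complex.I * s)‖ ≤ s ^ 2 / 2 := by
  have key : ∀ s : ℝ, 0 ≤ s →
      ‖Complex.exp (Complex.I * s) - 1 - Complex.I * s‖ ≤ s ^ 2 / 2 := by
    intro s hs
    have hd : ∀ x ∈ Set.uIcc 0 s, HasDerivAt
        (fun x : ℝ => Complex.exp (Complex.I * x) - 1 - Complex.I * x)
        (Complex.I * (Complex.exp (Complex.I * x) - 1)) x := fun x _ => by
      have h1 : HasDerivAt (fun x : ℝ => Complex.I * (x : ℂ)) Complex.I x := by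
        simpa using (Complex.ofRealCLM.hasDerivAt (x := x)).const_mul Complex.I
      refine ((h1.cexp.sub_const 1).sub h1).congr_deriv ?_
      ring
    have h := intervalIntegral.integral_eq_sub_of_hasDerivAt hd
      (Continuous.intervalIntegrable (by fun_prop) _ _)
    have h2 := intervalIntegral.norm_integral_le_of_norm_le (μ := volume) hs
      (f := fun x : ℝ => Complex.I * (Complex.exp (Complex.I * x) - 1)) (g := fun x => x)
      (ae_of_all _ fun x hx => by
        rw [norm_mul, Complex.norm_I, one_mul]
        refine Real.norm_exp_I_mul_ofReal_sub_one_le.trans ?_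
        rw [Real.norm_of_nonneg hx.1.le]) (Continuous.intervalIntegrable (by fun_prop) _ _)
    rw [h, integral_id] at h2
    simpa using h2
  rcases le_total 0 s with h | h
  · have h1 := key s h
    rw [← Complex.norm_conj] at h1
    simpa [← Complex.exp_conj] using h1
  · have h1 := key (-s) (by linarith)
    simpa using h1

/-- Weights 1 + δ and 1 + 1/δ with δ = 2/5; the next lemma uses δ = 1/3. The resulting ratio of 7/5
to 3/4 stays below 2, the margin available between K and Q. -/
theorem norm_add_sq_le {a b : ℂ} : ‖a + b‖ ^ 2 ≤ 7 / 5 * ‖a‖ ^ 2 + 7 / 2 * ‖b‖ ^ 2 := by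
  have h := norm_add_le a b
  have h1 : ‖a + b‖ ^ 2 ≤ (‖a‖ + ‖b‖) ^ 2 := by gcongr
  nlinarith [sq_nonneg (2 * ‖a‖ - 5 * ‖b‖)]

theorem le_norm_add_sq {a b : ℂ} : 3 / 4 * ‖a‖ ^ 2 - 3 * ‖b‖ ^ 2 ≤ ‖a + b‖ ^ 2 := by
  have h := norm_sub_le (a + b) b
  rw [add_sub_cancel_right] at h
  have h1 : ‖a‖ ^ 2 ≤ (‖a + b‖ + ‖b‖) ^ 2 := by gcongr
  nlinarith [sq_nonneg (‖a + b‖ - 3 * ‖b‖)]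

theorem fourier_timeProj_ae (hw : timeProj T w = w) {α : ℝ} (hα : 0 < α) :
    (𝓕 w : L²) =ᵐ[volume] fun ξ => ∫ x, w x *
      Complex.exp (-(Complex.I * ((2 * Real.pi * α * ξ * (x / α) : ℝ) : ℂ))) := by
  have hi : Integrable w := by rw [← hw]; exact integrable_timeProj T w
  filter_upwards [fourier_coeFn_ae_eq w hi] with ξ hξ
  rw [hξ, Real.fourier_real_eq_integral_exp_smul]
  congr 1
  funext x
  rw [smul_eq_mul, mul_comm]
  congr 2
  have : (α : ℂ) ≠ 0 := by exact_mod_cast hα.ne'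
  push_cast
  field_simp

theorem norm_sq_bandProj_le_of_bound (hα : 0 < (α : ℝ)) {c : ℝ} (hc : 0 ≤ c) {G : ℝ → ℝ}
    (hG : Continuous G) (hw : timeProj T w = w)
    (hb : ∀ ω : ℝ, ‖∫ x, w x * Complex.exp (-(Complex.I * ((ω * (x / α) : ℝ) : ℂ)))‖ ^ 2 ≤ G ω) :
    ‖bandProj (c / (2 * Real.pi * α)) w‖ ^ 2 ≤ (2 * Real.pi * α)⁻¹ * ∫ ω in -c..c, G ω := by
  set B := c / (2 * Real.pi * α) with hB
  have hB0 : 0 ≤ B := by positivity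
  have hBc : 2 * Real.pi * α * B = c := by rw [hB]; field_simp
  rw [norm_bandProj, norm_sq_timeProj, setOf_abs_le_eq_Icc]
  calc ∫ x in Set.Icc (-B) B, ‖(𝓕 w : L²) x‖ ^ 2
      ≤ ∫ ξ in Set.Icc (-B) B, G (2 * Real.pi * α * ξ) := by
        refine setIntegral_mono_ae (integrable_norm_sq _).integrableOn ?_ ?_
        · exact (Continuous.continuousOn (by fun_prop)).integrableOn_Icc
        · filter_upwards [fourier_timeProj_ae hw hα] with ξ hξ
          rw [hξ]
          exact hb _
    _ = _ := by
        rw [integral_Icc_eq_integral_Ioc, ← intervalIntegral.integral_of_le (by linarith),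
          intervalIntegral.integral_comp_mul_left G (by positivity), smul_eq_mul, mul_neg, hBc]

theorem norm_sq_bandProj_timeProj_le {α : ℝ} (hα : 0 < α) {c : ℝ} (hc : 0 ≤ c) (hT : 0 ≤ T)
    (hw : timeProj T w = w) :
    ‖bandProj (c / (2 * Real.pi * α)) w‖ ^ 2 ≤ 2 * (c * (T / α)) / Real.pi * ‖w‖ ^ 2 := by
  refine (norm_sq_bandProj_le_of_bound hα hc (continuous_const (y := 2 * T * ‖w‖ ^ 2)) hw
    fun ω => ?_).trans (le_of_eq ?_)
  · refine (norm_sq_integral_mul_le hw hα hT (C := 1) (by fun_prop) 0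
      fun x _ => ?_).trans (le_of_eq ?_)
    · rw [Complex.norm_exp]; simp
    · have : α * (T / α) = T := by field_simp
      norm_num
      left
      linarith
  · rw [intervalIntegral.integral_const, smul_eq_mul]
    field_simp
    ring

/-- The zeroth and first moments determine a short function in a narrow band up to a small error. -/
theorem norm_sq_bandProj_le_moments {α : ℝ} (hα : 0 < α) {c : ℝ} (hc : 0 ≤ c) (hT : 0 ≤ T)
    (hw : timeProj T w = w) :
    ‖bandProj (c / (2 * Real.pi * α)) w‖ ^ 2 ≤
      7 / 5 * (c / (Real.pi * α) * ‖∫ x, w x‖ ^ 2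
        + c ^ 3 / (3 * Real.pi * α) * ‖∫ x, w x * ((x / α : ℝ) : ℂ)‖ ^ 2)
      + 7 / (100 * Real.pi) * (c * (T / α)) ^ 5 * ‖w‖ ^ 2 := by
  set m₀ := ∫ x, w x with hm₀
  set m₁ := ∫ x, w x * ((x / α : ℝ) : ℂ) with hm₁
  -- The cross term of the two moments is linear in ω, so it integrates to zero over the symmetric
  -- band.
  set κ := 2 * (m₀ * (starRingEnd ℂ) (-(Complex.I * m₁))).re with hκ
  have hexp : ∀ ω : ℝ, ‖m₀ + ω * -(Complex.I * m₁)‖ ^ 2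
      = ‖m₀‖ ^ 2 + κ * ω + ‖m₁‖ ^ 2 * ω ^ 2 := fun ω => by
    rw [← Complex.normSq_eq_norm_sq, ← Complex.normSq_eq_norm_sq, ← Complex.normSq_eq_norm_sq, hκ]
    simp [Complex.normSq_apply]
    ring
  set G : ℝ → ℝ := fun ω => 7 / 5 * (‖m₀‖ ^ 2 + κ * ω + ‖m₁‖ ^ 2 * ω ^ 2)
    + 7 / 2 * (1 / 4 * (α * (2 * (T / α) ^ 5 / 5)) * ‖w‖ ^ 2) * ω ^ 4 with hG
  have hi0 : Integrable w := by rw [← hw]; exact integrable_timeProj T w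
  have hi1 := integrable_timeProj_mul hw (φ := fun x => ((x / α : ℝ) : ℂ)) (by fun_prop)
  refine (norm_sq_bandProj_le_of_bound hα hc (G := G) (by fun_prop) hw fun ω => ?_).trans
    (le_of_eq ?_)
  · set φ : ℝ → ℂ := fun x => Complex.exp (-(Complex.I * ((ω * (x / α) : ℝ) : ℂ))) - 1
      - -(Complex.I * ((ω * (x / α) : ℝ) : ℂ)) with hφ
    have hφc : Continuous φ := by fun_prop
    have e : ∫ x, w x * Complex.exp (-(Complex.I * ((ω * (x / α) : ℝ) : ℂ)))
        = (m₀ + ω * -(Complex.I * m₁)) + ∫ x, w x * φ x := by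
      rw [hm₀, hm₁, ← integral_const_mul, ← integral_neg, ← integral_const_mul,
        ← integral_add hi0, ← integral_add]
      · congr 1
        funext x
        simp only [hφ]
        push_cast; ring
      · exact hi0.add (((hi1.const_mul Complex.I).neg).const_mul (ω : ℂ))
      · exact integrable_timeProj_mul hw hφc
      · exact ((hi1.const_mul Complex.I).neg).const_mul (ω : ℂ)
    have hb := norm_sq_integral_mul_le hw hα hT hφc (C := ω ^ 2 / 2) 2
      fun x _ => by
        refine (norm_exp_I_mul_sub_le _).trans (le_of_eq ?_)
        rw [sq_abs]; ring
    rw [e]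
    refine norm_add_sq_le.trans ?_
    rw [hexp]
    simp only [hG]
    norm_num at hb ⊢
    nlinarith
  · simp only [hG]
    have hint : ∫ ω in -c..c, (7 / 5 * (‖m₀‖ ^ 2 + κ * ω + ‖m₁‖ ^ 2 * ω ^ 2)
        + 7 / 2 * (1 / 4 * (α * (2 * (T / α) ^ 5 / 5)) * ‖w‖ ^ 2) * ω ^ 4)
        = 7 / 5 * (2 * c * ‖m₀‖ ^ 2 + ‖m₁‖ ^ 2 * (2 * c ^ 3 / 3))
        + 7 / 2 * (1 / 4 * (α * (2 * (T / α) ^ 5 / 5)) * ‖w‖ ^ 2) * (2 * c ^ 5 / 5) := by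
      have hd : ∀ ω ∈ Set.uIcc (-c) c, HasDerivAt (fun ω : ℝ =>
          7 / 5 * (‖m₀‖ ^ 2 * ω + κ * (ω ^ 2 / 2) + ‖m₁‖ ^ 2 * (ω ^ 3 / 3))
          + 7 / 2 * (1 / 4 * (α * (2 * (T / α) ^ 5 / 5)) * ‖w‖ ^ 2) * (ω ^ 5 / 5))
          (7 / 5 * (‖m₀‖ ^ 2 + κ * ω + ‖m₁‖ ^ 2 * ω ^ 2)
            + 7 / 2 * (1 / 4 * (α * (2 * (T / α) ^ 5 / 5)) * ‖w‖ ^ 2) * ω ^ 4) ω := by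
        intro ω _
        refine ((((((hasDerivAt_id ω).const_mul (‖m₀‖ ^ 2)).add
          (((hasDerivAt_pow 2 ω).div_const 2).const_mul κ)).add
          (((hasDerivAt_pow 3 ω).div_const 3).const_mul (‖m₁‖ ^ 2))).const_mul (7 / 5)).add
          (((hasDerivAt_pow 5 ω).div_const 5).const_mul _)).congr_deriv ?_
        push_cast
        ring
      rw [intervalIntegral.integral_eq_sub_of_hasDerivAt hd
        (Continuous.intervalIntegrable (by fun_prop) _ _)]
      ring
    rw [hint]
    field_simp
    ring

variable {α : ℝ} (hα : 0 < α)

/-- Replace h_k by its linear Taylor polynomial. By parity only one of h_k(0), h_k'(0) is nonzero,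
hence no cross term; the remainder has order 2 or 3 accordingly. -/
theorem norm_sq_inner_hermiteL_ge (hT : 0 ≤ T) (hTα : T ≤ α) (hw : timeProj T w = w) (k : ℕ) :
    3 / 4 * (hermiteFun k 0 ^ 2 * ‖∫ x, w x‖ ^ 2
      + hermiteDeriv k 0 ^ 2 * ‖∫ x, w x * ((x / α : ℝ) : ℂ)‖ ^ 2)
      - 3 * (2 * k + 1) ^ 2 * α * ((T / α) ^ 5 / 10 * hermiteFun k 0 ^ 2
        + (T / α) ^ 7 / 126 * hermiteDeriv k 0 ^ 2) * ‖w‖ ^ 2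
      ≤ α * ‖(inner ℂ (hermiteL hα k) w : ℂ)‖ ^ 2 := by
  set m₀ := ∫ x, w x with hm₀
  set m₁ := ∫ x, w x * ((x / α : ℝ) : ℂ) with hm₁
  set a := hermiteFun k 0 with ha
  set d := hermiteDeriv k 0 with hd
  set φ : ℝ → ℂ := fun x =>
    ((hermiteFun k (x / α) - a - d * (x / α) : ℝ) : ℂ) with hφ
  have hφc : Continuous φ := by
    have := continuous_hermiteFun k
    fun_prop
  have hi0 : Integrable w := by rw [← hw]; exact integrable_timeProj T w
  have hi1 := integrable_timeProj_mul hw (φ := fun x => ((x / α : ℝ) : ℂ)) (by fun_prop)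
  have e : (inner ℂ (hermiteL hα k) w : ℂ)
      = (α ^ (-(1 / 2) : ℝ) : ℝ) * ((a * m₀ + d * m₁) + ∫ x, w x * φ x) := by
    rw [inner_hermiteL, hm₀, hm₁, ← integral_const_mul, ← integral_const_mul (d : ℂ),
      ← integral_add (hi0.const_mul (a : ℂ)) (hi1.const_mul (d : ℂ)), ← integral_add _
        (integrable_timeProj_mul hw hφc), ← integral_const_mul]
    swap
    · exact (hi0.const_mul (a : ℂ)).add (hi1.const_mul (d : ℂ))
    congr 1
    funext x
    simp only [hφ, scaledHermiteFun]
    push_cast; ring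
  have e2 : α * ‖(inner ℂ (hermiteL hα k) w : ℂ)‖ ^ 2
      = ‖(a * m₀ + d * m₁) + ∫ x, w x * φ x‖ ^ 2 := by
    rw [e, norm_mul, Complex.norm_real, mul_pow, Real.norm_eq_abs, sq_abs, pow_two (α ^ _),
      rpow_neg_half_sq hα, ← mul_assoc, mul_inv_cancel₀ hα.ne', one_mul]
  have hx1 : ∀ x, |x| ≤ T → |x / α| ≤ 1 := fun x hx => by
    rw [abs_div, abs_of_pos hα, div_le_one hα]; linarith
  rw [e2]
  refine le_trans ?_ le_norm_add_sq
  rcases Nat.even_or_odd k with hk | hk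
  · have hd0 : d = 0 := hermiteDeriv_zero_of_even hk
    have hb := norm_sq_integral_mul_le hw hα hT hφc (C := (2 * k + 1) * |a| / 2) 2
      fun x hx => by
        rw [hφ, Complex.norm_real, Real.norm_eq_abs]
        exact hermiteFun_taylor_even hk (hx1 x hx)
    have h2 : ((2 * k + 1) * |a| / 2) ^ 2 = (2 * (k : ℝ) + 1) ^ 2 * a ^ 2 / 4 := by
      rw [div_pow, mul_pow, sq_abs]; norm_num
    rw [h2] at hb
    simp only [hd0, Complex.ofReal_zero, zero_mul, add_zero, norm_mul, Complex.norm_real,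
      mul_pow, Real.norm_eq_abs, sq_abs]
    norm_num at hb ⊢
    linarith
  · have ha0 : a = 0 := hermiteFun_zero_of_odd hk
    have hb := norm_sq_integral_mul_le hw hα hT hφc (C := (2 * k + 1) * |d| / 6) 3
      fun x hx => by
        rw [hφ, Complex.norm_real, Real.norm_eq_abs]
        exact hermiteFun_taylor_odd hk (hx1 x hx)
    have h2 : ((2 * k + 1) * |d| / 6) ^ 2 = (2 * (k : ℝ) + 1) ^ 2 * d ^ 2 / 36 := by
      rw [div_pow, mul_pow, sq_abs]; norm_num
    rw [h2] at hb
    simp only [ha0, Complex.ofReal_zero, zero_mul, zero_add, norm_mul, Complex.norm_real,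
      mul_pow, Real.norm_eq_abs, sq_abs]
    norm_num at hb ⊢
    linarith

theorem norm_sq_hermiteProj_ge (hT : 0 ≤ T) (hTα : T ≤ α) (hw : timeProj T w = w) (n : ℕ)
    {S₀ S₁ : ℝ} (hS₀ : S₀ = ∑ k ∈ Finset.range (n + 1), hermiteFun k 0 ^ 2)
    (hS₁ : S₁ = ∑ k ∈ Finset.range (n + 1), hermiteDeriv k 0 ^ 2) :
    3 / 4 * (S₀ * ‖∫ x, w x‖ ^ 2 + S₁ * ‖∫ x, w x * ((x / α : ℝ) : ℂ)‖ ^ 2)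
      - 3 * (2 * n + 1) ^ 2 * α * ((T / α) ^ 5 / 10 * S₀ + (T / α) ^ 7 / 126 * S₁) * ‖w‖ ^ 2
      ≤ α * ‖hermiteProj hα n w‖ ^ 2 := by
  have h0 : 0 ≤ T / α := by positivity
  rw [hermiteProj, norm_sq_orthoSum (orthonormal_hermiteL hα), hS₀, hS₁, Finset.sum_mul,
    Finset.sum_mul, ← Finset.sum_add_distrib, Finset.mul_sum, Finset.mul_sum, Finset.mul_sum,
    ← Finset.sum_add_distrib, Finset.mul_sum, Finset.sum_mul, ← Finset.sum_sub_distrib,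
    Finset.mul_sum]
  refine Finset.sum_le_sum fun k hk => le_trans ?_ (norm_sq_inner_hermiteL_ge hα hT hTα hw k)
  have hkn : (k : ℝ) ≤ n := by exact_mod_cast Nat.lt_succ_iff.1 (Finset.mem_range.1 hk)
  refine sub_le_sub_left ?_ _
  gcongr

end Moments

/-! ### The estimate through moments, for short intervals -/

section SmallCase

/-- Numerical core of the moment case: τ stands for t², and 289/5 = (17/10) · 34 is the allowance
with t³/N removed. -/
theorem small_numeric {n : ℕ} (hn : 1 ≤ n) {τ : ℝ} (hτ : 0 ≤ τ)
    (h1 : n * τ ≤ 2 * (3925 / 10000) ^ 2) (h2 : n ≤ 11 ∨ τ * (2 * n + 1) ^ 3 ≤ 17 ^ 2) :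
    7 / 300 * (n ^ 2 * (2 * n + 1) / 8 * τ) + 3 * (2 * n + 1) ^ 2 *
      (5643 / 10000 * (14143 / 10000 * n + 10643 / 10000)) * (τ / 10 + τ ^ 2 * n / 63)
      ≤ 289 / 5 := by
  have hn' : (1 : ℝ) ≤ n := by exact_mod_cast hn
  rcases le_or_gt n 11 with h | h
  · have h3 : τ ≤ 2 * (3925 / 10000) ^ 2 / n := by
      rw [le_div_iff₀ (by linarith)]; linarith
    calc _ ≤ 7 / 300 * ((n : ℝ) ^ 2 * (2 * n + 1) / 8 * (2 * (3925 / 10000) ^ 2 / n))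
          + 3 * (2 * (n : ℝ) + 1) ^ 2 *
          (5643 / 10000 * (14143 / 10000 * n + 10643 / 10000)) * (2 * (3925 / 10000) ^ 2 / n / 10
            + (2 * (3925 / 10000) ^ 2 / n) ^ 2 * n / 63) := by gcongr
      _ ≤ _ := by interval_cases n <;> norm_num
  · have h4 : τ * (2 * n + 1) ^ 3 ≤ 17 ^ 2 := h2.resolve_left (by omega)
    have hn12 : (12 : ℝ) ≤ n := by exact_mod_cast h
    set m : ℝ := 2 * n + 1 with hm
    have hm25 : 25 ≤ m := by rw [hm]; linarith
    have hnm : (n : ℝ) ≤ m / 2 := by rw [hm]; linarith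
    have hρ : 5643 / 10000 * (14143 / 10000 * (n : ℝ) + 10643 / 10000) ≤ 4075 / 10000 * m := by
      rw [hm]; linarith
    have h5 : (τ * m ^ 2) ^ 2 ≤ (17 ^ 2 / 25) ^ 2 := by
      have : τ * m ^ 2 ≤ 17 ^ 2 / 25 := by
        rw [le_div_iff₀ (by norm_num)]
        calc τ * m ^ 2 * 25 ≤ τ * m ^ 2 * m := by gcongr
          _ = τ * m ^ 3 := by ring
          _ ≤ _ := h4
      gcongr
    calc _ ≤ 7 / 300 * ((m / 2) ^ 2 * m / 8 * τ) + 3 * m ^ 2 *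
          (4075 / 10000 * m) * (τ / 10 + τ ^ 2 * (m / 2) / 63) := by gcongr
      _ = (7 / 9600 + 3 * 4075 / 100000) * (τ * m ^ 3)
          + 3 * 4075 / 1260000 * (τ * m ^ 2) ^ 2 := by ring
      _ ≤ (7 / 9600 + 3 * 4075 / 100000) * 17 ^ 2
          + 3 * 4075 / 1260000 * (17 ^ 2 / 25) ^ 2 := by gcongr
      _ ≤ _ := by norm_num

/-- The error terms in the comparison of moments are dominated by the allowance. -/
theorem small_error_le {n : ℕ} (hn : 1 ≤ n) {c t N S₀ S₁ : ℝ} (hc : 0 < c) (ht : 0 < t)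
    (hN : 0 < N) (hcn : 2 * c ^ 2 = n) (hNn : N ^ 2 = 2 * n + 1)
    (hct : c * t ≤ 3925 / 10000) (h2 : n ≤ 11 ∨ t ^ 2 * (2 * n + 1) ^ 3 ≤ 17 ^ 2)
    (hS₀n : Real.pi * S₀ ^ 2 ≤ n + 1) (hS₁ : S₁ ≤ 2 * n * S₀) :
    7 / (100 * Real.pi) * (c * t) ^ 5
      + 3 * (2 * n + 1) ^ 2 * (t ^ 5 / 10 * S₀ + t ^ 7 / 126 * S₁)
      ≤ 17 / 10 * (34 * t ^ 3 / N) := by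
  have hπ := Real.pi_gt_d4
  have hτ : (n : ℝ) * t ^ 2 ≤ 2 * (3925 / 10000) ^ 2 := by
    rw [← hcn]
    have : (c * t) ^ 2 ≤ (3925 / 10000) ^ 2 := by gcongr
    linarith
  have hnum := small_numeric hn (sq_nonneg t) hτ h2
  -- An upper bound for N·S₀ linear in n: 0.5643 exceeds 1/√π, and 1.4143n + 1.0643 exceeds
  -- √((2n+1)(n+1)).
  set ρ : ℝ := 5643 / 10000 * (14143 / 10000 * n + 10643 / 10000) with hρ
  have hρ0 : 0 ≤ ρ := by positivity
  have hNS : N * S₀ ≤ ρ := by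
    refine le_of_sq_le_sq ?_ hρ0
    have h3 : (N * S₀) ^ 2 * 3.1415 ≤ (2 * n + 1) * (n + 1) := by
      calc (N * S₀) ^ 2 * 3.1415 = (2 * n + 1) * (3.1415 * S₀ ^ 2) := by rw [mul_pow, hNn]; ring
        _ ≤ (2 * n + 1) * (Real.pi * S₀ ^ 2) := by gcongr
        _ ≤ _ := by gcongr
    rw [hρ]
    nlinarith [(Nat.cast_nonneg n : (0 : ℝ) ≤ n), sq_nonneg (n : ℝ)]
  have hNc : N * c ^ 5 ≤ n ^ 2 * (2 * n + 1) / 8 := by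
    have h3 : c ≤ N / 2 := by
      refine le_of_sq_le_sq ?_ (by positivity)
      rw [div_pow, hNn]; linarith
    calc N * c ^ 5 = (n / 2) ^ 2 * (N * c) := by rw [← hcn]; ring
      _ ≤ (n / 2) ^ 2 * (N * (N / 2)) := by gcongr
      _ = (n / 2) ^ 2 * (N ^ 2 / 2) := by ring
      _ = _ := by rw [hNn]; ring
  have hcoef : 7 / (100 * Real.pi) ≤ 7 / 300 := by
    apply div_le_div_of_nonneg_left <;> linarith
  rw [← mul_div_assoc, le_div_iff₀ hN]
  calc _ ≤ (7 / 300 * (c * t) ^ 5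
        + 3 * (2 * n + 1) ^ 2 * (t ^ 5 / 10 * S₀ + t ^ 7 / 126 * (2 * n * S₀))) * N := by gcongr
    _ = t ^ 3 * (7 / 300 * (N * c ^ 5 * t ^ 2)
        + 3 * (2 * n + 1) ^ 2 * (N * S₀) * (t ^ 2 / 10 + (t ^ 2) ^ 2 * n / 63)) := by ring
    _ ≤ t ^ 3 * (7 / 300 * (n ^ 2 * (2 * n + 1) / 8 * t ^ 2)
        + 3 * (2 * n + 1) ^ 2 * ρ * (t ^ 2 / 10 + (t ^ 2) ^ 2 * n / 63)) := by gcongr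
    _ ≤ t ^ 3 * (289 / 5) := by gcongr
    _ = _ := by ring

theorem norm_sub_hermiteProj_le_of_small {α : ℝ} (hα : 0 < α) {n : ℕ} (hn : 1 ≤ n) {T c N : ℝ}
    (hT : 0 < T) (hc : 0 < c) (hcn : 2 * c ^ 2 = n) (hN : 0 < N) (hNn : N ^ 2 = 2 * n + 1)
    (hct : c * (T / α) ≤ 3925 / 10000)
    (h2 : n ≤ 11 ∨ (T / α) ^ 2 * (2 * n + 1) ^ 3 ≤ 17 ^ 2) (f : Lp ℂ 2 (volume : Measure ℝ)) :
    ‖timeProj T (f - hermiteProj hα n f)‖ ≤ ‖f - timeProj T f‖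
      + ‖f - bandProj (c / (2 * Real.pi * α)) f‖ + 34 * (T / α) ^ 3 / N * ‖f‖ := by
  have hn' : (1 : ℝ) ≤ n := by exact_mod_cast hn
  have hπ := Real.pi_gt_d4
  have ht : 0 < T / α := by positivity
  have hw : timeProj T (timeProj T f) = timeProj T f := (timeProj_isOrthoProj T).idem f
  -- Puts x/α in [-1, 1], where the Taylor bounds for Hermite functions hold.
  have hTα : T ≤ α := by
    have hc2 : 7 / 10 ≤ c := by nlinarith
    have : T / α ≤ 1 := by nlinarith
    exact (div_le_one hα).1 this
  set w := timeProj T f with hwd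
  refine norm_proj_sub_le_of_dominated (timeProj_isOrthoProj T) (bandProj_isOrthoProj _)
    (hermiteProj_isOrthoProj hα n) (by positivity) f ?_ ?_
  · have h := norm_sq_bandProj_timeProj_le hα hc.le hT.le hw
    -- The threshold 0.3925 is chosen just below π/8 for this inequality.
    have h3 : 4 * (2 * (c * (T / α)) / Real.pi) ≤ 1 := by
      rw [← mul_div_assoc, div_le_one Real.pi_pos]; linarith
    calc 4 * ‖bandProj (c / (2 * Real.pi * α)) w‖ ^ 2
        ≤ 4 * (2 * (c * (T / α)) / Real.pi * ‖w‖ ^ 2) := by gcongr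
      _ = 4 * (2 * (c * (T / α)) / Real.pi) * ‖w‖ ^ 2 := by ring
      _ ≤ 1 * ‖w‖ ^ 2 := by gcongr
      _ = _ := one_mul _
  · obtain ⟨S₀, hS₀⟩ : ∃ S₀, S₀ = ∑ k ∈ Finset.range (n + 1), hermiteFun k 0 ^ 2 := ⟨_, rfl⟩
    obtain ⟨S₁, hS₁⟩ : ∃ S₁, S₁ = ∑ k ∈ Finset.range (n + 1), hermiteDeriv k 0 ^ 2 := ⟨_, rfl⟩
    have hS₀0 : 0 ≤ S₀ := by rw [hS₀]; exact Finset.sum_nonneg fun k _ => sq_nonneg _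
    have hS₁0 : 0 ≤ S₁ := by rw [hS₁]; exact Finset.sum_nonneg fun k _ => sq_nonneg _
    have hb := sum_range_hermiteFun_zero_sq_bounds n
    have hb1 := sum_range_hermiteDeriv_zero_sq_ge n
    rw [← hS₀] at hb
    rw [← hS₁] at hb1
    have hS₁le : S₁ ≤ 2 * n * S₀ := by
      rw [hS₁, sum_hermiteDeriv_zero_sq, hS₀, Finset.mul_sum, Finset.sum_range_succ]
      refine le_add_of_le_of_nonneg (Finset.sum_le_sum fun k hk => ?_) (by positivity)
      have : (k : ℝ) + 1 ≤ n := by exact_mod_cast Finset.mem_range.1 hk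
      gcongr
    -- Zeroth moment: squared, with 2c² = n, the diagonal bound πS₀² ≥ 5n/8 beats the factor 7/5
    -- against 3/4. `hB` is the analogue for the first moment.
    have hA : 7 / 5 * (c / Real.pi) ≤ 3 / 4 * S₀ := by
      rw [← mul_div_assoc, div_le_iff₀ Real.pi_pos]
      refine le_of_sq_le_sq ?_ (by positivity)
      calc (7 / 5 * c) ^ 2 ≤ 9 / 16 * (3.1415 * (5 / 8 * (2 * c ^ 2))) := by nlinarith [sq_nonneg c]
        _ ≤ 9 / 16 * (Real.pi * (Real.pi * S₀ ^ 2)) := by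
            rw [hcn]
            have := mul_le_mul hπ.le hb.1 (by positivity) Real.pi_pos.le
            linarith
        _ = _ := by ring
    have hB : 7 / 5 * (c ^ 3 / (3 * Real.pi)) ≤ 3 / 4 * S₁ := by
      rw [← mul_div_assoc, div_le_iff₀ (by positivity)]
      refine le_of_sq_le_sq ?_ (by positivity)
      have h6 : (0 : ℝ) ≤ c ^ 6 := by positivity
      calc (7 / 5 * c ^ 3) ^ 2 ≤ 81 / 16 * (3.1415 * (5 / 9 * (2 * c ^ 2) ^ 3 / 8)) := by
            nlinarith
        _ ≤ 81 / 16 * (Real.pi * (Real.pi * S₁ ^ 2)) := by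
            rw [hcn]; gcongr; linarith
        _ = _ := by ring
    have hQ := norm_sq_bandProj_le_moments hα hc.le hT.le hw
    have hK := norm_sq_hermiteProj_ge hα hT.le hTα hw n hS₀ hS₁
    have hE := small_error_le hn hc ht hN hcn hNn hct h2 hb.2 hS₁le
    set A := ‖∫ x, w x‖ ^ 2
    set B := ‖∫ x, w x * ((x / α : ℝ) : ℂ)‖ ^ 2
    set t := T / α
    have hA0 : 0 ≤ A := by positivity
    have hB0 : 0 ≤ B := by positivity
    have hW0 : 0 ≤ ‖w‖ ^ 2 := by positivity
    have h5 := mul_le_mul_of_nonneg_right hE hW0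
    have h6 := mul_le_mul_of_nonneg_right hA hA0
    have h7 := mul_le_mul_of_nonneg_right hB hB0
    refine le_of_mul_le_mul_left ?_ hα
    calc α * ‖bandProj (c / (2 * Real.pi * α)) w‖ ^ 2
        ≤ α * (7 / 5 * (c / (Real.pi * α) * A + c ^ 3 / (3 * Real.pi * α) * B)
          + 7 / (100 * Real.pi) * (c * t) ^ 5 * ‖w‖ ^ 2) := by gcongr
      _ = 7 / 5 * (c / Real.pi) * A + 7 / 5 * (c ^ 3 / (3 * Real.pi)) * B
          + α * (7 / (100 * Real.pi) * (c * t) ^ 5 * ‖w‖ ^ 2) := by field_simp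
      _ ≤ 3 / 4 * S₀ * A + 3 / 4 * S₁ * B
          + α * (7 / (100 * Real.pi) * (c * t) ^ 5 * ‖w‖ ^ 2) := by linarith
      _ ≤ α * ‖hermiteProj hα n w‖ ^ 2 + α * ((7 / (100 * Real.pi) * (c * t) ^ 5
          + 3 * (2 * n + 1) ^ 2 * (t ^ 5 / 10 * S₀ + t ^ 7 / 126 * S₁)) * ‖w‖ ^ 2) := by linarith
      _ ≤ α * ‖hermiteProj hα n w‖ ^ 2 + α * (17 / 10 * (34 * t ^ 3 / N) * ‖w‖ ^ 2) := by gcongr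
      _ = _ := by ring

end SmallCase

/-! ### Case distinction and passage to the stated norms -/

section Main

/-- The operator form of the estimate: the Hermite projection against the time and band
projections, with the band adapted to the degree. -/
theorem norm_timeProj_sub_hermiteProj_le {α : ℝ} (hα : 0 < α) {n : ℕ} (hn : 1 ≤ n) {T c : ℝ}
    (hT : 0 < T) (hc : 0 < c) (hcn : 2 * c ^ 2 = n) (f : Lp ℂ 2 (volume : Measure ℝ)) :
    ‖timeProj T (f - hermiteProj hα n f)‖ ≤ ‖f - timeProj T f‖
      + ‖f - bandProj (c / (2 * Real.pi * α)) f‖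
      + 34 * (T / α) ^ 3 / √(2 * (n : ℝ) + 1) * ‖f‖ := by
  have hNn : √(2 * (n : ℝ) + 1) ^ 2 = 2 * n + 1 := Real.sq_sqrt (by positivity)
  have hN : 0 < √(2 * (n : ℝ) + 1) := by positivity
  set N := √(2 * (n : ℝ) + 1)
  have ht : 0 < T / α := by positivity
  -- If 34t³ ≥ N, the allowance alone covers the contraction bound ‖P(f - Kf)‖ ≤ ‖f‖.
  rcases le_or_gt N (34 * (T / α) ^ 3) with htriv | h34
  · have h1 : ‖timeProj T (f - hermiteProj hα n f)‖ ≤ 1 * ‖f‖ := by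
      rw [one_mul]
      exact ((timeProj_isOrthoProj T).norm_le _).trans ((hermiteProj_isOrthoProj hα n).norm_compl_le f)
    have h2 : 1 * ‖f‖ ≤ 34 * (T / α) ^ 3 / N * ‖f‖ := by
      gcongr
      rwa [le_div_iff₀ hN, one_mul]
    linarith [norm_nonneg (f - timeProj T f), norm_nonneg (f - bandProj (c / (2 * Real.pi * α)) f)]
  rcases lt_or_ge 40 (T / α * N) with h40 | h40
  · exact norm_sub_hermiteProj_le_of_large hα hT hc hcn hN hNn h40 h34 f
  rcases le_or_gt n 11 with hn11 | hn12
  · rcases le_or_gt (c * (T / α)) (3925 / 10000) with hct | hct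
    · exact norm_sub_hermiteProj_le_of_small hα hn hT hc hcn hN hNn hct (Or.inl hn11) f
    · have hn2 : 2 ≤ n := by
        by_contra hcon
        obtain rfl : n = 1 := by omega
        norm_num at hcn hNn
        have hN2 : N ≤ 18 / 10 := by nlinarith
        have hc2 : c ≤ 8 / 10 := by nlinarith
        have ht2 : T / α < 4 / 10 := by
          by_contra! h
          have : (4 / 10 : ℝ) ^ 3 ≤ (T / α) ^ 3 := by gcongr
          linarith
        nlinarith
      exact norm_sub_hermiteProj_le_of_loss_numeric hα hn2 hT hc hcn hN hNn h40
        (loss_numeric_small hn2 hn11 hc hcn hct.le) f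
  · rcases le_or_gt ((T / α) ^ 2 * (2 * (n : ℝ) + 1) ^ 3) (17 ^ 2) with hs | hs
    · have hn' : (12 : ℝ) ≤ n := by exact_mod_cast hn12
      -- As 2n+1 ≥ 25, the hypothesis yields t²(2n+1) ≤ 17²/25², hence ct ≤ 17/50.
      have hct : c * (T / α) ≤ 3925 / 10000 := by
        refine le_of_sq_le_sq ?_ (by norm_num)
        have h1 : (T / α) ^ 2 * (2 * n + 1) * 625 ≤ 17 ^ 2 := by
          refine le_trans ?_ hs
          calc (T / α) ^ 2 * (2 * (n : ℝ) + 1) * 625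
              = (T / α) ^ 2 * ((2 * (n : ℝ) + 1) * 25 ^ 2) := by ring
            _ ≤ (T / α) ^ 2 * ((2 * (n : ℝ) + 1) * (2 * (n : ℝ) + 1) ^ 2) := by
                gcongr
                linarith
            _ = _ := by ring
        have h2 : (c * (T / α)) ^ 2 = (T / α) ^ 2 * n / 2 := by rw [← hcn]; ring
        rw [h2]
        nlinarith [sq_nonneg (T / α)]
      exact norm_sub_hermiteProj_le_of_small hα hn hT hc hcn hN hNn hct (Or.inr hs) f
    · exact norm_sub_hermiteProj_le_of_loss_numeric hα (by omega) hT hc hcn hN hNn h40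
        (loss_numeric_large hn12 hc hcn hs.le) f

theorem eLpNorm_restrict_Icc_eq (T : ℝ) {g : ℝ → ℂ} {h : Lp ℂ 2 (volume : Measure ℝ)}
    (hg : h =ᵐ[volume] g) :
    eLpNorm g 2 (volume.restrict (Set.Icc (-T) T)) = ENNReal.ofReal ‖timeProj T h‖ := by
  rw [Lp.norm_def, ENNReal.ofReal_toReal (Lp.eLpNorm_ne_top _),
    ← eLpNorm_indicator_eq_eLpNorm_restrict measurableSet_Icc, ← setOf_abs_le_eq_Icc]
  refine eLpNorm_congr_ae ?_
  filter_upwards [timeProj_ae T h, hg] with x h1 h2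
  rw [h1, h2]
  by_cases hx : |x| ≤ T <;> simp [intervalInd, hx]

end Main

theorem mainTheorem10 (α T c εT εc : ℝ) (hα : 0 < α) (hT : 2 ≤ T) (hc : 2 / α ≤ c)
    (hεT : 0 ≤ εT) (hεc : 0 ≤ εc) (f : Lp ℂ 2 (volume : Measure ℝ))
    (hfT : IsAlmostTimeLimited f εT T) (hfc : IsAlmostBandLimited f εc (c / α))
    (n : ℕ) (hn : max (2 * (T / α) ^ 2) (2 * c ^ 2) ≤ (n : ℝ)) :
    eLpNorm (fun x => f x - scaledHermiteProj α n f x) 2 (volume.restrict (Set.Icc (-T) T)) ≤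
      ENNReal.ofReal ((εT + εc + 34 * (T / α) ^ 3 / √(2 * (n : ℝ) + 1)) * ‖f‖) := by
  have hT0 : 0 < T := by linarith
  have hc0 : 0 < c := lt_of_lt_of_le (by positivity) hc
  have hcn : 2 * c ^ 2 ≤ n := (le_max_right _ _).trans hn
  have hn0 : (0 : ℝ) < n := lt_of_lt_of_le (by positivity) hcn
  have hn1 : 1 ≤ n := by exact_mod_cast hn0
  have hg : f - hermiteProj hα n f =ᵐ[volume] fun x => f x - scaledHermiteProj α n f x := by
    filter_upwards [Lp.coeFn_sub f (hermiteProj hα n f), hermiteProj_ae hα n f] with x h1 h2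
    rw [h1, Pi.sub_apply, h2]
  rw [eLpNorm_restrict_Icc_eq T hg]
  refine ENNReal.ofReal_le_ofReal ?_
  -- The widened band half-width, with 2d² = n exactly; d ≥ c because 2c² ≤ n, so the band defect
  -- does not grow.
  set d := √((n : ℝ) / 2) with hd
  have hd0 : 0 < d := by positivity
  have hd2 : d ^ 2 = n / 2 := Real.sq_sqrt (by positivity)
  have hcd : c ≤ d := Real.le_sqrt_of_sq_le (by linarith)
  have h := norm_timeProj_sub_hermiteProj_le hα hn1 hT0 hd0 (by linarith) f
  have h1 := hfT.norm_sub_le hεT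
  have h2 := hfc.norm_sub_le hεc
  have h3 : ‖f - bandProj (d / (2 * Real.pi * α)) f‖ ≤ ‖f - bandProj (c / α / (2 * Real.pi)) f‖ := by
    refine norm_sub_bandProj_mono ?_ f
    rw [div_div, mul_comm α]
    gcongr
  linarith
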